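/- Let $\chi\in\mathcal D(\mathbb R)$ be a real-valued cut-off, $\sigma>0$, let $\alpha(x,t),\beta(x,t)$ be real polynomials in $x$ with coefficients smooth in $t$, and put $\beta_1:=\partial_x\beta$. Let $x_0\in C^\infty(\mathbb R)$ (for instance a constant). Let $G(t,t'):=\vartheta(t-t')$ be the Heaviside kernel, with the convention $G(t,t):=0$. For $\xi\in C^\infty(\mathbb R)$ let $x_\xi$ be the unique formal power series in the cut-off $\chi$ (every explicit factor $\chi$ counts as one order) which solves $$x_\xi(t)=x_0(t)+\int_{\mathbb R}G(t,s)\,\chi(s)\big[\alpha(x_\xi(s),s)+\beta(x_\xi(s),s)\sqrt\sigma\,\xi(s)\big]\,ds .$$ Let $F$ be a multilocal polynomial functional of $x$, i.e. for some $k\ge 0$ (a general one is a finite sum of these) its integral kernel is a polynomial in $x(t_1),\dots,x(t_k)$ with complex coefficients smooth in $(t_1,\dots,t_k)$; as a distribution it is tested against $f\in\mathcal D(\mathbb R^k)$. Define $$\Gamma_{\delta/2}:=\exp\Upsilon_{\delta/2},\quad \Upsilon_{\delta/2}(\Phi):=\frac12\int_{\mathbb R}\frac{\delta^2\Phi}{\delta\xi(s)^2}\,ds,\qquad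 \Gamma_G:=\exp\Upsilon_G,\quad \Upsilon_G(\Psi):=\int_{\mathbb R^2}G(t,t')\frac{\delta^2\Psi}{\delta x(t)\,\delta\tilde x(t')}\,dt\,dt',$$ acting respectively on polynomial functionals of $\xi$ and of $(x,\tilde x)$ that are smeared with test functions. The kernels of the functional derivatives are obtained as limits of Gateaux derivatives along smooth approximations of Dirac deltas; the part of $\delta^2\Psi/\delta x(t)\delta\tilde x(t')$ concentrated on $t=t'$ does not contribute because $G(t,t)=0$. Let $$\langle V\rangle:=\int_{\mathbb R}\Big[\tilde x\big(\chi\alpha(x,t)+\tfrac12\sigma\chi^2\,\beta(x,t)\beta_1(x,t)\big)+\tfrac{\sigma}{2}\chi^2\,\tilde x^2\beta(x,t)^2\Big]dt .$$ Assume that either $\beta=1$ (purely additive case) or $\alpha=0$ (purely multiplicative case, Stratonovich convention). Then, as formal power series in $\chi$ with distributional coefficients, i.e. at each order in $\chi$ and after pairing with any $f\in\mathcal D(\mathbb R^k)$, $$\Gamma_{\delta/2}\big[F(x_\xi)\big]\Big|_{\xi=0}=\Gamma_G\big[e^{\langle V\rangle}F\big]\Big|_{x=x_0,\ \tilde x=0}.$$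 -/

import Mathlib

open scoped ContDiff

noncomputable section

namespace MSR

/-! ### Smooth functions, configurations, polynomials with smooth coefficients -/

/-- The algebra `C^∞(E)` of smooth `A`-valued functions on `E`. -/
def smoothFns (E : Type) [NormedAddCommGroup E] [NormedSpace ℝ E]
    (A : Type) [NormedCommRing A] [NormedAlgebra ℝ A] : Subalgebra ℝ (E → A) where
  carrier := {u | ContDiff ℝ ∞ u}
  mul_mem' {u v} (hu : ContDiff ℝ ∞ u) (hv : ContDiff ℝ ∞ v) :=
    show ContDiff ℝ ∞ (u * v) from hu.mul hv
  add_mem' {u v} (hu : ContDiff ℝ ∞ u) (hv : ContDiff ℝ ∞ v) :=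
    show ContDiff ℝ ∞ (u + v) from hu.add hv
  algebraMap_mem' r := show ContDiff ℝ ∞ (fun _ : E => algebraMap ℝ A r) from contDiff_const

/-- Configurations: elements of `C^∞(ℝ)`. -/
abbrev Config : Type := smoothFns ℝ ℝ

/-- Evaluation of a smooth function at a point, as a ring homomorphism. -/
def evalAt {E : Type} [NormedAddCommGroup E] [NormedSpace ℝ E]
    {A : Type} [NormedCommRing A] [NormedAlgebra ℝ A] (p : E) : smoothFns E A →+* A :=
  (Pi.evalRingHom (fun _ : E => A) p).comp (smoothFns E A).subtype

/-- `α(x, t)` for a polynomial `α` in `x` with coefficients depending smoothly on `t`. -/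
def polyEval (α : Polynomial Config) (x t : ℝ) : ℝ := α.eval₂ (evalAt t) x

/-- `α(y, t)` for a formal power series `y`, as a formal power series. -/
def polyEvalSeries (α : Polynomial Config) (y : PowerSeries ℝ) (t : ℝ) : PowerSeries ℝ :=
  α.eval₂ ((PowerSeries.C (R := ℝ)).comp (evalAt t)) y

/-- The kernel `G(t, t') = ϑ(t - t')` of the Heaviside function with `G(t, t) = 0`. -/
def G (t t' : ℝ) : ℝ := if t' < t then 1 else 0

/-! ### Functional derivatives

Functionals are maps from configurations to `ℂ`. The kernel of the second functional derivative is
the second Gateaux derivative in the direction of two point masses, which are approximated by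
mollifiers. -/

/-- A smooth nonnegative mollifier of integral one, supported in `[s - 2/(n+1), s + 2/(n+1)]`. -/
def approxDelta (s : ℝ) (n : ℕ) : Config :=
  let φ : ContDiffBump s :=
    { rIn := 1 / ((n : ℝ) + 1)
      rOut := 2 / ((n : ℝ) + 1)
      rIn_pos := by positivity
      rIn_lt_rOut := by
        have h : (0 : ℝ) < (n : ℝ) + 1 := by positivity
        exact (div_lt_div_iff_of_pos_right h).2 one_lt_two }
  ⟨φ.normed MeasureTheory.volume, φ.contDiff_normed⟩

/-- `δ²Φ / δξ(s) δξ(s')` at `ξ`. -/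
def funDeriv₂ (Φ : Config → ℂ) (ξ : Config) (s s' : ℝ) : ℂ :=
  Filter.limUnder Filter.atTop fun n : ℕ =>
    deriv (fun a : ℝ =>
      deriv (fun b : ℝ => Φ (ξ + a • approxDelta s n + b • approxDelta s' n)) 0) 0

/-- `δ²Ψ / δx(t) δx̃(t')` at `(x, x̃)`, for `t ≠ t'`. -/
def mixedDeriv (Ψ : Config → Config → ℂ) (x x' : Config) (t t' : ℝ) : ℂ :=
  Filter.limUnder Filter.atTop fun n : ℕ =>
    deriv (fun a : ℝ =>
      deriv (fun b : ℝ => Ψ (x + a • approxDelta t n) (x' + b • approxDelta t' n)) 0) 0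

/-! ### The deformation maps -/

/-- `Υ_{δ/2}(Φ) = ½ ∫∫ δ(s - s') δ²Φ / δξ(s) δξ(s') ds ds'`. -/
def upsilonDelta (Φ : Config → ℂ) : Config → ℂ :=
  fun ξ => (1 / 2 : ℂ) * ∫ s : ℝ, funDeriv₂ Φ ξ s s

/-- `Γ_{δ/2} = exp Υ_{δ/2}`; on polynomial functionals only finitely many terms are nonzero. -/
def gammaDelta (Φ : Config → ℂ) : Config → ℂ :=
  fun ξ => ∑' m : ℕ, ((m.factorial : ℂ))⁻¹ * (upsilonDelta^[m] Φ) ξ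

/-- `Υ_G(Ψ) = ∫∫ G(t, t') δ²Ψ / δx(t) δx̃(t') dt dt'`. Since `G(t, t) = 0`, the part of the second
derivative that is concentrated on the diagonal does not contribute, and only its density off the
diagonal enters. -/
def upsilonG (Ψ : Config → Config → ℂ) : Config → Config → ℂ :=
  fun x x' => ∫ p : ℝ × ℝ, (G p.1 p.2 : ℂ) * mixedDeriv Ψ x x' p.1 p.2

/-- `Γ_G = exp Υ_G`; on polynomial functionals only finitely many terms are nonzero. -/
def gammaG (Ψ : Config → Config → ℂ) : Config → Config → ℂ :=
  fun x x' => ∑' m : ℕ, ((m.factorial : ℂ))⁻¹ * (upsilonG^[m] Ψ) x x'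

/-! ### Multilocal functionals -/

/-- `k`-point multilocal polynomial functionals of `x`: their integral kernel is a polynomial in
`x(t₁), …, x(t_k)` whose coefficients are smooth functions of `(t₁, …, t_k)`. -/
abbrev Multilocal (k : ℕ) : Type := MvPolynomial (Fin k) (smoothFns (Fin k → ℝ) ℂ)

/-- `⟨F(x), f⟩ = ∫ f(t) F(t; x(t₁), …, x(t_k)) dt`. -/
def smeared {k : ℕ} (F : Multilocal k) (f : (Fin k → ℝ) → ℂ) (x : Config) : ℂ :=
  ∫ t : Fin k → ℝ, f t * F.eval₂ (evalAt t) (fun i => (((x : ℝ → ℝ) (t i) : ℝ) : ℂ))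

/-! ### The algebraic SDE side

The variable of the power series counts the order in the cut-off `χ`. -/

/-- `x_ξ` is a formal power series in the cut-off solving
`x_ξ = x₀ + G * χ (α(x_ξ) + β(x_ξ) √σ ξ)`. -/
def IsPerturbativeSolution (χ : ℝ → ℝ) (σ : ℝ) (α β : Polynomial Config) (x₀ : Config)
    (sol : Config → ℝ → PowerSeries ℝ) : Prop :=
  ∀ (ξ : Config) (t : ℝ), sol ξ t =
    PowerSeries.C ((x₀ : ℝ → ℝ) t) + PowerSeries.X * PowerSeries.mk fun n =>
      ∫ s : ℝ, G t s * (χ s * PowerSeries.coeff n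
        (polyEvalSeries α (sol ξ s) s
          + PowerSeries.C (√σ * (ξ : ℝ → ℝ) s) * polyEvalSeries β (sol ξ s) s))

theorem X_pow_dvd_polyEvalSeries_sub (α : Polynomial Config) (y z : PowerSeries ℝ) (t : ℝ) (n : ℕ)
    (h : PowerSeries.X ^ n ∣ y - z) :
    PowerSeries.X ^ n ∣ polyEvalSeries α y t - polyEvalSeries α z t := by
  unfold polyEvalSeries
  rw [← Polynomial.eval_map, ← Polynomial.eval_map]
  exact h.trans (Polynomial.sub_dvd_eval_sub _ _ _)

theorem coeff_rhs_congr (α β : Polynomial Config) (c : ℝ) (y z : PowerSeries ℝ) (t : ℝ) (n : ℕ)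
    (h : ∀ m < n + 1, PowerSeries.coeff m y = PowerSeries.coeff m z) :
    PowerSeries.coeff n (polyEvalSeries α y t + PowerSeries.C c * polyEvalSeries β y t)
      = PowerSeries.coeff n (polyEvalSeries α z t + PowerSeries.C c * polyEvalSeries β z t) := by
  have hd : PowerSeries.X ^ (n + 1) ∣ y - z :=
    PowerSeries.X_pow_dvd_iff.2 fun m hm => by rw [map_sub, h m hm, sub_self]
  have ha := PowerSeries.X_pow_dvd_iff.1 (X_pow_dvd_polyEvalSeries_sub α y z t _ hd) n (by omega)
  have hb := PowerSeries.X_pow_dvd_iff.1 (X_pow_dvd_polyEvalSeries_sub β y z t _ hd) n (by omega)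
  rw [map_sub, sub_eq_zero] at ha hb
  rw [map_add, map_add, PowerSeries.coeff_C_mul, PowerSeries.coeff_C_mul, ha, hb]

/-- Picard iterates of the integral equation. -/
def picard (χ : ℝ → ℝ) (σ : ℝ) (α β : Polynomial Config) (x₀ ξ : Config) :
    ℕ → ℝ → PowerSeries ℝ
  | 0 => fun t => PowerSeries.C ((x₀ : ℝ → ℝ) t)
  | m + 1 => fun t =>
    PowerSeries.C ((x₀ : ℝ → ℝ) t) + PowerSeries.X * PowerSeries.mk fun n =>
      ∫ s : ℝ, G t s * (χ s * PowerSeries.coeff n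
        (polyEvalSeries α (picard χ σ α β x₀ ξ m s) s
          + PowerSeries.C (√σ * (ξ : ℝ → ℝ) s) * polyEvalSeries β (picard χ σ α β x₀ ξ m s) s))

theorem picard_succ (χ : ℝ → ℝ) (σ : ℝ) (α β : Polynomial Config) (x₀ ξ : Config) (m : ℕ) (t : ℝ) :
    picard χ σ α β x₀ ξ (m + 1) t =
    PowerSeries.C ((x₀ : ℝ → ℝ) t) + PowerSeries.X * PowerSeries.mk fun n =>
      ∫ s : ℝ, G t s * (χ s * PowerSeries.coeff n
        (polyEvalSeries α (picard χ σ α β x₀ ξ m s) s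
          + PowerSeries.C (√σ * (ξ : ℝ → ℝ) s) * polyEvalSeries β (picard χ σ α β x₀ ξ m s) s)) :=
  rfl

theorem coeff_picard_succ (χ : ℝ → ℝ) (σ : ℝ) (α β : Polynomial Config) (x₀ ξ : Config)
    (m : ℕ) : ∀ n ≤ m, ∀ t, PowerSeries.coeff n (picard χ σ α β x₀ ξ (m + 1) t)
      = PowerSeries.coeff n (picard χ σ α β x₀ ξ m t) := by
  induction m with
  | zero =>
    intro n hn t
    obtain rfl : n = 0 := by omega
    simp [picard]
  | succ m ih =>
    intro n hn t
    rw [picard_succ _ _ _ _ _ _ (m + 1), picard_succ _ _ _ _ _ _ m, map_add, map_add]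
    congr 1
    cases n with
    | zero => simp
    | succ n =>
      rw [PowerSeries.coeff_succ_X_mul, PowerSeries.coeff_succ_X_mul, PowerSeries.coeff_mk,
        PowerSeries.coeff_mk]
      congr 1
      funext s
      rw [coeff_rhs_congr α β _ _ _ s n fun j hj => ih j (by omega) s]

/-- The perturbative solution exists. -/
theorem exists_isPerturbativeSolution (χ : ℝ → ℝ) (σ : ℝ) (α β : Polynomial Config)
    (x₀ : Config) : ∃ sol, IsPerturbativeSolution χ σ α β x₀ sol := by
  have stab : ∀ (ξ : Config) (n m : ℕ), n ≤ m → ∀ s,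
      PowerSeries.coeff n (picard χ σ α β x₀ ξ m s)
        = PowerSeries.coeff n (picard χ σ α β x₀ ξ n s) := by
    intro ξ n m hnm
    induction m, hnm using Nat.le_induction with
    | base => intro s; rfl
    | succ m hm ih => intro s; rw [coeff_picard_succ χ σ α β x₀ ξ m n hm s, ih s]
  refine ⟨fun ξ t => PowerSeries.mk fun n =>
    PowerSeries.coeff n (picard χ σ α β x₀ ξ n t), fun ξ t => ?_⟩
  ext n
  cases n with
  | zero => simp [picard]
  | succ n =>
    rw [PowerSeries.coeff_mk, picard, map_add, map_add]
    congr 1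
    rw [PowerSeries.coeff_succ_X_mul, PowerSeries.coeff_succ_X_mul, PowerSeries.coeff_mk,
      PowerSeries.coeff_mk]
    congr 1
    funext s
    rw [coeff_rhs_congr α β _ _ _ s n fun j hj => by
      rw [PowerSeries.coeff_mk, stab ξ j n (by omega) s]]

/-- The perturbative solution is unique. -/
theorem IsPerturbativeSolution.unique {χ : ℝ → ℝ} {σ : ℝ} {α β : Polynomial Config}
    {x₀ : Config} {y z : Config → ℝ → PowerSeries ℝ}
    (hy : IsPerturbativeSolution χ σ α β x₀ y) (hz : IsPerturbativeSolution χ σ α β x₀ z) :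
    y = z := by
  have key : ∀ (ξ : Config) (n : ℕ) (t : ℝ),
      PowerSeries.coeff n (y ξ t) = PowerSeries.coeff n (z ξ t) := by
    intro ξ n
    induction n using Nat.strong_induction_on with
    | _ n ih =>
      intro t
      rw [hy ξ t, hz ξ t, map_add, map_add]
      congr 1
      cases n with
      | zero => simp
      | succ n =>
        rw [PowerSeries.coeff_succ_X_mul, PowerSeries.coeff_succ_X_mul, PowerSeries.coeff_mk,
          PowerSeries.coeff_mk]
        congr 1
        funext s
        rw [coeff_rhs_congr α β _ _ _ s n fun j hj => ih j hj s]
  funext ξ t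
  ext n
  exact key ξ n t

/-- `⟨F(x_ξ), f⟩`, a formal power series whose coefficients are functionals of `ξ`. -/
def smearedSolution {k : ℕ} (F : Multilocal k) (f : (Fin k → ℝ) → ℂ)
    (sol : Config → ℝ → PowerSeries ℝ) : PowerSeries (Config → ℂ) :=
  PowerSeries.mk fun n => fun ξ =>
    ∫ t : Fin k → ℝ, f t * PowerSeries.coeff n
      (F.eval₂ ((PowerSeries.C (R := ℂ)).comp (evalAt t))
        (fun i => (sol ξ (t i)).map Complex.ofRealHom))

/-- `⟨Γ_{δ/2}[F(x_ξ)]|_{ξ = 0}, f⟩`. -/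
def sdeExpectation {k : ℕ} (F : Multilocal k) (f : (Fin k → ℝ) → ℂ)
    (sol : Config → ℝ → PowerSeries ℝ) : PowerSeries ℂ :=
  PowerSeries.mk fun n => gammaDelta (PowerSeries.coeff n (smearedSolution F f sol)) 0

/-! ### The algebraic MSR side -/

/-- The interaction `⟨V⟩ = ∫ [x̃ (χ α + ½ σ χ² β ∂ₓβ) + ½ σ χ² x̃² β²] dt`, split by its order in the
cut-off. -/
def interaction (χ : ℝ → ℝ) (σ : ℝ) (α β : Polynomial Config) :
    PowerSeries (Config → Config → ℂ) :=
  PowerSeries.X * PowerSeries.C (fun x x' : Config =>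
      ((∫ t : ℝ, (x' : ℝ → ℝ) t * (χ t * polyEval α ((x : ℝ → ℝ) t) t) : ℝ) : ℂ))
  + PowerSeries.X ^ 2 * PowerSeries.C (fun x x' : Config =>
      ((∫ t : ℝ,
        ((x' : ℝ → ℝ) t * (1 / 2 * σ * χ t ^ 2 * polyEval β ((x : ℝ → ℝ) t) t
            * polyEval (Polynomial.derivative β) ((x : ℝ → ℝ) t) t)
          + σ / 2 * χ t ^ 2 * (x' : ℝ → ℝ) t ^ 2 * polyEval β ((x : ℝ → ℝ) t) t ^ 2) : ℝ) : ℂ))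

/-- The exponential `∑ Vⁿ / n!` of a formal power series `V` without constant term, for which
`Vⁿ` has no coefficients of order below `n`. -/
def formalExp (V : PowerSeries (Config → Config → ℂ)) : PowerSeries (Config → Config → ℂ) :=
  PowerSeries.mk fun N =>
    ∑ n ∈ Finset.range (N + 1), ((n.factorial : ℂ))⁻¹ • PowerSeries.coeff N (V ^ n)

/-- `⟨Γ_G[e^{⟨V⟩} F], f⟩` at `x = x₀`, `x̃ = 0`. -/
def msrExpectation (χ : ℝ → ℝ) (σ : ℝ) (α β : Polynomial Config) (x₀ : Config)
    {k : ℕ} (F : Multilocal k) (f : (Fin k → ℝ) → ℂ) : PowerSeries ℂ :=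
  PowerSeries.mk fun N =>
    gammaG (PowerSeries.coeff N
      (formalExp (interaction χ σ α β)
        * PowerSeries.C (fun x _ : Config => smeared F f x))) x₀ 0

end MSR

end

/-! At each order in `χ` both sides are the same Dyson series: a sum over words in two kinds of
vertices, `drift` (order one) and `pair` (order two). Each word contributes an integral over
decreasing times `s₁ > s₂ > ⋯` of differential operators acting on `f F`, evaluated at `x₀`. The sum
runs over `freeWords N`.

Noise side. Stop the solution at time `τ` and differentiate a polynomial in the stopped values with
respect to `τ`. All values that still move have the same velocity `χ (α + √σ β ξ)`, so the
polynomial evolves by a first-order operator. Iterating backwards from the latest time expands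
`F(x_ξ)` in words of `drift` and `noise` (`Model.coeff_stoppedEval`). Now vary `ξ` twice at one time
`s`. If the two varied letters `noise` are not adjacent, an intermediate time is squeezed between
two equal ones and nothing survives. If they are adjacent, the time ordering selects half of the
square (`integral_mul_integral_G`). Two `noise` operators at equal times compose to `(β ∂)² = β β₁ ∂
+ β² ∂²` up to the factor `σ χ²`, which is twice the quadratic vertex of `V` including its
Stratonovich term (`Model.vertexOp_noise_noise`). Hence `Υ_{δ/2}` replaces adjacent pairs of `noise`
by `pair` (`Model.hasUpsilon_wordFn`). A word with `n` letters `pair` is reached along `n!`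
sequences of contractions, which cancels the factorial of the exponential (`wordSum_contractions`).
Setting `ξ = 0` removes every word that still contains `noise`.

Response side. For fixed fields, `e^⟨V⟩` with the time integrals cut at `τ` solves a linear
differential equation in `τ`, so its coefficients are sums of time-ordered products of vertices
(`Model.expCoeff_eq_wordSum`). On polynomial kernels `Υ_G` is the algebraic operator `C = ∑ G(j, l)
∂/∂x(j) ∂/∂x̃(l)` (`hasUpsilonG_kernelFn`); Lebesgue differentiation recovers the density of the
functional derivative. The commutator of `C` with multiplication by `x̃(l)` is the derivation `∑
G(j, l) ∂/∂x(j)`, which commutes with `C`. So `exp C` at `x̃ = 0` turns every `x̃(l)` into this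
derivation. Since `G` is retarded and vanishes on the diagonal, a vertex differentiates only fields
at strictly later times, and a time-ordered product becomes the composition of the vertex operators
met on the noise side (`hasExp_vertices`, `eval_vertexActs`). -/

noncomputable section
namespace MSR

open MeasureTheory Filter Topology Set

/-! ### Words of vertices -/

/-- The vertices of the perturbative expansion: `drift` is a vertex `α`, `noise` is a vertex `β ξ`
and `pair` is a pair of contracted `noise` vertices. -/
inductive Letter
  | drift
  | noise
  | pair

open Letter

/-- The words of order `N` in the cut-off with exactly `p` letters `pair`. -/
def pairWords : ℕ → ℕ → List (List Letter)
  | 0, 0 => [[]]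
  | 0, _ + 1 => []
  | 1, 0 => [[drift], [noise]]
  | 1, _ + 1 => []
  | N + 2, 0 => (pairWords (N + 1) 0).map (drift :: ·) ++ (pairWords (N + 1) 0).map (noise :: ·)
  | N + 2, p + 1 => (pairWords (N + 1) (p + 1)).map (drift :: ·) ++
      (pairWords (N + 1) (p + 1)).map (noise :: ·) ++ (pairWords N p).map (pair :: ·)

/-- The words of order `N` in the cut-off without letters `noise`. -/
def freeWords : ℕ → List (List Letter)
  | 0 => [[]]
  | 1 => [[drift]]
  | N + 2 => (freeWords (N + 1)).map (drift :: ·) ++ (freeWords N).map (pair :: ·)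

/-- All words obtained by replacing two adjacent letters `noise` by a letter `pair`. -/
def contractions : List Letter → List (List Letter)
  | [] => []
  | drift :: w => (contractions w).map (drift :: ·)
  | pair :: w => (contractions w).map (pair :: ·)
  | noise :: noise :: w => (contractions (noise :: w)).map (noise :: ·) ++ [pair :: w]
  | noise :: w => (contractions w).map (noise :: ·)

/-- The contraction of the two leading letters. -/
def headContraction : List Letter → List (List Letter)
  | noise :: noise :: w => [pair :: w]
  | _ => []

/-- The defining equations of `contractions` inspect two letters at once. Separating the contraction
at the head from those in the tail permits induction letter by letter. -/
theorem contractions_cons (a : Letter) (w : List Letter) :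
    contractions (a :: w) = (contractions w).map (a :: ·) ++ headContraction (a :: w) := by
  cases a
  · simp [contractions, headContraction]
  · cases w with
    | nil => simp [contractions, headContraction]
    | cons b w => cases b <;> simp [contractions, headContraction]
  · simp [contractions, headContraction]

section sums
variable {M : Type} [AddCommMonoid M]

/-- The sum of `φ` over a list of words. -/
def wordSum (φ : List Letter → M) (l : List (List Letter)) : M := (l.map φ).sum

@[simp] theorem wordSum_nil (φ : List Letter → M) : wordSum φ [] = 0 := rfl

@[simp] theorem wordSum_cons (φ : List Letter → M) (w : List Letter) (l : List (List Letter)) :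
    wordSum φ (w :: l) = φ w + wordSum φ l := by simp [wordSum]

@[simp] theorem wordSum_append (φ : List Letter → M) (l l' : List (List Letter)) :
    wordSum φ (l ++ l') = wordSum φ l + wordSum φ l' := by simp [wordSum]

@[simp] theorem wordSum_map (φ : List Letter → M) (g : List Letter → List Letter)
    (l : List (List Letter)) : wordSum φ (l.map g) = wordSum (φ ∘ g) l := by simp [wordSum]

theorem wordSum_add (φ ψ : List Letter → M) (l : List (List Letter)) :
    wordSum (fun w => φ w + ψ w) l = wordSum φ l + wordSum ψ l := by
  induction l with
  | nil => simp
  | cons w l ih => simp only [wordSum_cons, ih]; abel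

theorem wordSum_congr {φ ψ : List Letter → M} {l : List (List Letter)}
    (h : ∀ w ∈ l, φ w = ψ w) : wordSum φ l = wordSum ψ l := by
  rw [wordSum, wordSum, List.map_congr_left h]

theorem wordSum_eq_zero {φ : List Letter → M} {l : List (List Letter)}
    (h : ∀ w ∈ l, φ w = 0) : wordSum φ l = 0 := by
  induction l with
  | nil => rfl
  | cons w l ih =>
    rw [wordSum_cons, h w (by simp), ih fun v hv => h v (by simp [hv]), zero_add]

theorem wordSum_apply {ι : Type} (φ : List Letter → ι → M) (l : List (List Letter)) (i : ι) :
    wordSum φ l i = wordSum (fun w => φ w i) l := by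
  induction l with
  | nil => rfl
  | cons w l ih => simp [ih]

theorem wordSum_contractions_cons (φ : List Letter → M) (a : Letter) (w : List Letter) :
    wordSum φ (contractions (a :: w)) =
      wordSum (fun v => φ (a :: v)) (contractions w) + wordSum φ (headContraction (a :: w)) := by
  rw [contractions_cons, wordSum_append, wordSum_map]; rfl

/-- The head of `noise :: w` can be contracted only if `w` begins with `noise`, and the words of
order `N + 1` that do so are `noise :: v` with `v` of order `N` and the same number of pairs. -/
theorem wordSum_headContraction (φ : List Letter → M) (N p : ℕ) :
    wordSum (fun w => wordSum φ (headContraction (noise :: w))) (pairWords (N + 1) p) =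
      wordSum (fun w => φ (pair :: w)) (pairWords N p) := by
  cases N with
  | zero => cases p <;> simp [pairWords, headContraction]
  | succ N =>
    cases p with
    | zero => simp [pairWords, headContraction, Function.comp_def, wordSum]
    | succ p =>
      rw [pairWords]
      simp [headContraction, Function.comp_def, wordSum]

/-- Double counting. A word with `p + 1` letters `pair` is a contraction of exactly `p + 1` words
with `p` of them: split any one of its pairs into two letters `noise`. The order is unchanged
because `pair` counts twice. -/
theorem wordSum_contractions (N : ℕ) : ∀ (p : ℕ) (φ : List Letter → M),
    wordSum (fun w => wordSum φ (contractions w)) (pairWords N p) =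
      (p + 1) • wordSum φ (pairWords N (p + 1)) := by
  induction N using Nat.twoStepInduction with
  | zero => intro p φ; cases p <;> simp [pairWords, contractions]
  | one => intro p φ; cases p <;> simp [pairWords, contractions]
  | more N ih0 ih1 =>
    intro p φ
    have hd : ∀ w, wordSum φ (headContraction (drift :: w)) = 0 := fun w => by
      simp [headContraction]
    have hp : ∀ w, wordSum φ (headContraction (pair :: w)) = 0 := fun w => by
      simp [headContraction]
    cases p with
    | zero =>
      simp only [pairWords, wordSum_append, wordSum_map, Function.comp_def,
        wordSum_contractions_cons, hd, wordSum_add, wordSum_headContraction, ih1]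
      simp [wordSum, add_assoc]
    | succ p =>
      simp only [pairWords, wordSum_append, wordSum_map, Function.comp_def,
        wordSum_contractions_cons, hd, hp, wordSum_add, wordSum_headContraction, ih1, ih0]
      have h0 : wordSum (fun _ : List Letter => (0 : M)) (pairWords (N + 1) (p + 1)) = 0 :=
        wordSum_eq_zero fun _ _ => rfl
      have h0' : wordSum (fun _ : List Letter => (0 : M)) (pairWords N p) = 0 :=
        wordSum_eq_zero fun _ _ => rfl
      rw [h0, h0']
      simp only [smul_add, add_smul, one_smul, add_zero]
      abel

theorem pairWords_eq_nil (N : ℕ) : ∀ p, N < p → pairWords N p = [] := by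
  induction N using Nat.twoStepInduction with
  | zero => intro p hp; obtain ⟨p, rfl⟩ := Nat.exists_eq_succ_of_ne_zero hp.ne'; rfl
  | one => intro p hp; obtain ⟨p, rfl⟩ := Nat.exists_eq_succ_of_ne_zero (by omega : p ≠ 0); rfl
  | more N ih0 ih1 =>
    intro p hp
    obtain ⟨p, rfl⟩ := Nat.exists_eq_succ_of_ne_zero (by omega : p ≠ 0)
    simp [pairWords, ih0 p (by omega), ih1 (p + 1) (by omega)]

/-- The words without `noise` are sorted by their number of pairs. A word of order `N` has at most
`N` of them, so any range longer than `N` exhausts all cases. -/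
theorem sum_wordSum_pairWords (N : ℕ) : ∀ (m : ℕ) (φ : List Letter → M),
    N < m → (∀ w, noise ∈ w → φ w = 0) →
    ∑ p ∈ Finset.range m, wordSum φ (pairWords N p) = wordSum φ (freeWords N) := by
  induction N using Nat.twoStepInduction with
  | zero =>
    intro m φ hm h
    obtain ⟨m, rfl⟩ := Nat.exists_eq_succ_of_ne_zero (by omega : m ≠ 0)
    rw [Finset.sum_range_succ']
    simp [pairWords, freeWords]
  | one =>
    intro m φ hm h
    obtain ⟨m, rfl⟩ := Nat.exists_eq_succ_of_ne_zero (by omega : m ≠ 0)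
    rw [Finset.sum_range_succ']
    simp [pairWords, freeWords, h [noise]]
  | more N ih0 ih1 =>
    intro m φ hm h
    obtain ⟨m, rfl⟩ := Nat.exists_eq_succ_of_ne_zero (by omega : m ≠ 0)
    have hn : ∀ l, wordSum (fun w => φ (noise :: w)) l = 0 := fun l =>
      wordSum_eq_zero fun w _ => h _ (by simp)
    have h1 := ih1 (m + 1) (fun w => φ (drift :: w)) (by omega) fun w hw => h _ (by simp [hw])
    -- Removing a leading `pair` lowers the number of pairs by one, so the range shrinks to `m` here
    -- but stays `m + 1` for a leading `drift`.
    have h0 := ih0 m (fun w => φ (pair :: w)) (by omega) fun w hw => h _ (by simp [hw])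
    rw [Finset.sum_range_succ'] at h1 ⊢
    simp only [pairWords, freeWords, wordSum_append, wordSum_map, Function.comp_def, hn, add_zero,
      Finset.sum_add_distrib, ← h0, ← h1]
    abel

end sums

theorem noise_notMem_of_mem_freeWords (N : ℕ) : ∀ w ∈ freeWords N, noise ∉ w := by
  induction N using Nat.twoStepInduction with
  | zero => simp [freeWords]
  | one => simp [freeWords]
  | more N ih0 ih1 =>
    intro w hw
    simp only [freeWords, List.mem_append, List.mem_map] at hw
    rcases hw with ⟨v, hv, rfl⟩ | ⟨v, hv, rfl⟩
    · simpa using ih1 v hv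
    · simpa using ih0 v hv

theorem pairWords_zero_succ (N : ℕ) : pairWords (N + 1) 0 =
    (pairWords N 0).map (drift :: ·) ++ (pairWords N 0).map (noise :: ·) := by
  cases N <;> rfl

/-! ### Nested time integrals -/

theorem measurable_G : Measurable fun p : ℝ × ℝ => G p.1 p.2 :=
  Measurable.ite (measurableSet_lt measurable_snd measurable_fst) measurable_const
    measurable_const

theorem norm_G_le (t s : ℝ) : ‖(G t s : ℂ)‖ ≤ 1 := by
  unfold G; split_ifs <;> simp

@[simp] theorem G_self (t : ℝ) : G t t = 0 := by simp [G]

theorem G_of_lt {t s : ℝ} (h : s < t) : G t s = 1 := if_pos h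

theorem G_of_le {t s : ℝ} (h : t ≤ s) : G t s = 0 := if_neg h.not_gt

/-- The sequence with head `s` and tail `u`. -/
def cons (s : ℝ) (u : ℕ → ℝ) : ℕ → ℝ := fun n => Nat.casesOn n s u

@[simp] theorem cons_zero (s : ℝ) (u : ℕ → ℝ) : cons s u 0 = s := rfl

@[simp] theorem cons_succ (s : ℝ) (u : ℕ → ℝ) (n : ℕ) : cons s u (n + 1) = u n := rfl

theorem measurable_cons : Measurable fun p : ℝ × (ℕ → ℝ) => cons p.1 p.2 := by
  refine measurable_pi_lambda _ fun n => ?_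
  cases n with
  | zero => exact measurable_fst
  | succ n => exact (measurable_pi_apply n).comp measurable_snd

theorem continuous_cons : Continuous fun p : ℝ × (ℕ → ℝ) => cons p.1 p.2 := by
  refine continuous_pi fun n => ?_
  cases n with
  | zero => exact continuous_fst
  | succ n => exact (continuous_apply n).comp continuous_snd

/-- The weight of a letter in the presence of the noise `ξ`. -/
def weight (ξ : ℝ → ℂ) : Letter → ℝ → ℂ
  | noise => ξ
  | _ => 1

/-- The derivative of the weight of a letter in the direction `η`. -/
def dweight (η : ℝ → ℂ) : Letter → ℝ → ℂ
  | noise => η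
  | _ => 0

/-- Lebesgue measure on `[-R, R]`. -/
def slab (R : ℝ) : Measure ℝ := volume.restrict (Icc (-R) R)

instance (R : ℝ) : IsFiniteMeasure (slab R) := by
  unfold slab
  exact ⟨by simp [Measure.restrict_apply]⟩

/-- The coefficient of `z ^ j` in the integral over `τ > s₁ > s₂ > ⋯` of the kernel `c` times
`ξ + z η` at each letter `noise`. -/
def nest (R : ℝ) (ξ η : ℝ → ℂ) : List Letter → ℕ → ℝ → ((ℕ → ℝ) → ℂ) → ℂ
  | [], 0, _, c => c 0
  | [], _ + 1, _, _ => 0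
  | a :: w, 0, τ, c =>
    ∫ s, G τ s * (weight ξ a s * nest R ξ η w 0 s fun u => c (cons s u)) ∂slab R
  | a :: w, j + 1, τ, c =>
    ∫ s, G τ s * (weight ξ a s * (nest R ξ η w (j + 1) s fun u => c (cons s u))
      + dweight η a s * nest R ξ η w j s fun u => c (cons s u)) ∂slab R

variable {R : ℝ} {ξ η : ℝ → ℂ}

theorem measurable_weight (hξ : Measurable ξ) (a : Letter) : Measurable (weight ξ a) := by
  cases a
  · exact measurable_const
  · exact hξ
  · exact measurable_const

theorem measurable_dweight (hη : Measurable η) (a : Letter) : Measurable (dweight η a) := by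
  cases a
  · exact measurable_const
  · exact hη
  · exact measurable_const

theorem measurable_integral_slab {Θ : Type} [MeasurableSpace Θ] {h : Θ → ℝ → ℂ}
    (hh : Measurable fun p : Θ × ℝ => h p.1 p.2) : Measurable fun θ => ∫ s, h θ s ∂slab R :=
  (hh.stronglyMeasurable.integral_prod_right (ν := slab R)).measurable

theorem measurable_ofReal_G {Θ : Type} [MeasurableSpace Θ] {a b : Θ → ℝ} (ha : Measurable a)
    (hb : Measurable b) : Measurable fun θ => (G (a θ) (b θ) : ℂ) :=
  Complex.measurable_ofReal.comp (measurable_G.comp (ha.prodMk hb))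

/-- The parameter space `Θ` is quantified inside the induction: the time of the leading letter joins
the parameters of the remaining integral, so `Θ` grows to `Θ × ℝ`. -/
theorem measurable_nest (hξ : Measurable ξ) (hη : Measurable η) (w : List Letter) :
    ∀ (j : ℕ) {Θ : Type} [MeasurableSpace Θ] (c : Θ → (ℕ → ℝ) → ℂ),
    (Measurable fun p : Θ × (ℕ → ℝ) => c p.1 p.2) →
    Measurable fun p : ℝ × Θ => nest R ξ η w j p.1 (c p.2) := by
  induction w with
  | nil =>
    intro j Θ _ c hc
    cases j with
    | zero => exact hc.comp (measurable_snd.prodMk measurable_const)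
    | succ j => exact measurable_const
  | cons a w ih =>
    intro j Θ _ c hc
    have hc' : Measurable fun p : (Θ × ℝ) × (ℕ → ℝ) => c p.1.1 (cons p.1.2 p.2) :=
      hc.comp ((measurable_fst.comp measurable_fst).prodMk
        (measurable_cons.comp ((measurable_snd.comp measurable_fst).prodMk measurable_snd)))
    have key : ∀ j, Measurable fun p : (ℝ × Θ) × ℝ =>
        nest R ξ η w j p.2 fun u => c p.1.2 (cons p.2 u) := fun j =>
      (ih j (fun q : Θ × ℝ => fun u => c q.1 (cons q.2 u)) hc').comp
        (measurable_snd.prodMk ((measurable_snd.comp measurable_fst).prodMk measurable_snd))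
    have hG : Measurable fun p : (ℝ × Θ) × ℝ => (G p.1.1 p.2 : ℂ) :=
      measurable_ofReal_G (measurable_fst.comp measurable_fst) measurable_snd
    have hw : Measurable fun p : (ℝ × Θ) × ℝ => weight ξ a p.2 :=
      (measurable_weight hξ a).comp measurable_snd
    have hd : Measurable fun p : (ℝ × Θ) × ℝ => dweight η a p.2 :=
      (measurable_dweight hη a).comp measurable_snd
    cases j with
    | zero => exact measurable_integral_slab (hG.mul (hw.mul (key 0)))
    | succ j => exact measurable_integral_slab (hG.mul ((hw.mul (key (j + 1))).add (hd.mul (key j))))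

theorem norm_weight_add_dweight_le (a : Letter) (s : ℝ) :
    ‖weight ξ a s‖ + ‖dweight η a s‖ ≤ 1 + ‖ξ s‖ + ‖η s‖ := by
  have := norm_nonneg (ξ s)
  have := norm_nonneg (η s)
  cases a <;> simp [weight, dweight] <;> linarith

/-- Each letter costs at most a factor `∫ (1 + ‖ξ‖ + ‖η‖)`. The bound sees `η` only through its `L¹`
norm, hence is uniform along mollifiers, and it does not depend on `j` or `τ`. -/
theorem norm_nest_le {K : ℝ} (hξ : Integrable ξ (slab R)) (hη : Integrable η (slab R))
    (hK : ∫ s, (1 + ‖ξ s‖ + ‖η s‖) ∂slab R ≤ K) (w : List Letter) :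
    ∀ (j : ℕ) (τ : ℝ) {c : (ℕ → ℝ) → ℂ} {M : ℝ}, (∀ u, ‖c u‖ ≤ M) →
    ‖nest R ξ η w j τ c‖ ≤ M * K ^ w.length := by
  have hint : Integrable (fun s => 1 + ‖ξ s‖ + ‖η s‖) (slab R) :=
    ((integrable_const 1).add hξ.norm).add hη.norm
  have hK0 : 0 ≤ K := le_trans (integral_nonneg fun s => by positivity) hK
  induction w with
  | nil =>
    intro j τ c M hM
    cases j with
    | zero => simpa [nest] using hM 0
    | succ j => simpa [nest] using (norm_nonneg _).trans (hM 0)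
  | cons a w ih =>
    intro j τ c M hM
    have hM0 : 0 ≤ M := (norm_nonneg _).trans (hM 0)
    have b : ∀ j s, ‖nest R ξ η w j s fun u => c (cons s u)‖ ≤ M * K ^ w.length := fun j s =>
      ih j s fun u => hM _
    have hfin : (∫ s, (1 + ‖ξ s‖ + ‖η s‖) * (M * K ^ w.length) ∂slab R)
        ≤ M * K ^ (a :: w).length := by
      rw [integral_mul_const, List.length_cons, pow_succ]
      calc _ ≤ K * (M * K ^ w.length) := by gcongr
        _ = _ := by ring
    cases j with
    | zero =>
      refine (norm_integral_le_of_norm_le (hint.mul_const (M * K ^ w.length))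
        (Eventually.of_forall fun s => ?_)).trans hfin
      rw [norm_mul, norm_mul]
      have h1 := norm_weight_add_dweight_le (ξ := ξ) (η := η) a s
      have h2 := norm_nonneg (dweight η a s)
      calc _ ≤ 1 * (‖weight ξ a s‖ * (M * K ^ w.length)) := by
            gcongr
            · exact norm_G_le _ _
            · exact b _ _
        _ ≤ _ := by rw [one_mul]; gcongr; linarith
    | succ j =>
      refine (norm_integral_le_of_norm_le (hint.mul_const (M * K ^ w.length))
        (Eventually.of_forall fun s => ?_)).trans hfin
      rw [norm_mul]
      have h1 := norm_weight_add_dweight_le (ξ := ξ) (η := η) a s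
      calc _ ≤ 1 * (‖weight ξ a s‖ * (M * K ^ w.length) + ‖dweight η a s‖ * (M * K ^ w.length)) := by
            gcongr
            · exact norm_G_le _ _
            · refine (norm_add_le _ _).trans ?_
              rw [norm_mul, norm_mul]
              gcongr
              · exact b _ _
              · exact b _ _
        _ ≤ _ := by rw [one_mul, ← add_mul]; gcongr

end MSR
end
-- Expansion and continuity of nested time integrals
noncomputable section
namespace MSR

open MeasureTheory Filter Topology Set Letter

variable {R : ℝ} {ξ η : ℝ → ℂ}

theorem integrable_G_mul {g h : ℝ → ℂ} {C : ℝ} (hg : Integrable g (slab R)) (hh : Measurable h)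
    (hb : ∀ s, ‖h s‖ ≤ C) (τ : ℝ) : Integrable (fun s => (G τ s : ℂ) * (g s * h s)) (slab R) := by
  have h1 : Integrable (fun s => h s * g s) (slab R) :=
    hg.bdd_mul (c := C) hh.aestronglyMeasurable (Eventually.of_forall hb)
  have h2 : Integrable (fun s => g s * h s) (slab R) := by simpa only [mul_comm] using h1
  exact h2.bdd_mul (c := 1) (measurable_ofReal_G measurable_const measurable_id).aestronglyMeasurable
    (Eventually.of_forall fun s => norm_G_le _ _)

theorem integrable_weight (hξ : Integrable ξ (slab R)) (a : Letter) :
    Integrable (weight ξ a) (slab R) := by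
  cases a
  · exact integrable_const (1 : ℂ)
  · exact hξ
  · exact integrable_const (1 : ℂ)

theorem integrable_dweight (hη : Integrable η (slab R)) (a : Letter) :
    Integrable (dweight η a) (slab R) := by
  cases a
  · exact integrable_const (0 : ℂ)
  · exact hη
  · exact integrable_const (0 : ℂ)

theorem measurable_nest_cons (hξ : Measurable ξ) (hη : Measurable η) (w : List Letter) (j : ℕ)
    {c : (ℕ → ℝ) → ℂ} (hc : Measurable c) :
    Measurable fun s => nest R ξ η w j s fun u => c (cons s u) :=
  (measurable_nest hξ hη w j (fun s u => c (cons s u)) (hc.comp measurable_cons)).comp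
    (measurable_id.prodMk measurable_id)

theorem exists_norm_nest_le (hξ : Integrable ξ (slab R)) (hη : Integrable η (slab R))
    (w : List Letter) {M : ℝ} : ∃ C, ∀ (j : ℕ) (τ : ℝ) (c : (ℕ → ℝ) → ℂ), (∀ u, ‖c u‖ ≤ M) →
      ‖nest R ξ η w j τ c‖ ≤ C :=
  ⟨_, fun j τ _ hc => norm_nest_le hξ hη le_rfl w j τ hc⟩

theorem integrable_weight_mul_nest (hξ : Integrable ξ (slab R)) (hη : Integrable η (slab R))
    (hξm : Measurable ξ) (hηm : Measurable η) {g : ℝ → ℂ} (hg : Integrable g (slab R))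
    (w : List Letter) (j : ℕ) (τ : ℝ) {c : (ℕ → ℝ) → ℂ} (hc : Measurable c) {M : ℝ}
    (hM : ∀ u, ‖c u‖ ≤ M) :
    Integrable (fun s => (G τ s : ℂ) * (g s * nest R ξ η w j s fun u => c (cons s u)))
      (slab R) := by
  obtain ⟨C, hC⟩ := exists_norm_nest_le hξ hη w (M := M)
  exact integrable_G_mul hg (measurable_nest_cons hξm hηm w j hc)
    (fun s => hC j s _ fun u => hM _) τ

theorem nest_zero_congr (ξ η η' : ℝ → ℂ) (w : List Letter) : ∀ (τ : ℝ) (c : (ℕ → ℝ) → ℂ),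
    nest R ξ η w 0 τ c = nest R ξ η' w 0 τ c := by
  induction w with
  | nil => intro τ c; rfl
  | cons a w ih => intro τ c; simp only [nest, ih]

theorem nest_const_mul (w : List Letter) : ∀ (j : ℕ) (τ : ℝ) (a : ℂ) (c : (ℕ → ℝ) → ℂ),
    nest R ξ η w j τ (fun u => a * c u) = a * nest R ξ η w j τ c := by
  induction w with
  | nil => intro j τ a c; cases j <;> simp [nest]
  | cons b w ih =>
    intro j τ a c
    cases j <;> simp only [nest, ih] <;> rw [← integral_const_mul] <;> congr 1 <;> ext s <;> ring

theorem nest_zero (w : List Letter) (j : ℕ) (τ : ℝ) :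
    nest R ξ η w j τ (fun _ => 0) = 0 := by
  simpa using nest_const_mul (R := R) (ξ := ξ) (η := η) w j τ 0 (fun _ => 0)

theorem nest_eq_zero_of_length_lt (w : List Letter) :
    ∀ (j : ℕ) (τ : ℝ) (c : (ℕ → ℝ) → ℂ), w.length < j → nest R ξ η w j τ c = 0 := by
  induction w with
  | nil => intro j τ c hj; cases j with
    | zero => simp at hj
    | succ j => rfl
  | cons a w ih =>
    intro j τ c hj
    cases j with
    | zero => simp at hj
    | succ j =>
      simp only [List.length_cons] at hj
      simp [nest, ih j _ _ (by omega), ih (j + 1) _ _ (by omega)]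

/-- The weight of every letter is affine in the noise, so expanding the product of weights gives a
polynomial in `z`; the recursion defining `nest` is the Leibniz rule for its coefficients. Thus the
functionals are polynomial along lines, and their second variation can be read off at `j = 2`. -/
theorem nest_zero_add_smul (hξ : Integrable ξ (slab R)) (hη : Integrable η (slab R))
    (hξm : Measurable ξ) (hηm : Measurable η) {M : ℝ} (z : ℂ) (w : List Letter) :
    ∀ (τ : ℝ) (c : (ℕ → ℝ) → ℂ), Measurable c → (∀ u, ‖c u‖ ≤ M) →
    nest R (ξ + z • η) 0 w 0 τ c =
      ∑ j ∈ Finset.range (w.length + 1), z ^ j * nest R ξ η w j τ c := by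
  induction w with
  | nil => intro τ c _ _; simp [nest]
  | cons a w ih =>
    intro τ c hc hM
    have hs : ∀ s, Measurable (cons s) := fun s =>
      measurable_cons.comp (measurable_const.prodMk measurable_id)
    have hw : ∀ s, weight (ξ + z • η) a s = weight ξ a s + z * dweight η a s := fun s => by
      cases a <;> simp [weight, dweight]
    have h0 := fun j => integrable_weight_mul_nest hξ hη hξm hηm (integrable_weight hξ a) w j τ hc hM
    have h1 := fun j =>
      integrable_weight_mul_nest hξ hη hξm hηm (integrable_dweight hη a) w j τ hc hM
    have hsucc : ∀ j, nest R ξ η (a :: w) (j + 1) τ c =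
        (∫ s, (G τ s : ℂ) * (weight ξ a s * nest R ξ η w (j + 1) s fun u => c (cons s u)) ∂slab R)
        + ∫ s, (G τ s : ℂ) * (dweight η a s * nest R ξ η w j s fun u => c (cons s u)) ∂slab R := by
      intro j
      rw [← integral_add (h0 _) (h1 _)]
      simp only [nest, mul_add]
    have hL : nest R (ξ + z • η) 0 (a :: w) 0 τ c =
        (∑ j ∈ Finset.range (w.length + 1), z ^ j *
          ∫ s, (G τ s : ℂ) * (weight ξ a s * nest R ξ η w j s fun u => c (cons s u)) ∂slab R)
        + ∑ j ∈ Finset.range (w.length + 1), z ^ (j + 1) *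
          ∫ s, (G τ s : ℂ) * (dweight η a s * nest R ξ η w j s fun u => c (cons s u)) ∂slab R := by
      simp only [← integral_const_mul]
      rw [← integral_finsetSum _ fun j _ => (h0 j).const_mul _,
        ← integral_finsetSum _ fun j _ => (h1 j).const_mul _,
        ← integral_add (integrable_finsetSum _ fun j _ => (h0 j).const_mul _)
          (integrable_finsetSum _ fun j _ => (h1 j).const_mul _)]
      simp only [nest]
      congr 1
      ext s
      rw [ih s (fun u => c (cons s u)) (hc.comp (hs s)) (fun u => hM _), hw, Finset.mul_sum,
        Finset.mul_sum, ← Finset.sum_add_distrib]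
      refine Finset.sum_congr rfl fun j _ => ?_
      ring
    -- The ranges are aligned by splitting off `j = 0`; the surplus top term vanishes because `w`
    -- has too few letters to carry `w.length + 1` factors `η`.
    rw [hL, List.length_cons, Finset.sum_range_succ' _ (w.length + 1)]
    simp only [hsucc, mul_add, Finset.sum_add_distrib]
    rw [Finset.sum_range_succ' (fun j => z ^ j * ∫ s, (G τ s : ℂ) *
      (weight ξ a s * nest R ξ η w j s fun u => c (cons s u)) ∂slab R) w.length]
    rw [Finset.sum_range_succ (fun j => z ^ (j + 1) * ∫ s, (G τ s : ℂ) *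
      (weight ξ a s * nest R ξ η w (j + 1) s fun u => c (cons s u)) ∂slab R) w.length]
    simp only [nest_eq_zero_of_length_lt w (w.length + 1) _ _ (Nat.lt_succ_self _), mul_zero,
      integral_zero, nest]
    ring

theorem ae_slab_notMem {E : Set ℝ} (hE : E.Countable) : ∀ᵐ s ∂slab R, s ∉ E :=
  ae_restrict_of_ae (measure_eq_zero_iff_ae_notMem.1 (hE.measure_zero volume))

theorem tendsto_G {ι : Type} {l : Filter ι} {a b : ι → ℝ} {x y : ℝ} (ha : Tendsto a l (𝓝 x))
    (hb : Tendsto b l (𝓝 y)) (hxy : x ≠ y) :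
    Tendsto (fun i => (G (a i) (b i) : ℂ)) l (𝓝 (G x y : ℂ)) := by
  apply tendsto_const_nhds.congr'
  rcases lt_or_gt_of_ne hxy with h | h
  · filter_upwards [ha.eventually_lt hb h] with i hi
    rw [G_of_le hi.le, G_of_le h.le]
  · filter_upwards [hb.eventually_lt ha h] with i hi
    rw [G_of_lt hi, G_of_lt h]

/-- Dominated convergence. The propagator is locally constant off the diagonal, and a countable set
of times is null, so the kernels need to converge only when all vertex times avoid `E`. This matters
since the kernels of words jump when a vertex time meets an observation time. -/
theorem tendsto_nest_zero (hξ : Integrable ξ (slab R)) (hη : Integrable η (slab R))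
    (hξm : Measurable ξ) (hηm : Measurable η) {M : ℝ} {E : Set ℝ} (hE : E.Countable) {ι : Type}
    {l : Filter ι} [l.IsCountablyGenerated] (w : List Letter) :
    ∀ (τ : ι → ℝ) (τ₀ : ℝ) (c : ι → (ℕ → ℝ) → ℂ) (c₀ : (ℕ → ℝ) → ℂ), Tendsto τ l (𝓝 τ₀) →
    (∀ i, Measurable (c i)) → (∀ i u, ‖c i u‖ ≤ M) →
    (∀ u, (∀ j < w.length, u j ∉ E) → Tendsto (fun i => c i u) l (𝓝 (c₀ u))) →
    Tendsto (fun i => nest R ξ η w 0 (τ i) (c i)) l (𝓝 (nest R ξ η w 0 τ₀ c₀)) := by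
  induction w with
  | nil => intro τ τ₀ c c₀ _ _ _ h; exact h 0 (by simp)
  | cons a w ih =>
    intro τ τ₀ c c₀ hτ hc hM h
    obtain ⟨C, hC⟩ := exists_norm_nest_le hξ hη w (M := M)
    have hs : ∀ s, Measurable (cons s) := fun s =>
      measurable_cons.comp (measurable_const.prodMk measurable_id)
    simp only [nest]
    refine tendsto_integral_filter_of_dominated_convergence (fun s => ‖weight ξ a s‖ * C)
      (Eventually.of_forall fun i => (integrable_weight_mul_nest hξ hη hξm hηm
        (integrable_weight hξ a) w 0 (τ i) (hc i) (hM i)).aestronglyMeasurable)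
      (Eventually.of_forall fun i => Eventually.of_forall fun s => ?_)
      ((integrable_weight hξ a).norm.mul_const C) ?_
    · rw [norm_mul, norm_mul]
      calc _ ≤ 1 * (‖weight ξ a s‖ * C) := by
            gcongr
            · exact norm_G_le _ _
            · exact hC _ _ _ fun u => hM i _
        _ = _ := one_mul _
    · filter_upwards [ae_slab_notMem hE, ae_slab_notMem (countable_singleton τ₀)] with s hsE hsτ
      refine (tendsto_G hτ tendsto_const_nhds (Ne.symm hsτ)).mul (tendsto_const_nhds.mul ?_)
      refine ih _ _ _ _ tendsto_const_nhds (fun i => (hc i).comp (hs s)) (fun i u => hM i _)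
        fun u hu => h _ fun j hj => ?_
      cases j with
      | zero => exact hsE
      | succ j => exact hu j (by simpa using hj)

/-- All integration times lie below `τ`, so a factor `η` finds nothing of the support of `η` there.
-/
theorem nest_succ_eq_zero (w : List Letter) : ∀ (j : ℕ) (τ : ℝ) (c : (ℕ → ℝ) → ℂ),
    (∀ s < τ, η s = 0) → nest R ξ η w (j + 1) τ c = 0 := by
  induction w with
  | nil => intro j τ c _; rfl
  | cons a w ih =>
    intro j τ c h
    simp only [nest]
    refine integral_eq_zero_of_ae (Eventually.of_forall fun s => ?_)
    by_cases hs : s < τ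
    · have : dweight η a s = 0 := by cases a <;> simp [dweight, h s hs]
      simp [this, ih j s _ fun r hr => h r (hr.trans hs)]
    · simp [G_of_le (not_lt.1 hs)]

/-- Exchanging the two variables turns `G(s, s')` into `G(s', s)`, and the two propagators add up to
one off the null diagonal. Each therefore carries half of the total mass; this is the origin of the
Stratonovich factor. -/
theorem integral_mul_integral_G {δ : ℝ → ℝ} (hδ : Integrable δ) (h1 : ∫ s, δ s = 1) :
    ∫ s, δ s * ∫ s', G s s' * δ s' = 1 / 2 := by
  have hG : Measurable fun p : ℝ × ℝ => G p.1 p.2 := measurable_G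
  have hG' : Measurable fun p : ℝ × ℝ => G p.2 p.1 := measurable_G.comp measurable_swap
  have hle : ∀ t s, ‖G t s‖ ≤ 1 := fun t s => by unfold G; split_ifs <;> simp
  have hp : Integrable (fun p : ℝ × ℝ => δ p.1 * δ p.2) := hδ.mul_prod hδ
  have i1 : Integrable (fun p : ℝ × ℝ => G p.1 p.2 * (δ p.1 * δ p.2)) :=
    hp.bdd_mul (c := 1) hG.aestronglyMeasurable (Eventually.of_forall fun p => hle _ _)
  have i2 : Integrable (fun p : ℝ × ℝ => G p.2 p.1 * (δ p.1 * δ p.2)) :=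
    hp.bdd_mul (c := 1) hG'.aestronglyMeasurable (Eventually.of_forall fun p => hle _ _)
  have e1 : ∫ s, δ s * ∫ s', G s s' * δ s' = ∫ p : ℝ × ℝ, G p.1 p.2 * (δ p.1 * δ p.2) := by
    rw [Measure.volume_eq_prod, integral_prod _ i1]
    congr 1; ext s; rw [← integral_const_mul]; congr 1; ext s'; ring
  have e2 : ∫ p : ℝ × ℝ, G p.2 p.1 * (δ p.1 * δ p.2) = ∫ p : ℝ × ℝ, G p.1 p.2 * (δ p.1 * δ p.2) := by
    rw [Measure.volume_eq_prod,
      ← integral_prod_swap (μ := volume) (ν := volume) (f := fun p : ℝ × ℝ => G p.1 p.2 * (δ p.1 * δ p.2))]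
    congr 1; ext p; simp [mul_comm (δ p.1)]
  have e3 : (∫ p : ℝ × ℝ, G p.1 p.2 * (δ p.1 * δ p.2)) + ∫ p : ℝ × ℝ, G p.2 p.1 * (δ p.1 * δ p.2)
      = 1 := by
    rw [← integral_add i1 i2, Measure.volume_eq_prod,
      integral_prod (fun p : ℝ × ℝ => G p.1 p.2 * (δ p.1 * δ p.2) + G p.2 p.1 * (δ p.1 * δ p.2))
        (i1.add i2)]
    have : ∀ s, ∫ s', (G s s' * (δ s * δ s') + G s' s * (δ s * δ s')) = δ s := by
      intro s
      have : ∫ s', (G s s' * (δ s * δ s') + G s' s * (δ s * δ s')) = ∫ s', δ s * δ s' := by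
        refine integral_congr_ae ?_
        filter_upwards [measure_eq_zero_iff_ae_notMem.1
          ((countable_singleton s).measure_zero volume)] with s' hs'
        rcases lt_or_gt_of_ne (show s' ≠ s from hs') with h | h
        · simp [G_of_lt h, G_of_le h.le]
        · simp [G_of_lt h, G_of_le h.le]
      rw [this, integral_const_mul, h1, mul_one]
    simp only [this, h1]
  rw [e1]
  linarith

end MSR
end
-- The second variation of a nested integral at a point mass
noncomputable section
namespace MSR

open MeasureTheory Filter Topology Set Letter

variable {R : ℝ} {ξ η : ℝ → ℂ}

/-- Smooth nonnegative functions of integral one which concentrate at `s₀`. -/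
structure IsMollifier (δ : ℕ → ℝ → ℝ) (ε : ℕ → ℝ) (s₀ : ℝ) : Prop where
  continuous : ∀ n, Continuous (δ n)
  nonneg : ∀ n s, 0 ≤ δ n s
  integrable : ∀ n, Integrable (δ n)
  integral_eq : ∀ n, ∫ s, δ n s = 1
  tendsto : Tendsto ε atTop (𝓝 0)
  eq_zero : ∀ n s, ε n ≤ |s - s₀| → δ n s = 0

theorem isMollifier_approxDelta (s₀ : ℝ) :
    IsMollifier (fun n => (approxDelta s₀ n : ℝ → ℝ)) (fun n => 2 / ((n : ℝ) + 1)) s₀ where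
  continuous n := (show ContDiff ℝ ∞ (approxDelta s₀ n : ℝ → ℝ) from (approxDelta s₀ n).2).continuous
  nonneg n s := ContDiffBump.nonneg_normed _ _
  integrable n := ContDiffBump.integrable_normed _
  integral_eq n := ContDiffBump.integral_normed _
  tendsto := by
    have := (tendsto_one_div_add_atTop_nhds_zero_nat (𝕜 := ℝ)).const_mul 2
    simpa [div_eq_mul_inv] using this
  eq_zero n s h := by
    by_contra h0
    have h1 : s ∈ Function.support (approxDelta s₀ n : ℝ → ℝ) := h0
    unfold approxDelta at h1
    rw [ContDiffBump.support_normed_eq] at h1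
    simp only [Metric.mem_ball, Real.dist_eq] at h1
    linarith

variable {δ : ℕ → ℝ → ℝ} {ε : ℕ → ℝ} {s₀ : ℝ}

theorem integral_slab_eq {F : Type} [NormedAddCommGroup F] [NormedSpace ℝ F] {f : ℝ → F}
    (h : ∀ s, s ∉ Icc (-R) R → f s = 0) : ∫ s, f s ∂slab R = ∫ s, f s :=
  setIntegral_eq_integral_of_forall_compl_eq_zero h

namespace IsMollifier

theorem integrable_slab (hδ : IsMollifier δ ε s₀) (n : ℕ) : Integrable (δ n) (slab R) :=
  (hδ.integrable n).restrict

theorem integral_slab_le (hδ : IsMollifier δ ε s₀) (n : ℕ) : ∫ s, δ n s ∂slab R ≤ 1 := by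
  rw [← hδ.integral_eq n]
  exact setIntegral_le_integral (hδ.integrable n) (Eventually.of_forall (hδ.nonneg n))

theorem eventually_eq_zero (hδ : IsMollifier δ ε s₀) (hs : s₀ ∈ Ioo (-R) R) :
    ∀ᶠ n in atTop, ∀ s ∉ Icc (-R) R, δ n s = 0 := by
  have hpos : 0 < min (s₀ - -R) (R - s₀) := lt_min (by linarith [hs.1]) (by linarith [hs.2])
  filter_upwards [hδ.tendsto.eventually (gt_mem_nhds hpos)] with n hn s hsR
  apply hδ.eq_zero
  by_contra! hlt
  have := hlt.trans hn
  rw [lt_min_iff, abs_lt, abs_lt] at this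
  exact hsR ⟨by linarith [this.1.1], by linarith [this.2.2]⟩

theorem norm_integral_mul_le (hδ : IsMollifier δ ε s₀) (n : ℕ) {f : ℝ → ℂ} {C : ℝ} (hC : 0 ≤ C)
    (hf : ∀ s, δ n s ≠ 0 → ‖f s‖ ≤ C) : ‖∫ s, (δ n s : ℂ) * f s ∂slab R‖ ≤ C := by
  refine (norm_integral_le_of_norm_le ((hδ.integrable_slab n).mul_const C)
    (Eventually.of_forall fun s => ?_)).trans ?_
  · rw [norm_mul, Complex.norm_real, Real.norm_of_nonneg (hδ.nonneg n s)]
    by_cases h0 : δ n s = 0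
    · simp [h0]
    · exact mul_le_mul_of_nonneg_left (hf s h0) (hδ.nonneg n s)
  · rw [integral_mul_const]
    exact mul_le_of_le_one_left hC (hδ.integral_slab_le n)

/-- On the shrinking support of the mollifiers `h` is close to `h s₀ s₀`, and for a constant kernel
the double integral is an ordered half of a square. Continuity is needed at the coincidence point
only. -/
theorem tendsto_integral_pair (hδ : IsMollifier δ ε s₀) (hs : s₀ ∈ Ioo (-R) R)
    {h : ℝ → ℝ → ℂ} (hm : Measurable fun p : ℝ × ℝ => h p.1 p.2) {M : ℝ}
    (hM : ∀ s s', ‖h s s'‖ ≤ M) (hc : ContinuousAt (fun p : ℝ × ℝ => h p.1 p.2) (s₀, s₀)) :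
    Tendsto (fun n => ∫ s, (δ n s : ℂ) *
      ∫ s', (G s s' : ℂ) * ((δ n s' : ℂ) * h s s') ∂slab R ∂slab R) atTop
      (𝓝 (1 / 2 * h s₀ s₀)) := by
  have hδi : ∀ n, Integrable (fun s => (δ n s : ℂ)) (slab R) := fun n =>
    (hδ.integrable_slab n).ofReal
  have hhs : ∀ s, Measurable (h s) := fun s => hm.comp (measurable_const.prodMk measurable_id)
  have inner : ∀ n s, Integrable (fun s' => (G s s' : ℂ) * ((δ n s' : ℂ) * h s s')) (slab R) :=
    fun n s => integrable_G_mul (hδi n) (hhs s) (hM s) s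
  have inner0 : ∀ n s, Integrable (fun s' => (G s s' : ℂ) * ((δ n s' : ℂ) * h s₀ s₀)) (slab R) :=
    fun n s => integrable_G_mul (hδi n) measurable_const (fun _ => hM s₀ s₀) s
  have hM0 : 0 ≤ M := (norm_nonneg _).trans (hM 0 0)
  have normI : ∀ n s (g : ℝ → ℂ) (C : ℝ), 0 ≤ C → (∀ s', δ n s' ≠ 0 → ‖g s'‖ ≤ C) →
      ‖∫ s', (G s s' : ℂ) * ((δ n s' : ℂ) * g s') ∂slab R‖ ≤ C := by
    intro n s g C hC hg
    have := hδ.norm_integral_mul_le (R := R) n (f := fun s' => (G s s' : ℂ) * g s') hC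
      fun s' hs' => by
        rw [norm_mul]
        calc _ ≤ 1 * C := by
              gcongr
              · exact norm_G_le _ _
              · exact hg s' hs'
          _ = C := one_mul C
    simpa only [mul_left_comm] using this
  have measI : ∀ n, Measurable fun s => ∫ s', (G s s' : ℂ) * ((δ n s' : ℂ) * h s s') ∂slab R :=
    fun n => measurable_integral_slab ((measurable_ofReal_G measurable_fst measurable_snd).mul
      ((Complex.measurable_ofReal.comp ((hδ.continuous n).measurable.comp measurable_snd)).mul hm))
  have measI0 : ∀ n, Measurable fun s => ∫ s', (G s s' : ℂ) * ((δ n s' : ℂ) * h s₀ s₀) ∂slab R :=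
    fun n => measurable_integral_slab ((measurable_ofReal_G measurable_fst measurable_snd).mul
      ((Complex.measurable_ofReal.comp ((hδ.continuous n).measurable.comp measurable_snd)).mul
        measurable_const))
  rw [Metric.tendsto_atTop']
  intro e he
  obtain ⟨r, hr, hball⟩ := Metric.continuousAt_iff.1 hc (e / 2) (by positivity)
  obtain ⟨n₁, hn₁⟩ := eventually_atTop.1 (hδ.eventually_eq_zero hs)
  obtain ⟨n₂, hn₂⟩ := eventually_atTop.1 (hδ.tendsto.eventually (gt_mem_nhds hr))
  refine ⟨max n₁ n₂, fun n hn => ?_⟩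
  have hz := hn₁ n ((le_max_left _ _).trans hn.le)
  have hε := hn₂ n ((le_max_right _ _).trans hn.le)
  -- For the constant kernel the value is exact, not only a limit, as soon as the mollifier is
  -- supported inside the slab.
  have hhalf : ∫ s, (δ n s : ℂ) * ∫ s', (G s s' : ℂ) * ((δ n s' : ℂ) * h s₀ s₀) ∂slab R ∂slab R
      = 1 / 2 * h s₀ s₀ := by
    have e1 : ∀ s, ∫ s', (G s s' : ℂ) * ((δ n s' : ℂ) * h s₀ s₀) ∂slab R =
        ((∫ s', G s s' * δ n s' : ℝ) : ℂ) * h s₀ s₀ := by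
      intro s
      rw [integral_slab_eq fun s' hs' => by simp [hz s' hs'], ← integral_complex_ofReal,
        ← integral_mul_const]
      congr 1; ext s'; push_cast; ring
    simp only [e1]
    simp only [← mul_assoc]
    rw [integral_mul_const, integral_slab_eq fun s' hs' => by simp [hz s' hs']]
    have := integral_mul_integral_G (hδ.integrable n) (hδ.integral_eq n)
    have h2 : ∫ s, (δ n s : ℂ) * ((∫ s', G s s' * δ n s' : ℝ) : ℂ) = ((1 / 2 : ℝ) : ℂ) := by
      rw [← this, ← integral_complex_ofReal]; congr 1; ext s; push_cast; ring
    rw [h2]; norm_num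
  have i1 : Integrable (fun s => (δ n s : ℂ) *
      ∫ s', (G s s' : ℂ) * ((δ n s' : ℂ) * h s s') ∂slab R) (slab R) := by
    simpa only [mul_comm] using (hδi n).bdd_mul (c := M) (measI n).aestronglyMeasurable
      (Eventually.of_forall fun s => normI n s _ M hM0 fun _ _ => hM _ _)
  have i2 : Integrable (fun s => (δ n s : ℂ) *
      ∫ s', (G s s' : ℂ) * ((δ n s' : ℂ) * h s₀ s₀) ∂slab R) (slab R) := by
    simpa only [mul_comm] using (hδi n).bdd_mul (c := M) (measI0 n).aestronglyMeasurable
      (Eventually.of_forall fun s => normI n s _ M hM0 fun _ _ => hM _ _)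
  rw [dist_eq_norm, ← hhalf, ← integral_sub i1 i2]
  refine lt_of_le_of_lt ?_ (half_lt_self he)
  have e2 : ∀ s, ((δ n s : ℂ) * ∫ s', (G s s' : ℂ) * ((δ n s' : ℂ) * h s s') ∂slab R) -
      (δ n s : ℂ) * ∫ s', (G s s' : ℂ) * ((δ n s' : ℂ) * h s₀ s₀) ∂slab R =
      (δ n s : ℂ) * ∫ s', (G s s' : ℂ) * ((δ n s' : ℂ) * (h s s' - h s₀ s₀)) ∂slab R := by
    intro s
    rw [← mul_sub, ← integral_sub (inner n s) (inner0 n s)]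
    congr 2; ext s'; ring
  simp only [e2]
  refine hδ.norm_integral_mul_le n (by positivity) fun s hs0 => ?_
  refine normI n s _ _ (by positivity) fun s' hs0' => ?_
  have hd : ∀ s, δ n s ≠ 0 → dist s s₀ < r := fun s hs => by
    rw [Real.dist_eq]
    exact lt_of_not_ge fun hle => hs (hδ.eq_zero n s (hε.le.trans hle))
  have := hball (x := (s, s')) (by rw [Prod.dist_eq]; exact max_lt (hd s hs0) (hd s' hs0'))
  rw [dist_eq_norm] at this
  exact this.le

/-- The inner time is squeezed: `q` vanishes below `s₀ - ε n`, while the propagator keeps `s'` below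
`s`, hence below `s₀ + ε n`. The mass of `b` on this shrinking interval tends to zero. This excludes
contractions of letters that are not adjacent. -/
theorem tendsto_integral_small (hδ : IsMollifier δ ε s₀) {b : ℝ → ℝ} (hb : Integrable b (slab R))
    (hb0 : ∀ s, 0 ≤ b s) {q : ℕ → ℝ → ℝ → ℂ} (hq : ∀ n s s', ‖q n s s'‖ ≤ b s')
    (hq0 : ∀ n s s', s' ≤ s₀ - ε n → q n s s' = 0) :
    Tendsto (fun n => ∫ s, (δ n s : ℂ) * ∫ s', (G s s' : ℂ) * q n s s' ∂slab R ∂slab R) atTop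
      (𝓝 0) := by
  set S : ℕ → Set ℝ := fun n => Icc (s₀ - ε n) (s₀ + ε n)
  have hr : Tendsto (fun n => ∫ s', (S n).indicator b s' ∂slab R) atTop (𝓝 0) := by
    rw [← integral_zero ℝ ℝ (μ := slab R)]
    refine tendsto_integral_filter_of_dominated_convergence b
      (Eventually.of_forall fun n => (hb.indicator measurableSet_Icc).aestronglyMeasurable)
      (Eventually.of_forall fun n => Eventually.of_forall fun s => ?_) hb ?_
    · rw [Real.norm_of_nonneg (indicator_nonneg (fun s _ => hb0 s) s)]
      exact indicator_le_self' (fun s _ => hb0 s) s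
    · filter_upwards [ae_slab_notMem (countable_singleton s₀)] with s hs
      have hs' : s ≠ s₀ := hs
      have hpos : 0 < |s - s₀| := abs_pos.2 (sub_ne_zero.2 hs')
      apply tendsto_const_nhds.congr'
      filter_upwards [hδ.tendsto.eventually (gt_mem_nhds hpos)] with n hn
      rw [indicator_of_notMem]
      intro hmem
      have : |s - s₀| ≤ ε n := abs_le.2 ⟨by linarith [hmem.1], by linarith [hmem.2]⟩
      linarith
  refine squeeze_zero_norm (fun n => ?_) hr
  refine hδ.norm_integral_mul_le n (integral_nonneg fun s => indicator_nonneg (fun s _ => hb0 s) s)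
    fun s hs => ?_
  refine norm_integral_le_of_norm_le (hb.indicator measurableSet_Icc)
    (Eventually.of_forall fun s' => ?_)
  have hs1 : s < s₀ + ε n := by
    have := lt_of_not_ge fun hle => hs (hδ.eq_zero n s hle)
    linarith [(abs_lt.1 this).2]
  by_cases hmem : s' ∈ S n
  · rw [indicator_of_mem hmem, norm_mul]
    calc _ ≤ 1 * b s' := by
          gcongr
          · exact norm_G_le _ _
          · exact hq _ _ _
      _ = _ := one_mul _
  · rw [indicator_of_notMem hmem]
    by_cases h1 : s' ≤ s₀ - ε n
    · simp [hq0 n s s' h1]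
    · have h2 : s ≤ s' := by
        by_contra! h2
        exact hmem ⟨(not_le.1 h1).le, by linarith⟩
      simp [G_of_le h2]

end IsMollifier

/-- The contribution of the contraction of the two leading letters to `nestLimit`. -/
def headLimit (R : ℝ) (ξ : ℝ → ℂ) (τ s₀ : ℝ) (c : (ℕ → ℝ) → ℂ) : List Letter → ℂ
  | noise :: noise :: w =>
    1 / 2 * ((G τ s₀ : ℂ) * nest R ξ 0 w 0 s₀ fun u => c (cons s₀ (cons s₀ u)))
  | _ => 0

/-- The limit of the second order part of `nest` in the direction of a point mass at `s₀`. -/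
def nestLimit (R : ℝ) (ξ : ℝ → ℂ) : List Letter → ℝ → ℝ → ((ℕ → ℝ) → ℂ) → ℂ
  | [], _, _, _ => 0
  | a :: w, τ, s₀, c =>
    (∫ s, G τ s * (weight ξ a s * nestLimit R ξ w s s₀ fun u => c (cons s u)) ∂slab R)
      + headLimit R ξ τ s₀ c (a :: w)

theorem exists_norm_nestLimit_le (hξ : Integrable ξ (slab R)) (w : List Letter) {M : ℝ} :
    ∃ C, 0 ≤ C ∧ ∀ (τ s₀ : ℝ) (c : (ℕ → ℝ) → ℂ), (∀ u, ‖c u‖ ≤ M) →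
      ‖nestLimit R ξ w τ s₀ c‖ ≤ C := by
  induction w with
  | nil => exact ⟨0, le_rfl, fun τ s₀ c _ => by simp [nestLimit]⟩
  | cons a w ih =>
    obtain ⟨C, hC0, hC⟩ := ih
    obtain ⟨C', hC'0, hC'⟩ : ∃ C, 0 ≤ C ∧ ∀ (τ s₀ : ℝ) (c : (ℕ → ℝ) → ℂ), (∀ u, ‖c u‖ ≤ M) →
        ‖headLimit R ξ τ s₀ c (a :: w)‖ ≤ C := by
      have h0 : ∃ C : ℝ, 0 ≤ C ∧ ∀ (τ s₀ : ℝ) (c : (ℕ → ℝ) → ℂ), (∀ u, ‖c u‖ ≤ M) →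
        ‖(0 : ℂ)‖ ≤ C := ⟨0, le_rfl, by simp⟩
      cases a with
      | drift => exact h0
      | pair => exact h0
      | noise =>
        cases w with
        | nil => exact h0
        | cons b w =>
          cases b with
          | drift => exact h0
          | pair => exact h0
          | noise =>
            obtain ⟨K, hK⟩ := exists_norm_nest_le hξ (integrable_zero ℝ ℂ (slab R)) w (M := M)
            refine ⟨|K|, abs_nonneg _, fun τ s₀ c hc => ?_⟩
            have := (hK 0 s₀ (fun u => c (cons s₀ (cons s₀ u))) fun u => hc _).trans (le_abs_self K)
            simp only [headLimit, norm_mul]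
            have hG := norm_G_le τ s₀
            calc _ ≤ 1 * (1 * |K|) := by gcongr; norm_num
              _ = |K| := by ring
    refine ⟨(∫ s, ‖weight ξ a s‖ * C ∂slab R) + C', add_nonneg (integral_nonneg fun s => by
      positivity) hC'0, fun τ s₀ c hc => ?_⟩
    refine (norm_add_le _ _).trans (add_le_add (norm_integral_le_of_norm_le
      ((integrable_weight hξ a).norm.mul_const C) (Eventually.of_forall fun s => ?_)) (hC' τ s₀ c hc))
    rw [norm_mul, norm_mul]
    calc _ ≤ 1 * (‖weight ξ a s‖ * C) := by
          gcongr
          · exact norm_G_le _ _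
          · exact hC _ _ _ fun u => hc _
      _ = _ := one_mul _

theorem measurable_nestLimit (hξ : Measurable ξ) (w : List Letter) :
    ∀ {Θ : Type} [MeasurableSpace Θ] (c : Θ → (ℕ → ℝ) → ℂ),
    (Measurable fun p : Θ × (ℕ → ℝ) => c p.1 p.2) →
    Measurable fun p : (ℝ × ℝ) × Θ => nestLimit R ξ w p.1.1 p.1.2 (c p.2) := by
  induction w with
  | nil => intro Θ _ c hc; exact measurable_const
  | cons a w ih =>
    intro Θ _ c hc
    have hc' : Measurable fun p : (Θ × ℝ) × (ℕ → ℝ) => c p.1.1 (cons p.1.2 p.2) :=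
      hc.comp ((measurable_fst.comp measurable_fst).prodMk
        (measurable_cons.comp ((measurable_snd.comp measurable_fst).prodMk measurable_snd)))
    have key : Measurable fun p : ((ℝ × ℝ) × Θ) × ℝ =>
        nestLimit R ξ w p.2 p.1.1.2 fun u => c p.1.2 (cons p.2 u) :=
      (ih (fun q : Θ × ℝ => fun u => c q.1 (cons q.2 u)) hc').comp
        ((measurable_snd.prodMk (measurable_snd.comp (measurable_fst.comp measurable_fst))).prodMk
          ((measurable_snd.comp measurable_fst).prodMk measurable_snd))
    refine Measurable.add (measurable_integral_slab
      ((measurable_ofReal_G (measurable_fst.comp (measurable_fst.comp measurable_fst))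
        measurable_snd).mul (((measurable_weight hξ a).comp measurable_snd).mul key))) ?_
    cases a with
    | drift => exact measurable_const
    | pair => exact measurable_const
    | noise =>
      cases w with
      | nil => exact measurable_const
      | cons b w =>
        cases b with
        | drift => exact measurable_const
        | pair => exact measurable_const
        | noise =>
          simp only [headLimit]
          have hc'' : Measurable fun p : (Θ × ℝ) × (ℕ → ℝ) =>
              c p.1.1 (cons p.1.2 (cons p.1.2 p.2)) := by
            refine hc.comp ((measurable_fst.comp measurable_fst).prodMk
              (measurable_cons.comp ((measurable_snd.comp measurable_fst).prodMk
                (measurable_cons.comp ((measurable_snd.comp measurable_fst).prodMk measurable_snd)))))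
          exact measurable_const.mul ((measurable_ofReal_G (measurable_fst.comp measurable_fst)
            (measurable_snd.comp measurable_fst)).mul ((measurable_nest hξ measurable_const w 0
            (fun q : Θ × ℝ => fun u => c q.1 (cons q.2 (cons q.2 u))) hc'').comp
            ((measurable_snd.comp measurable_fst).prodMk
              (measurable_snd.prodMk (measurable_snd.comp measurable_fst)))))

/-- Mollifiers have `L¹` norm at most one, which is the last summand of `K`; the bound is therefore
uniform in `n` and serves for domination. -/
theorem IsMollifier.exists_norm_nest_le (hδ : IsMollifier δ ε s₀) (hξ : Integrable ξ (slab R))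
    (w : List Letter) {M : ℝ} (hM0 : 0 ≤ M) : ∃ C, 0 ≤ C ∧ ∀ (n j : ℕ) (τ : ℝ) (c : (ℕ → ℝ) → ℂ),
      (∀ u, ‖c u‖ ≤ M) → ‖nest R ξ (fun s => (δ n s : ℂ)) w j τ c‖ ≤ C := by
  set K := (∫ s, (1 + ‖ξ s‖) ∂slab R) + 1
  have hK0 : 0 ≤ K := add_nonneg (integral_nonneg fun s => by positivity) zero_le_one
  refine ⟨M * K ^ w.length, by positivity, fun n j τ c hc =>
    norm_nest_le hξ (hδ.integrable_slab n).ofReal ?_ w j τ hc⟩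
  have hint : Integrable (fun s => 1 + ‖ξ s‖) (slab R) := (integrable_const 1).add hξ.norm
  rw [integral_add hint (hδ.integrable_slab n).ofReal.norm]
  refine add_le_add le_rfl ((integral_congr_ae (Eventually.of_forall fun s => ?_)).trans_le
    (hδ.integral_slab_le n))
  exact (Complex.norm_real _).trans (Real.norm_of_nonneg (hδ.nonneg n s))

/-- Here the leading letter carries one mollifier. If the next letter carries the other, the limit
is half of the kernel at coinciding times; if a deeper letter does, the time of the next letter is
squeezed and the limit is zero. The conditions `τ ≠ s₀` and `s₀ ∉ E` make the propagator and the
kernel continuous at the coincidence point. -/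
theorem IsMollifier.tendsto_head (hδ : IsMollifier δ ε s₀) (hs : s₀ ∈ Ioo (-R) R)
    (hξ : Integrable ξ (slab R)) (hξm : Measurable ξ) {E : Set ℝ} (hE : E.Countable) (hsE : s₀ ∉ E)
    {M : ℝ} (a : Letter) (w : List Letter) {τ : ℝ} (hτ : τ ≠ s₀) {c : (ℕ → ℝ) → ℂ}
    (hc : Measurable c) (hM : ∀ u, ‖c u‖ ≤ M)
    (hcE : ∀ u, (∀ j < (a :: w).length, u j ∉ E) → ContinuousAt c u) :
    Tendsto (fun n => ∫ s, (G τ s : ℂ) * (dweight (fun s => (δ n s : ℂ)) a s *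
      nest R ξ (fun s => (δ n s : ℂ)) w 1 s fun u => c (cons s u)) ∂slab R) atTop
      (𝓝 (headLimit R ξ τ s₀ c (a :: w))) := by
  have hM0 : 0 ≤ M := (norm_nonneg _).trans (hM 0)
  cases a with
  | drift => simp [dweight, headLimit]
  | pair => simp [dweight, headLimit]
  | noise =>
    cases w with
    | nil => simp [nest, headLimit]
    | cons b w =>
      obtain ⟨C, hC0, hC⟩ := hδ.exists_norm_nest_le hξ w hM0
      have hs1 : ∀ s, Measurable (cons s) := fun s =>
        measurable_cons.comp (measurable_const.prodMk measurable_id)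
      have hc1 : Measurable fun p : (ℝ × ℝ) × (ℕ → ℝ) => c (cons p.1.1 (cons p.1.2 p.2)) :=
        hc.comp (measurable_cons.comp ((measurable_fst.comp measurable_fst).prodMk
          (measurable_cons.comp ((measurable_snd.comp measurable_fst).prodMk measurable_snd))))
      have hδm : ∀ n, Measurable fun s => (δ n s : ℂ) := fun n =>
        Complex.measurable_ofReal.comp (hδ.continuous n).measurable
      have hδi : ∀ n, Integrable (fun s => (δ n s : ℂ)) (slab R) := fun n =>
        (hδ.integrable_slab n).ofReal
      -- `N1` has the second mollifier strictly below the second letter; in `N0` the second letter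
      -- has already used it, so that no mollifier remains.
      set N1 : ℕ → ℝ → ℝ → ℂ := fun n s s' => nest R ξ (fun s => (δ n s : ℂ)) w 1 s'
        fun u => c (cons s (cons s' u))
      set N0 : ℝ → ℝ → ℂ := fun s s' => nest R ξ 0 w 0 s' fun u => c (cons s (cons s' u))
      have hN0 : ∀ n s s', nest R ξ (fun s => (δ n s : ℂ)) w 0 s'
          (fun u => c (cons s (cons s' u))) = N0 s s' := fun n s s' => nest_zero_congr _ _ _ _ _ _
      have hN0b : ∀ s s', ‖N0 s s'‖ ≤ C := fun s s' => by
        rw [← hN0 0]; exact hC _ _ _ _ fun u => hM _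
      have hN0m : Measurable fun p : ℝ × ℝ => N0 p.1 p.2 :=
        (measurable_nest hξm measurable_const w 0
          (fun p : ℝ × ℝ => fun u => c (cons p.1 (cons p.2 u))) hc1).comp
          (measurable_snd.prodMk measurable_id)
      have hinner : ∀ n s, (nest R ξ (fun s => (δ n s : ℂ)) (b :: w) 1 s fun u => c (cons s u)) =
          (∫ s', (G s s' : ℂ) * (weight ξ b s' * N1 n s s') ∂slab R) +
          ∫ s', (G s s' : ℂ) * (dweight (fun s => (δ n s : ℂ)) b s' * N0 s s') ∂slab R := by
        intro n s
        have j1 := integrable_weight_mul_nest hξ (hδi n) hξm (hδm n) (integrable_weight hξ b) w 1 s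
          (hc.comp (hs1 s)) (fun u => hM _)
        have j2 := integrable_weight_mul_nest hξ (hδi n) hξm (hδm n)
          (integrable_dweight (hδi n) b) w 0 s (hc.comp (hs1 s)) (fun u => hM _)
        simp only [Function.comp_apply, hN0] at j1 j2
        rw [← integral_add j1 j2]
        simp only [nest, hN0, mul_add]
      have hN1m : ∀ n, Measurable fun p : ℝ × ℝ => N1 n p.1 p.2 := fun n =>
        (measurable_nest hξm (hδm n) w 1
          (fun p : ℝ × ℝ => fun u => c (cons p.1 (cons p.2 u))) hc1).comp
          (measurable_snd.prodMk measurable_id)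
      -- Second mollifier below the second letter: this part tends to zero.
      have hA := hδ.tendsto_integral_small (R := R) (b := fun s' => ‖weight ξ b s'‖ * C)
        ((integrable_weight hξ b).norm.mul_const C) (fun s => by positivity)
        (q := fun n s s' => (G τ s : ℂ) * (weight ξ b s' * N1 n s s'))
        (fun n s s' => by
          rw [norm_mul, norm_mul]
          calc _ ≤ 1 * (‖weight ξ b s'‖ * C) := by
                gcongr
                · exact norm_G_le _ _
                · exact hC _ _ _ _ fun u => hM _
            _ = _ := one_mul _)
        (fun n s s' h => by
          have : N1 n s s' = 0 := nest_succ_eq_zero w 0 s' _ fun r hr => by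
            rw [hδ.eq_zero n r, Complex.ofReal_zero]
            rw [abs_sub_comm]
            exact le_trans (by linarith) (le_abs_self _)
          rw [this, mul_zero, mul_zero])
      -- Both mollifiers on the two leading letters: the only part that survives, and only if both
      -- letters are `noise`.
      have hB : Tendsto (fun n => ∫ s, (δ n s : ℂ) * ∫ s', (G s s' : ℂ) *
          (dweight (fun s => (δ n s : ℂ)) b s' * ((G τ s : ℂ) * N0 s s')) ∂slab R ∂slab R) atTop
          (𝓝 (headLimit R ξ τ s₀ c (noise :: b :: w))) := by
        cases b with
        | drift => simp [dweight, headLimit]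
        | pair => simp [dweight, headLimit]
        | noise =>
          refine hδ.tendsto_integral_pair hs (h := fun s s' => (G τ s : ℂ) * N0 s s')
            ((measurable_ofReal_G measurable_const measurable_fst).mul hN0m) (M := C)
            (fun s s' => ?_) ?_
          · rw [norm_mul]
            calc _ ≤ 1 * C := by
                  gcongr
                  · exact norm_G_le _ _
                  · exact hN0b _ _
              _ = _ := one_mul _
          · refine (tendsto_G tendsto_const_nhds (continuous_fst.tendsto (s₀, s₀)) hτ).mul ?_
            refine tendsto_nest_zero hξ (integrable_zero _ _ _) hξm measurable_const (M := M) hE w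
              (fun p : ℝ × ℝ => p.2) s₀ (fun p : ℝ × ℝ => fun u => c (cons p.1 (cons p.2 u))) _
              (continuous_snd.tendsto (s₀, s₀)) (fun p => hc.comp ((hs1 _).comp (hs1 _)))
              (fun p u => hM _) fun u hu => ?_
            have h1 : ContinuousAt c (cons s₀ (cons s₀ u)) := hcE _ fun j hj => by
              match j with
              | 0 => exact hsE
              | 1 => exact hsE
              | j + 2 => exact hu j (by simpa using hj)
            have h2 : Continuous fun p : ℝ × ℝ => cons p.1 (cons p.2 u) :=
              continuous_cons.comp (continuous_fst.prodMk
                (continuous_cons.comp (continuous_snd.prodMk continuous_const)))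
            exact h1.tendsto.comp (h2.tendsto (s₀, s₀))
      have hAB := hA.add hB
      rw [zero_add] at hAB
      refine hAB.congr fun n => ?_
      have hbd : ∀ (g : ℝ → ℂ) (h : ℝ → ℝ → ℂ), Integrable g (slab R) → Measurable g →
          (Measurable fun p : ℝ × ℝ => h p.1 p.2) → (∀ s s', ‖h s s'‖ ≤ C) →
          Integrable (fun s => (δ n s : ℂ) * ∫ s', (G s s' : ℂ) * (g s' * h s s') ∂slab R)
            (slab R) := by
        intro g h hg hgm hhm hb
        have hbound : ∀ s, ‖∫ s', (G s s' : ℂ) * (g s' * h s s') ∂slab R‖ ≤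
            ∫ s', ‖g s'‖ * C ∂slab R := fun s => by
          refine norm_integral_le_of_norm_le (hg.norm.mul_const C) (Eventually.of_forall fun s' => ?_)
          rw [norm_mul, norm_mul]
          calc _ ≤ 1 * (‖g s'‖ * C) := by
                gcongr
                · exact norm_G_le _ _
                · exact hb _ _
            _ = _ := one_mul _
        have := (hδi n).bdd_mul (measurable_integral_slab ((measurable_ofReal_G measurable_fst
          measurable_snd).mul ((hgm.comp measurable_snd).mul hhm))).aestronglyMeasurable
          (Eventually.of_forall hbound)
        simpa only [mul_comm] using this
      have hGb : ∀ (h : ℝ → ℝ → ℂ), (∀ s s', ‖h s s'‖ ≤ C) → ∀ s s', ‖(G τ s : ℂ) * h s s'‖ ≤ C :=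
        fun h hh s s' => by
          rw [norm_mul]
          calc _ ≤ 1 * C := by
                gcongr
                · exact norm_G_le _ _
                · exact hh _ _
            _ = _ := one_mul _
      have hGm : Measurable fun p : ℝ × ℝ => (G τ p.1 : ℂ) :=
        measurable_ofReal_G measurable_const measurable_fst
      have I1 := hbd (weight ξ b) (fun s s' => (G τ s : ℂ) * N1 n s s') (integrable_weight hξ b)
        (measurable_weight hξm b) (hGm.mul (hN1m n)) (hGb _ fun s s' => hC _ _ _ _ fun u => hM _)
      have I2 := hbd (dweight (fun s => (δ n s : ℂ)) b) (fun s s' => (G τ s : ℂ) * N0 s s')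
        (integrable_dweight (hδi n) b) (measurable_dweight (hδm n) b) (hGm.mul hN0m) (hGb _ hN0b)
      have e1 : ∀ s s', (G τ s : ℂ) * (weight ξ b s' * N1 n s s') =
          weight ξ b s' * ((G τ s : ℂ) * N1 n s s') := fun s s' => by ring
      simp only [e1]
      rw [← integral_add I1 I2]
      congr 1
      ext s
      rw [hinner]
      have e2 : ∀ (g h : ℝ → ℂ), ∫ s', (G s s' : ℂ) * (g s' * ((G τ s : ℂ) * h s')) ∂slab R =
          (G τ s : ℂ) * ∫ s', (G s s' : ℂ) * (g s' * h s') ∂slab R := by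
        intro g h
        rw [← integral_const_mul]
        congr 1; ext s'; ring
      rw [e2 (weight ξ b) (N1 n s), e2 _ (N0 s)]
      simp only [dweight]
      ring

/-- The leading letter carries either no mollifier, which leaves the same problem for the tail under
an integral, or one of the two, which is the head contribution. -/
theorem IsMollifier.tendsto_nest_two (hδ : IsMollifier δ ε s₀) (hs : s₀ ∈ Ioo (-R) R)
    (hξ : Integrable ξ (slab R)) (hξm : Measurable ξ) {E : Set ℝ} (hE : E.Countable) (hsE : s₀ ∉ E)
    {M : ℝ} (w : List Letter) : ∀ {τ : ℝ} (_ : τ ≠ s₀) {c : (ℕ → ℝ) → ℂ}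
    (_ : Measurable c) (_ : ∀ u, ‖c u‖ ≤ M)
    (_ : ∀ u, (∀ j < w.length, u j ∉ E) → ContinuousAt c u),
    Tendsto (fun n => nest R ξ (fun s => (δ n s : ℂ)) w 2 τ c) atTop
      (𝓝 (nestLimit R ξ w τ s₀ c)) := by
  induction w with
  | nil => intro τ hτ c _ _ _; simp [nest, nestLimit]
  | cons a w ih =>
    intro τ hτ c hc hM hcE
    have hM0 : 0 ≤ M := (norm_nonneg _).trans (hM 0)
    have hs1 : ∀ s, Measurable (cons s) := fun s =>
      measurable_cons.comp (measurable_const.prodMk measurable_id)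
    have hδm : ∀ n, Measurable fun s => (δ n s : ℂ) := fun n =>
      Complex.measurable_ofReal.comp (hδ.continuous n).measurable
    have hδi : ∀ n, Integrable (fun s => (δ n s : ℂ)) (slab R) := fun n =>
      (hδ.integrable_slab n).ofReal
    obtain ⟨C, hC0, hC⟩ := hδ.exists_norm_nest_le hξ w hM0
    have I1 := fun n => integrable_weight_mul_nest hξ (hδi n) hξm (hδm n) (integrable_weight hξ a)
      w 2 τ hc hM
    have I2 := fun n => integrable_weight_mul_nest hξ (hδi n) hξm (hδm n)
      (integrable_dweight (hδi n) a) w 1 τ hc hM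
    have hsplit : ∀ n, nest R ξ (fun s => (δ n s : ℂ)) (a :: w) 2 τ c =
        (∫ s, (G τ s : ℂ) * (weight ξ a s *
          nest R ξ (fun s => (δ n s : ℂ)) w 2 s fun u => c (cons s u)) ∂slab R) +
        ∫ s, (G τ s : ℂ) * (dweight (fun s => (δ n s : ℂ)) a s *
          nest R ξ (fun s => (δ n s : ℂ)) w 1 s fun u => c (cons s u)) ∂slab R := by
      intro n
      rw [← integral_add (I1 n) (I2 n)]
      simp only [nest, mul_add]
    simp only [hsplit, nestLimit]
    refine Tendsto.add ?_ (hδ.tendsto_head hs hξ hξm hE hsE a w hτ hc hM hcE)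
    refine tendsto_integral_filter_of_dominated_convergence (fun s => ‖weight ξ a s‖ * C)
      (Eventually.of_forall fun n => (I1 n).aestronglyMeasurable)
      (Eventually.of_forall fun n => Eventually.of_forall fun s => ?_)
      ((integrable_weight hξ a).norm.mul_const C) ?_
    · rw [norm_mul, norm_mul]
      calc _ ≤ 1 * (‖weight ξ a s‖ * C) := by
            gcongr
            · exact norm_G_le _ _
            · exact hC _ _ _ _ fun u => hM _
        _ = _ := one_mul _
    -- The induction hypothesis requires the new upper limit `s` to differ from `s₀`, and `s ∉ E` is
    -- needed for continuity; both fail on a null set only.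
    · filter_upwards [ae_slab_notMem hE, ae_slab_notMem (countable_singleton s₀)] with s hsE' hss
      refine tendsto_const_nhds.mul (tendsto_const_nhds.mul ?_)
      refine ih hss (hc.comp (hs1 s)) (fun u => hM _) fun u hu => ?_
      have h1 : ContinuousAt c (cons s u) := hcE _ fun j hj => by
        cases j with
        | zero => exact hsE'
        | succ j => exact hu j (by simpa using hj)
      exact h1.comp (continuous_cons.comp (continuous_const.prodMk continuous_id)).continuousAt

/-- A mollifier concentrating outside the slab eventually has no mass where the times are
integrated. -/
theorem IsMollifier.eventually_nest_two_eq_zero (hδ : IsMollifier δ ε s₀) (hs : R < |s₀|)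
    (w : List Letter) : ∀ᶠ n in atTop, ∀ (j : ℕ) (τ : ℝ) (c : (ℕ → ℝ) → ℂ),
      nest R ξ (fun s => (δ n s : ℂ)) w (j + 1) τ c = 0 := by
  filter_upwards [hδ.tendsto.eventually (gt_mem_nhds (sub_pos.2 hs))] with n hn
  have hz : ∀ s ∈ Icc (-R) R, δ n s = 0 := fun s hsR => by
    refine hδ.eq_zero n s (hn.le.trans ?_)
    have : |s| ≤ R := abs_le.2 hsR
    have := abs_sub_abs_le_abs_sub s₀ s
    rw [abs_sub_comm] at this
    linarith
  induction w with
  | nil => intro j τ c; rfl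
  | cons a w ih =>
    intro j τ c
    simp only [nest]
    refine integral_eq_zero_of_ae ?_
    filter_upwards [ae_restrict_mem measurableSet_Icc] with s hsR
    have : dweight (fun s => (δ n s : ℂ)) a s = 0 := by cases a <;> simp [dweight, hz s hsR]
    simp [this, ih j]

end MSR
end
noncomputable section
namespace MSR

open MeasureTheory Filter Topology Set Letter

/-! ### Polynomials with coefficients in an algebra of functions -/

/-- The coefficients of the family `P` of polynomials belong to the function algebra `𝒜`. -/
def CoeffIn {Θ ι : Type} (𝒜 : Subalgebra ℂ (Θ → ℂ)) (P : Θ → MvPolynomial ι ℂ) : Prop :=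
  ∀ m, (fun θ => (P θ).coeff m) ∈ 𝒜

namespace CoeffIn

variable {Θ ι : Type} {𝒜 : Subalgebra ℂ (Θ → ℂ)} {P Q : Θ → MvPolynomial ι ℂ}

theorem add (hP : CoeffIn 𝒜 P) (hQ : CoeffIn 𝒜 Q) : CoeffIn 𝒜 fun θ => P θ + Q θ := fun m => by
  simp only [MvPolynomial.coeff_add]
  exact 𝒜.add_mem (hP m) (hQ m)

theorem mul (hP : CoeffIn 𝒜 P) (hQ : CoeffIn 𝒜 Q) : CoeffIn 𝒜 fun θ => P θ * Q θ := fun m => by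
  classical
  have : (fun θ => (P θ * Q θ).coeff m) = ∑ x ∈ Finset.HasAntidiagonal.antidiagonal m,
      (fun θ => (P θ).coeff x.1) * fun θ => (Q θ).coeff x.2 := by
    ext θ
    simp [MvPolynomial.coeff_mul, Finset.sum_apply]
  rw [this]
  exact 𝒜.sum_mem fun x _ => 𝒜.mul_mem (hP _) (hQ _)

theorem const (P : MvPolynomial ι ℂ) : CoeffIn 𝒜 fun _ : Θ => P := fun m =>
  𝒜.algebraMap_mem (P.coeff m)

theorem C {h : Θ → ℂ} (hh : h ∈ 𝒜) : CoeffIn 𝒜 fun θ => (MvPolynomial.C (h θ) : MvPolynomial ι ℂ) :=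
  fun m => by
  classical
  simp only [MvPolynomial.coeff_C]
  by_cases hm : 0 = m
  · simpa [hm] using hh
  · simp only [hm, if_false]
    exact 𝒜.zero_mem

theorem smul {h : Θ → ℂ} (hh : h ∈ 𝒜) (hP : CoeffIn 𝒜 P) : CoeffIn 𝒜 fun θ => h θ • P θ := by
  simp only [MvPolynomial.smul_eq_C_mul]
  exact (CoeffIn.C hh).mul hP

theorem sum {κ : Type} (s : Finset κ) {P : κ → Θ → MvPolynomial ι ℂ}
    (hP : ∀ i ∈ s, CoeffIn 𝒜 (P i)) : CoeffIn 𝒜 fun θ => ∑ i ∈ s, P i θ := fun m => by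
  have : (fun θ => (∑ i ∈ s, P i θ).coeff m) = ∑ i ∈ s, fun θ => (P i θ).coeff m := by
    ext θ
    simp [MvPolynomial.coeff_sum, Finset.sum_apply]
  rw [this]
  exact 𝒜.sum_mem fun i hi => hP i hi m

theorem pow (hP : CoeffIn 𝒜 P) (n : ℕ) : CoeffIn 𝒜 fun θ => P θ ^ n := by
  induction n with
  | zero => simpa using const 1
  | succ n ih => simpa only [pow_succ] using ih.mul hP

theorem pderiv (hP : CoeffIn 𝒜 P) (i : ι) : CoeffIn 𝒜 fun θ => MvPolynomial.pderiv i (P θ) :=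
  fun m => by
  have : (fun θ => (MvPolynomial.pderiv i (P θ)).coeff m) =
      ((m i + 1 : ℕ) : ℂ) • fun θ => (P θ).coeff (m + Finsupp.single i 1) := by
    ext θ
    rw [MvPolynomial.coeff_pderiv]
    simp [mul_comm]
  rw [this]
  exact 𝒜.smul_mem (hP _) _

end CoeffIn

/-- The algebra of measurable functions. -/
def measAlg (Θ : Type) [MeasurableSpace Θ] : Subalgebra ℂ (Θ → ℂ) where
  carrier := {h | Measurable h}
  mul_mem' hf hg := Measurable.mul hf hg
  add_mem' hf hg := Measurable.add hf hg
  algebraMap_mem' r := measurable_const (a := r)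

/-- The algebra of bounded functions. -/
def bddAlg (Θ : Type) : Subalgebra ℂ (Θ → ℂ) where
  carrier := {h | ∃ C, ∀ θ, ‖h θ‖ ≤ C}
  mul_mem' := by
    rintro f g ⟨C, hC⟩ ⟨C', hC'⟩
    refine ⟨C * C', fun θ => ?_⟩
    simp only [Pi.mul_apply, norm_mul]
    exact mul_le_mul (hC θ) (hC' θ) (norm_nonneg _) ((norm_nonneg _).trans (hC θ))
  add_mem' := by
    rintro f g ⟨C, hC⟩ ⟨C', hC'⟩
    exact ⟨C + C', fun θ => (norm_add_le _ _).trans (add_le_add (hC θ) (hC' θ))⟩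
  algebraMap_mem' r := ⟨‖r‖, fun _ => le_rfl⟩

/-- The algebra of functions that are continuous at a point. -/
def contAtAlg {Θ : Type} [TopologicalSpace Θ] (θ : Θ) : Subalgebra ℂ (Θ → ℂ) where
  carrier := {h | ContinuousAt h θ}
  mul_mem' hf hg := ContinuousAt.mul hf hg
  add_mem' hf hg := ContinuousAt.add hf hg
  algebraMap_mem' r := continuousAt_const (y := r)

/-- The algebra of continuous functions. -/
def contAlg (Θ : Type) [TopologicalSpace Θ] : Subalgebra ℂ (Θ → ℂ) where
  carrier := {h | Continuous h}
  mul_mem' hf hg := Continuous.mul hf hg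
  add_mem' hf hg := Continuous.add hf hg
  algebraMap_mem' r := continuous_const (y := r)

/-- The value `γ(y, s)` for `y` in a complex algebra. -/
def polyIn {A : Type} [CommRing A] [Algebra ℂ A] (γ : Polynomial Config) (s : ℝ) (y : A) : A :=
  Polynomial.aeval y (γ.map (Complex.ofRealHom.comp (evalAt s)))

theorem map_polyIn {A B : Type} [CommRing A] [Algebra ℂ A] [CommRing B] [Algebra ℂ B]
    (φ : A →ₐ[ℂ] B) (γ : Polynomial Config) (s : ℝ) (y : A) :
    φ (polyIn γ s y) = polyIn γ s (φ y) :=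
  (Polynomial.aeval_algHom_apply φ y _).symm

theorem derivation_polyIn {A : Type} [CommRing A] [Algebra ℂ A] (D : Derivation ℂ A A)
    (γ : Polynomial Config) (s : ℝ) (y : A) :
    D (polyIn γ s y) = polyIn (Polynomial.derivative γ) s y * D y := by
  rw [polyIn, polyIn, Derivation.map_aeval, Polynomial.derivative_map, smul_eq_mul]

/-- The data of the stochastic differential equation, with a bound for the support of the
cut-off. -/
structure Model where
  /-- the cut-off -/
  χ : ℝ → ℝ
  /-- the strength of the noise -/
  σ : ℝ
  /-- the drift -/
  α : Polynomial Config
  /-- the diffusion coefficient -/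
  β : Polynomial Config
  /-- the initial configuration -/
  x₀ : Config
  /-- a bound for the support of the cut-off -/
  R : ℝ
  continuous : Continuous χ
  σ_nonneg : 0 ≤ σ
  R_pos : 0 < R
  χ_eq_zero : ∀ s, R ≤ |s| → χ s = 0

namespace Model

variable (m : Model)

/-- The coefficient of the first derivative in the vertex operator of a letter. -/
def lin {A : Type} [CommRing A] [Algebra ℂ A] (a : Letter) (s : ℝ) (y : A) : A :=
  match a with
  | drift => (m.χ s : ℂ) • polyIn m.α s y
  | noise => (√m.σ * m.χ s : ℂ) • polyIn m.β s y
  | pair => (1 / 2 * m.σ * m.χ s ^ 2 : ℂ) •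
      (polyIn m.β s y * polyIn (Polynomial.derivative m.β) s y)

/-- The coefficient of the second derivative in the vertex operator of a letter. -/
def quad {A : Type} [CommRing A] [Algebra ℂ A] (a : Letter) (s : ℝ) (y : A) : A :=
  match a with
  | pair => (1 / 2 * m.σ * m.χ s ^ 2 : ℂ) • polyIn m.β s y ^ 2
  | _ => 0

theorem map_lin {A B : Type} [CommRing A] [Algebra ℂ A] [CommRing B] [Algebra ℂ B]
    (φ : A →ₐ[ℂ] B) (a : Letter) (s : ℝ) (y : A) : φ (m.lin a s y) = m.lin a s (φ y) := by
  cases a <;> simp only [lin, map_smul, map_mul, map_polyIn]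

theorem map_quad {A B : Type} [CommRing A] [Algebra ℂ A] [CommRing B] [Algebra ℂ B]
    (φ : A →ₐ[ℂ] B) (a : Letter) (s : ℝ) (y : A) : φ (m.quad a s y) = m.quad a s (φ y) := by
  cases a <;> simp only [quad, map_smul, map_pow, map_polyIn, map_zero]

theorem lin_eq_zero {A : Type} [CommRing A] [Algebra ℂ A] (a : Letter) {s : ℝ} (y : A)
    (hs : m.χ s = 0) : m.lin a s y = 0 := by cases a <;> simp [lin, hs]

theorem quad_eq_zero {A : Type} [CommRing A] [Algebra ℂ A] (a : Letter) {s : ℝ} (y : A)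
    (hs : m.χ s = 0) : m.quad a s y = 0 := by cases a <;> simp [quad, hs]

end Model

/-- Polynomials in the values of the increment `x_ξ - x₀` stopped at a given time: `none` stands for
its value at that time, `some i` for its value at `t i`. -/
abbrev State (k : ℕ) : Type := MvPolynomial (Option (Fin k)) ℂ

/-- The derivative with respect to the increments that are still moving at time `s`. -/
def shift {k : ℕ} (t : Fin k → ℝ) (s : ℝ) : Derivation ℂ (State k) (State k) :=
  MvPolynomial.pderiv none + ∑ i, (G (t i) s : ℂ) • MvPolynomial.pderiv (some i)

theorem shift_apply {k : ℕ} (t : Fin k → ℝ) (s : ℝ) (P : State k) :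
    shift t s P = MvPolynomial.pderiv none P +
      ∑ i, (G (t i) s : ℂ) • MvPolynomial.pderiv (some i) P := by
  have : ∀ (S : Finset (Fin k)), (∑ i ∈ S, (G (t i) s : ℂ) •
      (MvPolynomial.pderiv (some i) : Derivation ℂ (State k) (State k))) P =
      ∑ i ∈ S, (G (t i) s : ℂ) • MvPolynomial.pderiv (some i) P := by
    intro S
    classical
    induction S using Finset.induction_on with
    | empty => simp
    | insert i S hi ih => simp [Finset.sum_insert hi, ih]
  rw [shift, Derivation.add_apply, this]

@[simp] theorem shift_none {k : ℕ} (t : Fin k → ℝ) (s : ℝ) :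
    shift t s (MvPolynomial.X none) = 1 := by
  rw [shift_apply, MvPolynomial.pderiv_X_self, Finset.sum_eq_zero, add_zero]
  intro i _
  rw [MvPolynomial.pderiv_X_of_ne (by simp), smul_zero]

@[simp] theorem shift_some {k : ℕ} (t : Fin k → ℝ) (s : ℝ) (i : Fin k) :
    shift t s (MvPolynomial.X (some i)) = MvPolynomial.C (G (t i) s : ℂ) := by
  rw [shift_apply, MvPolynomial.pderiv_X_of_ne (by simp), zero_add, Finset.sum_eq_single i]
  · rw [MvPolynomial.pderiv_X_self, MvPolynomial.smul_eq_C_mul, mul_one]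
  · intro j _ hj
    rw [MvPolynomial.pderiv_X_of_ne (by simpa using hj.symm), smul_zero]
  · simp

/-! ### Vertex operators and the kernels of words -/

namespace Model

variable (m : Model) {k : ℕ}

/-- The position of a vertex at time `s`. -/
def position (s : ℝ) : State k := MvPolynomial.C ((m.x₀ : ℝ → ℝ) s : ℂ) + MvPolynomial.X none

@[simp] theorem shift_position (t : Fin k → ℝ) (s r : ℝ) : shift t s (m.position r) = 1 := by
  rw [position, map_add, shift_none, MvPolynomial.derivation_C, zero_add]

/-- The operator of a vertex at time `s`. -/
def vertexOp (a : Letter) (t : Fin k → ℝ) (s : ℝ) : State k →ₗ[ℂ] State k :=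
  LinearMap.mulLeft ℂ (m.lin a s (m.position s)) ∘ₗ (shift t s : State k →ₗ[ℂ] State k) +
  LinearMap.mulLeft ℂ (m.quad a s (m.position s)) ∘ₗ (shift t s : State k →ₗ[ℂ] State k) ∘ₗ
    (shift t s : State k →ₗ[ℂ] State k)

theorem vertexOp_apply (a : Letter) (t : Fin k → ℝ) (s : ℝ) (P : State k) :
    m.vertexOp a t s P = m.lin a s (m.position s) * shift t s P +
      m.quad a s (m.position s) * shift t s (shift t s P) := rfl

/-- Since `shift` sends the position to `1`, the Leibniz rule gives `(β ∂)(β ∂ P) = β β₁ ∂P + β²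
∂²P`, and `√σ` squares to `σ`. The first term produces the Stratonovich drift `½ σ χ² β β₁` of the
interaction, the second its part quadratic in `x̃`. -/
theorem vertexOp_noise_noise (t : Fin k → ℝ) (s : ℝ) (P : State k) :
    m.vertexOp noise t s (m.vertexOp noise t s P) = (2 : ℂ) • m.vertexOp pair t s P := by
  have hσ : (√m.σ : ℂ) * √m.σ = m.σ := by
    rw [← Complex.ofReal_mul, Real.mul_self_sqrt m.σ_nonneg]
  simp only [vertexOp_apply, lin, quad, zero_mul, add_zero]
  rw [smul_mul_assoc, smul_mul_assoc, Derivation.map_smul, Derivation.leibniz, derivation_polyIn,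
    shift_position]
  simp only [smul_eq_mul, mul_one, MvPolynomial.smul_eq_C_mul, map_mul, map_pow]
  rw [← hσ]
  have h2 : (MvPolynomial.C (2 : ℂ) : State k) * MvPolynomial.C (1 / 2 : ℂ) = 1 := by
    rw [← map_mul]; norm_num
  simp only [map_mul]
  -- The two sides now differ only by the factor `2 · ½`, which is hidden inside constants of the
  -- polynomial ring.
  linear_combination -(MvPolynomial.C (√m.σ : ℂ) * MvPolynomial.C (√m.σ : ℂ) *
    MvPolynomial.C (m.χ s : ℂ) ^ 2 * (polyIn m.β s (m.position s) *
      polyIn (Polynomial.derivative m.β) s (m.position s) * shift t s P +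
      polyIn m.β s (m.position s) ^ 2 * shift t s (shift t s P))) * h2

/-- The kernel of a word: the value at zero of the vertex operators of its letters, at the times
`u 0, u 1, …`, applied to `P`. -/
def kern : List Letter → (Fin k → ℝ) → State k → (ℕ → ℝ) → ℂ
  | [], _, P, _ => P.coeff 0
  | a :: w, t, P, u => kern w t (m.vertexOp a t (u 0) P) fun n => u (n + 1)

theorem kern_cons_cons (a : Letter) (w : List Letter) (t : Fin k → ℝ) (P : State k) (s : ℝ)
    (u : ℕ → ℝ) : m.kern (a :: w) t P (cons s u) = m.kern w t (m.vertexOp a t s P) u := rfl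

theorem kern_smul (w : List Letter) (t : Fin k → ℝ) : ∀ (a : ℂ) (P : State k) (u : ℕ → ℝ),
    m.kern w t (a • P) u = a * m.kern w t P u := by
  induction w with
  | nil => intro a P u; simp [kern]
  | cons b w ih => intro a P u; simp [kern, ih]

/-- A kernel arises by ring operations and formal derivatives from the propagators, the vertex
coefficients and `P`. So it lies in every function algebra that contains these; measurability,
boundedness and continuity of kernels are instances for different algebras. -/
theorem kern_mem {Θ : Type} (𝒜 : Subalgebra ℂ (Θ → ℂ)) (w : List Letter) :
    ∀ (t : Θ → Fin k → ℝ) (P : Θ → State k) (u : Θ → ℕ → ℝ),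
    (∀ i, ∀ j < w.length, (fun θ => (G (t θ i) (u θ j) : ℂ)) ∈ 𝒜) →
    (∀ j < w.length, ∀ a, CoeffIn 𝒜 fun θ => m.lin a (u θ j) (m.position (u θ j) : State k)) →
    (∀ j < w.length, ∀ a, CoeffIn 𝒜 fun θ => m.quad a (u θ j) (m.position (u θ j) : State k)) →
    CoeffIn 𝒜 P → (fun θ => m.kern w (t θ) (P θ) (u θ)) ∈ 𝒜 := by
  induction w with
  | nil => intro t P u _ _ _ hP; exact hP 0
  | cons a w ih =>
    intro t P u hG hl hq hP
    have hD : ∀ {Q : Θ → State k}, CoeffIn 𝒜 Q → CoeffIn 𝒜 fun θ => shift (t θ) (u θ 0) (Q θ) := by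
      intro Q hQ
      simp only [shift_apply]
      exact (hQ.pderiv none).add (CoeffIn.sum _ fun i _ =>
        CoeffIn.smul (hG i 0 (by simp)) (hQ.pderiv (some i)))
    refine ih t _ (fun θ n => u θ (n + 1)) (fun i j hj => hG i (j + 1) (by simpa using hj))
      (fun j hj => hl (j + 1) (by simpa using hj)) (fun j hj => hq (j + 1) (by simpa using hj)) ?_
    simp only [vertexOp_apply]
    exact ((hl 0 (by simp) a).mul (hD hP)).add ((hq 0 (by simp) a).mul (hD (hD hP)))

end Model

theorem coeffIn_contAlg_polyIn {k : ℕ} (m : Model) (γ : Polynomial Config) :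
    CoeffIn (contAlg ℝ) fun s => polyIn γ s (m.position s : State k) := by
  have hx : ∀ x : Config, (fun s => ((x : ℝ → ℝ) s : ℂ)) ∈ contAlg ℝ := fun x =>
    Complex.continuous_ofReal.comp (show ContDiff ℝ ∞ (x : ℝ → ℝ) from x.2).continuous
  have hpos : CoeffIn (contAlg ℝ) fun s => (m.position s : State k) :=
    (CoeffIn.C (hx m.x₀)).add (CoeffIn.const _)
  induction γ using Polynomial.induction_on' with
  | add p q hp hq =>
    have : ∀ s, polyIn (p + q) s (m.position s : State k) = polyIn p s (m.position s) +
      polyIn q s (m.position s) := fun s => by simp [polyIn, Polynomial.map_add]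
    simp only [this]
    exact hp.add hq
  | monomial n x =>
    have : ∀ s, polyIn (Polynomial.monomial n x) s (m.position s : State k) =
        MvPolynomial.C ((x : ℝ → ℝ) s : ℂ) * m.position s ^ n := fun s => by
      simp only [polyIn, Polynomial.map_monomial, Polynomial.aeval_monomial,
        MvPolynomial.algebraMap_eq]
      rfl
    simp only [this]
    exact (CoeffIn.C (hx x)).mul (hpos.pow n)

namespace Model

variable (m : Model) {k : ℕ}

theorem contAlg_χ : (fun s => (m.χ s : ℂ)) ∈ contAlg ℝ :=
  Complex.continuous_ofReal.comp m.continuous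

theorem coeffIn_lin (a : Letter) :
    CoeffIn (contAlg ℝ) fun s => m.lin a s (m.position s : State k) := by
  have hχ := m.contAlg_χ
  cases a
  · exact CoeffIn.smul hχ (coeffIn_contAlg_polyIn m _)
  · exact CoeffIn.smul ((contAlg ℝ).mul_mem ((contAlg ℝ).algebraMap_mem (√m.σ : ℂ)) hχ)
      (coeffIn_contAlg_polyIn m _)
  · exact CoeffIn.smul ((contAlg ℝ).mul_mem ((contAlg ℝ).algebraMap_mem (1 / 2 * m.σ : ℂ))
      ((contAlg ℝ).pow_mem hχ 2)) ((coeffIn_contAlg_polyIn m _).mul (coeffIn_contAlg_polyIn m _))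

theorem coeffIn_quad (a : Letter) :
    CoeffIn (contAlg ℝ) fun s => m.quad a s (m.position s : State k) := by
  have hχ := m.contAlg_χ
  cases a
  · exact CoeffIn.const 0
  · exact CoeffIn.const 0
  · exact CoeffIn.smul ((contAlg ℝ).mul_mem ((contAlg ℝ).algebraMap_mem (1 / 2 * m.σ : ℂ))
      ((contAlg ℝ).pow_mem hχ 2)) ((coeffIn_contAlg_polyIn m _).pow 2)

theorem exists_norm_le_of_χ {h : ℝ → ℂ} (hc : Continuous h) (h0 : ∀ s, m.χ s = 0 → h s = 0) :
    ∃ C, ∀ s, ‖h s‖ ≤ C := by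
  obtain ⟨C, hC⟩ := (isCompact_Icc (a := -m.R) (b := m.R)).exists_bound_of_continuousOn
    hc.continuousOn
  refine ⟨C, fun s => ?_⟩
  by_cases hs : s ∈ Icc (-m.R) m.R
  · exact hC s hs
  · have : m.R ≤ |s| := by
      by_contra! hlt
      exact hs (abs_le.1 hlt.le)
    rw [h0 s (m.χ_eq_zero s this), norm_zero]
    exact (norm_nonneg _).trans (hC 0 ⟨by linarith [m.R_pos], m.R_pos.le⟩)

theorem measurable_kern (w : List Letter) {Θ : Type} [MeasurableSpace Θ] {t : Θ → Fin k → ℝ}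
    {P : Θ → State k} (ht : Measurable t) (hP : CoeffIn (measAlg Θ) P) :
    Measurable fun p : Θ × (ℕ → ℝ) => m.kern w (t p.1) (P p.1) p.2 := by
  have hu : ∀ j, Measurable fun p : Θ × (ℕ → ℝ) => p.2 j := fun j =>
    (measurable_pi_apply j).comp measurable_snd
  refine m.kern_mem (measAlg _) w (fun p : Θ × (ℕ → ℝ) => t p.1) (fun p => P p.1)
    (fun p => p.2) ?_ ?_ ?_ ?_
  · intro i j _
    exact measurable_ofReal_G ((measurable_pi_apply i).comp (ht.comp measurable_fst)) (hu j)
  · intro j _ a d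
    exact (Continuous.measurable (m.coeffIn_lin a d)).comp (hu j)
  · intro j _ a d
    exact (Continuous.measurable (m.coeffIn_quad a d)).comp (hu j)
  · intro d
    exact Measurable.comp (hP d) measurable_fst

theorem exists_norm_kern_le (w : List Letter) {Θ : Type} (t : Θ → Fin k → ℝ) {P : Θ → State k}
    (hP : CoeffIn (bddAlg Θ) P) : ∃ M, ∀ θ u, ‖m.kern w (t θ) (P θ) u‖ ≤ M := by
  obtain ⟨M, hM⟩ := m.kern_mem (bddAlg (Θ × (ℕ → ℝ))) w (fun p : Θ × (ℕ → ℝ) => t p.1)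
    (fun p => P p.1) (fun p => p.2) (fun i j _ => ⟨1, fun p => norm_G_le _ _⟩)
    (fun j _ a d => by
      obtain ⟨C, hC⟩ := m.exists_norm_le_of_χ (m.coeffIn_lin (k := k) a d) fun s hs => by
        simp only [m.lin_eq_zero a _ hs, MvPolynomial.coeff_zero]
      exact ⟨C, fun p => hC _⟩)
    (fun j _ a d => by
      obtain ⟨C, hC⟩ := m.exists_norm_le_of_χ (m.coeffIn_quad (k := k) a d) fun s hs => by
        simp only [m.quad_eq_zero a _ hs, MvPolynomial.coeff_zero]
      exact ⟨C, fun p => hC _⟩)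
    (fun d => by
      obtain ⟨C, hC⟩ := hP d
      exact ⟨C, fun p => hC _⟩)
  exact ⟨M, fun θ u => hM (θ, u)⟩

/-- The only discontinuities come from the propagators `G (t i) (u j)`, which jump when a vertex
time meets an observation time. -/
theorem continuousAt_kern (w : List Letter) (t : Fin k → ℝ) (P : State k) (u : ℕ → ℝ)
    (hu : ∀ j < w.length, u j ∉ range t) : ContinuousAt (m.kern w t P) u := by
  refine m.kern_mem (contAtAlg u) w (fun _ => t) (fun _ => P) (fun u => u) ?_ ?_ ?_ ?_
  · intro i j hj
    exact tendsto_G tendsto_const_nhds ((continuous_apply j).tendsto u) fun h => hu j hj ⟨i, h⟩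
  · intro j _ a d
    have h : Continuous fun s => (m.lin a s (m.position s : State k)).coeff d := m.coeffIn_lin a d
    exact (h.comp (show Continuous fun v : ℕ → ℝ => v j from continuous_apply j)).continuousAt
  · intro j _ a d
    have h : Continuous fun s => (m.quad a s (m.position s : State k)).coeff d := m.coeffIn_quad a d
    exact (h.comp (show Continuous fun v : ℕ → ℝ => v j from continuous_apply j)).continuousAt
  · exact CoeffIn.const P

theorem measurable_kern_fixed (w : List Letter) (t : Fin k → ℝ) (P : State k) :
    Measurable (m.kern w t P) :=
  (m.measurable_kern w (Θ := Unit) (t := fun _ => t) (P := fun _ => P) measurable_const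
    (CoeffIn.const P)).comp (measurable_const (a := ()).prodMk measurable_id)

theorem exists_norm_kern_fixed_le (w : List Letter) (t : Fin k → ℝ) (P : State k) :
    ∃ M, ∀ u, ‖m.kern w t P u‖ ≤ M := by
  obtain ⟨M, hM⟩ := m.exists_norm_kern_le w (Θ := Unit) (fun _ => t) (P := fun _ => P)
    (CoeffIn.const P)
  exact ⟨M, hM ()⟩

theorem integrable_vertexOp {ξ : ℝ → ℂ} (hξ : Integrable ξ (slab m.R)) (hξm : Measurable ξ)
    (t : Fin k → ℝ) (a : Letter) (v : List Letter) (τ : ℝ) (P : State k) :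
    Integrable (fun s => (G τ s : ℂ) * (weight ξ a s *
      nest m.R ξ 0 v 0 s (m.kern v t (m.vertexOp a t s P)))) (slab m.R) := by
  obtain ⟨M, hM⟩ := m.exists_norm_kern_fixed_le (a :: v) t P
  have := integrable_weight_mul_nest hξ (integrable_zero _ _ _) hξm measurable_zero
    (integrable_weight hξ a) v 0 τ (m.measurable_kern_fixed (a :: v) t P) hM
  simpa only [kern_cons_cons] using this

theorem integral_wordSum {ξ : ℝ → ℂ} (hξ : Integrable ξ (slab m.R)) (hξm : Measurable ξ)
    (t : Fin k → ℝ) (a : Letter) (τ : ℝ) (P : State k) (l : List (List Letter)) :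
    Integrable (fun s => (G τ s : ℂ) * (weight ξ a s * wordSum (fun v =>
      nest m.R ξ 0 v 0 s (m.kern v t (m.vertexOp a t s P))) l)) (slab m.R) ∧
    ∫ s, (G τ s : ℂ) * (weight ξ a s * wordSum (fun v =>
      nest m.R ξ 0 v 0 s (m.kern v t (m.vertexOp a t s P))) l) ∂slab m.R =
    wordSum (fun v => ∫ s, (G τ s : ℂ) * (weight ξ a s *
      nest m.R ξ 0 v 0 s (m.kern v t (m.vertexOp a t s P))) ∂slab m.R) l := by
  induction l with
  | nil => simp
  | cons v l ihl =>
    have hi := m.integrable_vertexOp hξ hξm t a v τ P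
    simp only [wordSum_cons, mul_add]
    exact ⟨hi.add ihl.1, by rw [integral_add hi ihl.1, ihl.2]⟩

/-- The point `s₀` at which the noise is varied becomes the time of the new letter `pair`.
Contractions in the tail follow from the induction hypothesis after exchanging integrals. At the
head, two `noise` operators at equal times give twice the `pair` operator. -/
theorem integral_nestLimit {ξ : ℝ → ℂ} (hξ : Integrable ξ (slab m.R)) (hξm : Measurable ξ)
    (t : Fin k → ℝ) (w : List Letter) : ∀ (τ : ℝ) (P : State k),
    ∫ s₀, nestLimit m.R ξ w τ s₀ (m.kern w t P) ∂slab m.R =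
      wordSum (fun v => nest m.R ξ 0 v 0 τ (m.kern v t P)) (contractions w) := by
  induction w with
  | nil => intro τ P; simp [nestLimit, contractions]
  | cons a w ih =>
    intro τ P
    obtain ⟨M, hM⟩ := m.exists_norm_kern_fixed_le (a :: w) t P
    have hkm := m.measurable_kern_fixed (a :: w) t P
    obtain ⟨C, hC0, hC⟩ := exists_norm_nestLimit_le hξ w (M := M)
    have hmeas := measurable_nestLimit (R := m.R) hξm w (fun (s : ℝ) u =>
      m.kern (a :: w) t P (cons s u)) (hkm.comp measurable_cons)
    have hmeas2 : Measurable fun p : ℝ × ℝ =>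
        nestLimit m.R ξ w p.2 p.1 fun u => m.kern (a :: w) t P (cons p.2 u) :=
      hmeas.comp ((measurable_snd.prodMk measurable_fst).prodMk measurable_snd)
    have hb : ∀ s s₀, ‖nestLimit m.R ξ w s s₀ fun u => m.kern (a :: w) t P (cons s u)‖ ≤ C :=
      fun s s₀ => hC s s₀ _ fun u => hM _
    have hpair : Integrable (fun p : ℝ × ℝ => (G τ p.2 : ℂ) * (weight ξ a p.2 *
        nestLimit m.R ξ w p.2 p.1 fun u => m.kern (a :: w) t P (cons p.2 u)))
        ((slab m.R).prod (slab m.R)) := by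
      have h1 : Integrable (fun p : ℝ × ℝ => weight ξ a p.2) ((slab m.R).prod (slab m.R)) :=
        (integrable_weight hξ a).comp_snd _
      have h2 := h1.bdd_mul (c := C) hmeas2.aestronglyMeasurable
        (Eventually.of_forall fun p => hb p.2 p.1)
      have h3 := h2.bdd_mul (c := 1) (measurable_ofReal_G (measurable_const (a := τ))
        measurable_snd).aestronglyMeasurable (Eventually.of_forall fun p => norm_G_le _ _)
      refine h3.congr (Eventually.of_forall fun p => ?_)
      simp only [mul_comm (weight ξ a p.2)]
    have hfirst : Integrable (fun s₀ => ∫ s, (G τ s : ℂ) * (weight ξ a s *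
        nestLimit m.R ξ w s s₀ fun u => m.kern (a :: w) t P (cons s u)) ∂slab m.R) (slab m.R) :=
      hpair.integral_prod_left
    have hlim : Integrable (fun s₀ => nestLimit m.R ξ (a :: w) τ s₀ (m.kern (a :: w) t P))
        (slab m.R) := by
      obtain ⟨C', hC'0, hC'⟩ := exists_norm_nestLimit_le hξ (a :: w) (M := M)
      refine Integrable.of_bound (C := C') ?_ (Eventually.of_forall fun s₀ => hC' _ _ _ hM)
      exact ((measurable_nestLimit hξm (a :: w) (fun (_ : Unit) => m.kern (a :: w) t P)
        (hkm.comp measurable_snd)).comp ((measurable_const.prodMk measurable_id).prodMk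
          (measurable_const (a := ())))).aestronglyMeasurable
    have hhead : Integrable (fun s₀ => headLimit m.R ξ τ s₀ (m.kern (a :: w) t P) (a :: w))
        (slab m.R) := by
      refine (hlim.sub hfirst).congr (Eventually.of_forall fun s₀ => ?_)
      simp [nestLimit]
    simp only [nestLimit]
    rw [integral_add hfirst hhead, wordSum_contractions_cons]
    congr 1
    · rw [integral_integral_swap (f := fun s₀ s => (G τ s : ℂ) * (weight ξ a s *
        nestLimit m.R ξ w s s₀ fun u => m.kern (a :: w) t P (cons s u))) hpair]
      simp only [integral_const_mul, kern_cons_cons]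
      have e : ∀ s, ∫ s₀, nestLimit m.R ξ w s s₀
          (fun u => m.kern w t (m.vertexOp a t s P) u) ∂slab m.R =
          wordSum (fun v => nest m.R ξ 0 v 0 s (m.kern v t (m.vertexOp a t s P)))
            (contractions w) := fun s => ih s _
      simp only [e, nest, kern_cons_cons]
      exact (m.integral_wordSum hξ hξm t a τ P _).2
    · cases a with
      | drift => simp [headLimit, headContraction]
      | pair => simp [headLimit, headContraction]
      | noise =>
        cases w with
        | nil => simp [headLimit, headContraction]
        | cons b w =>
          cases b with
          | drift => simp [headLimit, headContraction]
          | pair => simp [headLimit, headContraction]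
          | noise =>
            -- The factor `½` of `headLimit` cancels the `2` from `vertexOp_noise_noise`.
            simp only [headLimit, headContraction, wordSum_cons, wordSum_nil, add_zero, nest,
              kern_cons_cons, vertexOp_noise_noise, kern_smul, weight, Pi.one_apply, one_mul]
            congr 1
            ext s
            rw [nest_const_mul]
            ring

end Model
end MSR
end
noncomputable section
namespace MSR

open MeasureTheory Filter Topology Set Letter

/-! ### The second functional derivative of polynomial functionals of the noise -/

/-- `Φ` is polynomial along lines, and `Φ'` is half of the integral of the diagonal of its second
functional derivative. -/
def HasUpsilon (Φ Φ' : Config → ℂ) : Prop :=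
  ∃ (d : Config → ℝ → ℂ) (p : Config → Config → Polynomial ℂ),
    (∀ ξ η (z : ℝ), Φ (ξ + z • η) = (p ξ η).eval (z : ℂ)) ∧
    (∀ ξ, ∀ᵐ s, Tendsto (fun n => (p ξ (approxDelta s n)).coeff 2) atTop (𝓝 (d ξ s))) ∧
    (∀ ξ, Integrable (d ξ)) ∧ ∀ ξ, Φ' ξ = ∫ s, d ξ s

/-- When both increments go in the same direction, `Φ` depends only on `a + b`, through a
polynomial. The second derivative at zero is twice its quadratic coefficient, and this `2` cancels
the `½` in `Υ_{δ/2}`. -/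
theorem HasUpsilon.upsilonDelta_eq {Φ Φ' : Config → ℂ} (h : HasUpsilon Φ Φ') :
    upsilonDelta Φ = Φ' := by
  obtain ⟨d, p, hp, hlim, hint, hΦ'⟩ := h
  funext ξ
  have hder : ∀ (q : Polynomial ℂ) (a : ℝ),
      HasDerivAt (fun b : ℝ => q.eval ((a : ℂ) + b)) (q.derivative.eval (a : ℂ)) 0 := by
    intro q a
    have h1 : HasDerivAt (fun z : ℂ => q.eval z) (q.derivative.eval ((a + 0 : ℝ) : ℂ))
        ((a + 0 : ℝ) : ℂ) := q.hasDerivAt _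
    have h2 := (h1.comp_ofReal).comp_const_add a 0
    simpa using h2
  have key : ∀ s (n : ℕ), deriv (fun a : ℝ => deriv (fun b : ℝ =>
      Φ (ξ + a • approxDelta s n + b • approxDelta s n)) 0) 0 =
      2 * (p ξ (approxDelta s n)).coeff 2 := by
    intro s n
    set q := p ξ (approxDelta s n)
    have e1 : ∀ a b : ℝ, Φ (ξ + a • approxDelta s n + b • approxDelta s n) =
        q.eval ((a : ℂ) + b) := fun a b => by
      rw [add_assoc, ← add_smul, hp, Complex.ofReal_add]
    simp only [e1, (hder q _).deriv]
    have h2 := hder q.derivative 0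
    simp only [Complex.ofReal_zero, zero_add] at h2
    rw [h2.deriv, ← Polynomial.coeff_zero_eq_eval_zero, Polynomial.coeff_derivative,
      Polynomial.coeff_derivative]
    push_cast
    ring
  have hfd : ∀ᵐ s, funDeriv₂ Φ ξ s s = 2 * d ξ s := by
    filter_upwards [hlim ξ] with s hs
    unfold funDeriv₂
    simp only [key]
    exact (hs.const_mul 2).limUnder_eq
  rw [upsilonDelta, hΦ', integral_congr_ae hfd, integral_const_mul]
  ring

theorem HasUpsilon.zero : HasUpsilon 0 0 :=
  ⟨0, 0, by simp, by simp, fun _ => integrable_zero _ _ _, by simp⟩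

theorem HasUpsilon.add {Φ Φ' Ψ Ψ' : Config → ℂ} (h : HasUpsilon Φ Φ') (h' : HasUpsilon Ψ Ψ') :
    HasUpsilon (Φ + Ψ) (Φ' + Ψ') := by
  obtain ⟨d, p, h1, h2, h3, h4⟩ := h
  obtain ⟨d', p', h1', h2', h3', h4'⟩ := h'
  refine ⟨fun ξ s => d ξ s + d' ξ s, fun ξ η => p ξ η + p' ξ η, fun ξ η z => by
    simp [h1, h1'], fun ξ => ?_, fun ξ => (h3 ξ).add (h3' ξ), fun ξ => ?_⟩
  · filter_upwards [h2 ξ, h2' ξ] with s hs hs'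
    simpa using hs.add hs'
  · rw [integral_add (h3 ξ) (h3' ξ), Pi.add_apply, h4, h4']

theorem HasUpsilon.smul {Φ Φ' : Config → ℂ} (h : HasUpsilon Φ Φ') (a : ℂ) :
    HasUpsilon (a • Φ) (a • Φ') := by
  obtain ⟨d, p, h1, h2, h3, h4⟩ := h
  refine ⟨fun ξ s => a * d ξ s, fun ξ η => a • p ξ η, fun ξ η z => by
    simp [h1], fun ξ => ?_, fun ξ => (h3 ξ).const_mul a, fun ξ => ?_⟩
  · filter_upwards [h2 ξ] with s hs
    simpa using hs.const_mul a
  · rw [integral_const_mul, Pi.smul_apply, h4, smul_eq_mul]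

theorem HasUpsilon.wordSum {Φ Φ' : List Letter → Config → ℂ} (l : List (List Letter))
    (h : ∀ w ∈ l, HasUpsilon (Φ w) (Φ' w)) : HasUpsilon (wordSum Φ l) (wordSum Φ' l) := by
  induction l with
  | nil => exact HasUpsilon.zero
  | cons w l ih =>
    rw [wordSum_cons, wordSum_cons]
    exact (h w (by simp)).add (ih fun v hv => h v (by simp [hv]))

/-- A configuration as a complex function. -/
def toC (ξ : Config) : ℝ → ℂ := fun s => ((ξ : ℝ → ℝ) s : ℂ)

theorem continuous_config (ξ : Config) : Continuous (ξ : ℝ → ℝ) :=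
  (show ContDiff ℝ ∞ (ξ : ℝ → ℝ) from ξ.2).continuous

theorem continuous_toC (ξ : Config) : Continuous (toC ξ) :=
  Complex.continuous_ofReal.comp (continuous_config ξ)

theorem measurable_toC (ξ : Config) : Measurable (toC ξ) := (continuous_toC ξ).measurable

theorem integrable_toC (ξ : Config) (R : ℝ) : Integrable (toC ξ) (slab R) :=
  (continuous_toC ξ).continuousOn.integrableOn_compact isCompact_Icc

theorem toC_add_smul (ξ η : Config) (z : ℝ) : toC (ξ + z • η) = toC ξ + (z : ℂ) • toC η := by
  funext s
  simp [toC]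

theorem nest_eq_zero_of_noise_mem {R : ℝ} {η : ℝ → ℂ} (w : List Letter) (hw : noise ∈ w) :
    ∀ (τ : ℝ) (c : (ℕ → ℝ) → ℂ), nest R 0 η w 0 τ c = 0 := by
  induction w with
  | nil => simp at hw
  | cons a w ih =>
    intro τ c
    rcases List.mem_cons.1 hw with rfl | h
    · simp [nest, weight]
    · simp [nest, ih h]

namespace Model

variable (m : Model) {k : ℕ} (ρ : Measure (Fin k → ℝ)) (P : (Fin k → ℝ) → State k)

/-- The coefficient of `z ^ j` in the functional of a word, evaluated at `ξ + z η`. -/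
def wordCoeff (w : List Letter) (j : ℕ) (ξ η : ℝ → ℂ) : ℂ :=
  ∫ t, nest m.R ξ η w j m.R (m.kern w t (P t)) ∂ρ

/-- The functional of the noise given by a word. -/
def wordFn (w : List Letter) (ξ : Config) : ℂ := m.wordCoeff ρ P w 0 (toC ξ) 0

theorem wordFn_zero_of_noise_mem (w : List Letter) (hw : noise ∈ w) : m.wordFn ρ P w 0 = 0 := by
  have : toC 0 = 0 := by funext s; simp [toC]
  simp [wordFn, wordCoeff, this, nest_eq_zero_of_noise_mem w hw]

variable [IsFiniteMeasure ρ] {P}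

theorem integrable_nest_kern (hPm : CoeffIn (measAlg _) P) (hPb : CoeffIn (bddAlg _) P)
    {ξ η : ℝ → ℂ} (hξm : Measurable ξ) (hξ : Integrable ξ (slab m.R)) (hηm : Measurable η)
    (hη : Integrable η (slab m.R)) (w : List Letter) (j : ℕ) (τ : ℝ) :
    Integrable (fun t => nest m.R ξ η w j τ (m.kern w t (P t))) ρ := by
  obtain ⟨M, hM⟩ := m.exists_norm_kern_le w (fun t : Fin k → ℝ => t) hPb
  obtain ⟨C, hC⟩ := exists_norm_nest_le hξ hη w (M := M)
  refine Integrable.of_bound (C := C) ?_ (Eventually.of_forall fun t => hC _ _ _ (hM t))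
  exact ((measurable_nest hξm hηm w j
    (fun t : Fin k → ℝ => m.kern w t (P t)) (m.measurable_kern w measurable_id hPm)).comp
    (measurable_const.prodMk measurable_id)).aestronglyMeasurable

theorem wordFn_add_smul (hPm : CoeffIn (measAlg _) P) (hPb : CoeffIn (bddAlg _) P)
    (w : List Letter) (ξ η : Config) (z : ℝ) : m.wordFn ρ P w (ξ + z • η) =
      ∑ j ∈ Finset.range (w.length + 1), (z : ℂ) ^ j * m.wordCoeff ρ P w j (toC ξ) (toC η) := by
  obtain ⟨M, hM⟩ := m.exists_norm_kern_le w (fun t : Fin k → ℝ => t) hPb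
  simp only [wordCoeff, wordFn, toC_add_smul, ← integral_const_mul]
  rw [← integral_finsetSum _ fun j _ => (m.integrable_nest_kern ρ hPm hPb (measurable_toC ξ)
    (integrable_toC ξ _) (measurable_toC η) (integrable_toC η _) w j m.R).const_mul _]
  congr 1
  ext t
  exact nest_zero_add_smul (integrable_toC ξ _) (integrable_toC η _) (measurable_toC ξ)
    (measurable_toC η) z w m.R _ (m.measurable_kern_fixed w t (P t)) (hM t)

/-- `Υ_{δ/2}` contracts adjacent letters `noise`. The pointwise limit of the second variation passes
through the integral over the observation times by dominated convergence, and integrating it over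
`s` in the slab yields the contracted words by `integral_nestLimit`. -/
theorem hasUpsilon_wordFn (hρ : ρ ≪ volume) (hPm : CoeffIn (measAlg _) P)
    (hPb : CoeffIn (bddAlg _) P) (w : List Letter) :
    HasUpsilon (m.wordFn ρ P w) (wordSum (m.wordFn ρ P) (contractions w)) := by
  obtain ⟨M, hM⟩ := m.exists_norm_kern_le w (fun t : Fin k → ℝ => t) hPb
  have hM0 : 0 ≤ M := (norm_nonneg _).trans (hM 0 0)
  have hkm := m.measurable_kern w (Θ := Fin k → ℝ) measurable_id hPm
  refine ⟨fun ξ => (Ioo (-m.R) m.R).indicator fun s =>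
      ∫ t, nestLimit m.R (toC ξ) w m.R s (m.kern w t (P t)) ∂ρ,
    fun ξ η => ∑ j ∈ Finset.range (w.length + 1),
      Polynomial.C (m.wordCoeff ρ P w j (toC ξ) (toC η)) * Polynomial.X ^ j, ?_, ?_, ?_, ?_⟩
  · intro ξ η z
    rw [m.wordFn_add_smul ρ hPm hPb, Polynomial.eval_finsetSum]
    refine Finset.sum_congr rfl fun j _ => ?_
    rw [Polynomial.eval_mul, Polynomial.eval_C, Polynomial.eval_pow, Polynomial.eval_X, mul_comm]
  · intro ξ
    have hcoeff : ∀ η, (∑ j ∈ Finset.range (w.length + 1),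
        Polynomial.C (m.wordCoeff ρ P w j (toC ξ) (toC η)) * Polynomial.X ^ j).coeff 2 =
        m.wordCoeff ρ P w 2 (toC ξ) (toC η) := by
      intro η
      simp only [Polynomial.finsetSum_coeff, Polynomial.coeff_C_mul_X_pow]
      rw [Finset.sum_ite_eq]
      split_ifs with h
      · rfl
      · rw [Finset.mem_range, not_lt] at h
        simp only [wordCoeff, nest_eq_zero_of_length_lt w 2 _ _ h, integral_zero]
    simp only [hcoeff]
    -- Inside the open slab the mollifiers are eventually supported there, and outside the closed
    -- slab they eventually miss it. The endpoints, where half of the mass could be lost, form a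
    -- null set.
    filter_upwards [measure_eq_zero_iff_ae_notMem.1
      (((countable_singleton m.R).insert (-m.R)).measure_zero volume)] with s hs
    simp only [mem_insert_iff, mem_singleton_iff, not_or] at hs
    have hδ := isMollifier_approxDelta s
    by_cases hmem : s ∈ Ioo (-m.R) m.R
    · rw [indicator_of_mem hmem]
      obtain ⟨C, hC0, hC⟩ := hδ.exists_norm_nest_le (integrable_toC ξ m.R) w hM0
      refine tendsto_integral_filter_of_dominated_convergence (fun _ => C)
        (Eventually.of_forall fun n => (m.integrable_nest_kern ρ hPm hPb (measurable_toC ξ)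
          (integrable_toC ξ _) (measurable_toC _) (integrable_toC _ _) w 2
          m.R).aestronglyMeasurable)
        (Eventually.of_forall fun n => Eventually.of_forall fun t => hC _ _ _ _ (hM t))
        (integrable_const C) ?_
      -- For fixed `s`, absolute continuity of `ρ` makes a coincidence with an observation time a
      -- null event; otherwise the kernel could be discontinuous at `s`.
      have hae : ∀ᵐ t ∂ρ, ∀ i, t i ≠ s := by
        rw [eventually_countable_forall]
        exact fun i => hρ.ae_le (Measure.ae_eval_ne (fun _ => (volume : Measure ℝ)) i s)
      filter_upwards [hae] with t ht
      exact hδ.tendsto_nest_two hmem (integrable_toC ξ _) (measurable_toC ξ)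
        (countable_range t) (by rintro ⟨i, hi⟩; exact ht i hi) w (ne_of_gt hmem.2)
        (m.measurable_kern_fixed w t (P t)) (hM t) fun u hu => m.continuousAt_kern w t (P t) u hu
    · rw [indicator_of_notMem hmem]
      have hR : m.R < |s| := by
        rw [lt_abs]
        by_contra! hcon
        exact hmem ⟨lt_of_le_of_ne (by linarith [hcon.2]) (Ne.symm hs.1),
          lt_of_le_of_ne hcon.1 hs.2⟩
      apply tendsto_const_nhds.congr'
      filter_upwards [hδ.eventually_nest_two_eq_zero (ξ := toC ξ) hR w] with n hn
      have : ∀ t, nest m.R (toC ξ) (toC (approxDelta s n)) w 2 m.R (m.kern w t (P t)) = 0 :=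
        fun t => hn 1 _ _
      simp [wordCoeff, this]
  · intro ξ
    rw [integrable_indicator_iff measurableSet_Ioo]
    obtain ⟨C, hC0, hC⟩ := exists_norm_nestLimit_le (integrable_toC ξ m.R) w (M := M)
    have hmeas : Measurable fun s => ∫ t, nestLimit m.R (toC ξ) w m.R s (m.kern w t (P t)) ∂ρ := by
      have : Measurable fun p : ℝ × (Fin k → ℝ) =>
          nestLimit m.R (toC ξ) w m.R p.1 (m.kern w p.2 (P p.2)) :=
        ((measurable_nestLimit (R := m.R) (measurable_toC ξ) w
          (fun t : Fin k → ℝ => m.kern w t (P t)) hkm).comp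
        ((measurable_const.prodMk measurable_fst).prodMk measurable_snd :
          Measurable fun p : ℝ × (Fin k → ℝ) => ((m.R, p.1), p.2)))
      exact this.stronglyMeasurable.integral_prod_right (ν := ρ) |>.measurable
    refine Measure.integrableOn_of_bounded (M := C * ρ.real univ) (by simp)
      hmeas.aestronglyMeasurable (Eventually.of_forall fun s => ?_)
    exact norm_integral_le_of_norm_le_const (Eventually.of_forall fun t => hC _ _ _ (hM t))
  · intro ξ
    rw [integral_indicator measurableSet_Ioo, setIntegral_congr_set Ioo_ae_eq_Icc]
    change _ = ∫ s, _ ∂slab m.R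
    obtain ⟨C, hC0, hC⟩ := exists_norm_nestLimit_le (integrable_toC ξ m.R) w (M := M)
    rw [integral_integral_swap]
    · simp only [m.integral_nestLimit (integrable_toC ξ _) (measurable_toC ξ), wordSum_apply]
      have : ∀ l : List (List Letter), Integrable (fun t => MSR.wordSum (fun v =>
          nest m.R (toC ξ) 0 v 0 m.R (m.kern v t (P t))) l) ρ ∧
          ∫ t, MSR.wordSum (fun v => nest m.R (toC ξ) 0 v 0 m.R (m.kern v t (P t))) l ∂ρ =
          MSR.wordSum (fun v => m.wordFn ρ P v ξ) l := by
        intro l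
        induction l with
        | nil => simp
        | cons v l ih =>
          have hi := m.integrable_nest_kern ρ hPm hPb (measurable_toC ξ) (integrable_toC ξ _)
            measurable_zero (integrable_zero _ _ _) v 0 m.R
          simp only [wordSum_cons]
          exact ⟨hi.add ih.1, by rw [integral_add hi ih.1, ih.2]; rfl⟩
      exact (this _).2.symm
    · refine Integrable.of_bound (C := C) ?_ (Eventually.of_forall fun p => hC _ _ _ (hM _))
      exact ((measurable_nestLimit (R := m.R) (measurable_toC ξ) w
          (fun t : Fin k → ℝ => m.kern w t (P t)) hkm).comp
        ((measurable_const.prodMk measurable_fst).prodMk measurable_snd :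
          Measurable fun p : ℝ × (Fin k → ℝ) => ((m.R, p.1), p.2))).aestronglyMeasurable

theorem iterate_upsilonDelta (hρ : ρ ≪ volume) (hPm : CoeffIn (measAlg _) P)
    (hPb : CoeffIn (bddAlg _) P) (N n : ℕ) :
    upsilonDelta^[n] (wordSum (m.wordFn ρ P) (pairWords N 0)) =
      (n.factorial : ℂ) • wordSum (m.wordFn ρ P) (pairWords N n) := by
  induction n with
  | zero => simp
  | succ n ih =>
    rw [Function.iterate_succ_apply', ih]
    have h := (HasUpsilon.wordSum (Φ := m.wordFn ρ P)
      (Φ' := fun w => wordSum (m.wordFn ρ P) (contractions w)) (pairWords N n)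
      fun w _ => m.hasUpsilon_wordFn ρ hρ hPm hPb w).smul (n.factorial : ℂ)
    rw [h.upsilonDelta_eq, wordSum_contractions, ← Nat.cast_smul_eq_nsmul ℂ, smul_smul,
      Nat.factorial_succ]
    congr 1
    push_cast
    ring

/-- The term of order `n` of the exponential contains each word with `n` pairs exactly once. It is
zero for `n > N`, so the series is a finite sum, and at zero noise only words without `noise`
remain. -/
theorem gammaDelta_wordSum (hρ : ρ ≪ volume) (hPm : CoeffIn (measAlg _) P)
    (hPb : CoeffIn (bddAlg _) P) (N : ℕ) :
    gammaDelta (wordSum (m.wordFn ρ P) (pairWords N 0)) 0 =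
      wordSum (fun w => m.wordFn ρ P w 0) (freeWords N) := by
  have h : ∀ n, ((n.factorial : ℂ))⁻¹ *
      (upsilonDelta^[n] (wordSum (m.wordFn ρ P) (pairWords N 0))) 0 =
      wordSum (fun w => m.wordFn ρ P w 0) (pairWords N n) := fun n => by
    have : (n.factorial : ℂ) ≠ 0 := by exact_mod_cast n.factorial_ne_zero
    rw [m.iterate_upsilonDelta ρ hρ hPm hPb, Pi.smul_apply, smul_eq_mul, ← mul_assoc,
      inv_mul_cancel₀ this, one_mul, wordSum_apply]
  rw [gammaDelta]
  simp only [h]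
  rw [tsum_eq_sum (s := Finset.range (N + 1)) fun n hn => by
    rw [pairWords_eq_nil N n (by have := Finset.mem_range.not.1 hn; omega), wordSum_nil]]
  exact sum_wordSum_pairWords N (N + 1) _ (Nat.lt_succ_self N) fun w hw =>
    m.wordFn_zero_of_noise_mem ρ P w hw

end Model
end MSR
end
noncomputable section
namespace MSR

open MeasureTheory Filter Topology Set Letter

/-! ### The expansion of the perturbative solution -/

theorem integral_slab_G {R τ : ℝ} (hτ : τ ∈ Icc (-R) R) (g : ℝ → ℂ) :
    ∫ s, (G τ s : ℂ) * g s ∂slab R = ∫ s in (-R)..τ, g s := by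
  have e : (fun s => (G τ s : ℂ) * g s) = (Iio τ).indicator g := by
    funext s
    by_cases h : s < τ
    · rw [indicator_of_mem (show s ∈ Iio τ from h), G_of_lt h, Complex.ofReal_one, one_mul]
    · rw [indicator_of_notMem (show s ∉ Iio τ from h), G_of_le (not_lt.1 h), Complex.ofReal_zero,
        zero_mul]
  rw [e, integral_indicator measurableSet_Iio, slab, Measure.restrict_restrict measurableSet_Iio,
    intervalIntegral.integral_of_le hτ.1]
  have : Iio τ ∩ Icc (-R) R = Ico (-R) τ := by
    ext s
    simp only [mem_inter_iff, mem_Iio, mem_Icc, mem_Ico]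
    exact ⟨fun h => ⟨h.2.1, h.1⟩, fun h => ⟨h.2, h.1, h.2.le.trans hτ.2⟩⟩
  rw [this, setIntegral_congr_set Ico_ae_eq_Ioc]

theorem integral_G_mul {R : ℝ} {h : ℝ → ℂ} (hc : Continuous h) (h0 : ∀ s, R ≤ |s| → h s = 0)
    (τ : ℝ) : ∫ s, (G τ s : ℂ) * h s = ∫ s in (-R)..τ, h s := by
  have e : (fun s => (G τ s : ℂ) * h s) = (Iio τ).indicator h := by
    funext s
    by_cases hs : s < τ
    · rw [indicator_of_mem (show s ∈ Iio τ from hs), G_of_lt hs, Complex.ofReal_one, one_mul]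
    · rw [indicator_of_notMem (show s ∉ Iio τ from hs), G_of_le (not_lt.1 hs), Complex.ofReal_zero,
        zero_mul]
  have hcs : HasCompactSupport h := HasCompactSupport.intro (isCompact_Icc (a := -R) (b := R))
    fun s hs => h0 s (by
      by_contra! hlt
      exact hs (abs_le.1 hlt.le))
  have hi := hc.integrable_of_hasCompactSupport (μ := volume) hcs
  have hz : ∫ s in Iic (-R), h s = 0 := by
    rw [setIntegral_eq_zero_of_forall_eq_zero]
    intro s hs
    refine h0 s ?_
    have h1 : s ≤ -R := hs
    have := neg_le_abs s
    linarith
  rw [e, integral_indicator measurableSet_Iio, setIntegral_congr_set Iio_ae_eq_Iic,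
    ← intervalIntegral.integral_Iic_sub_Iic hi.integrableOn hi.integrableOn, hz, sub_zero]

theorem hasDerivAt_integral_G {R : ℝ} {h : ℝ → ℂ} (hc : Continuous h)
    (h0 : ∀ s, R ≤ |s| → h s = 0) (τ : ℝ) :
    HasDerivAt (fun τ => ∫ s, (G τ s : ℂ) * h s) (h τ) τ := by
  simp only [integral_G_mul hc h0]
  exact (hc.integral_hasStrictDerivAt _ _).hasDerivAt

/-- The coefficients of order at most `n` depend continuously on the parameter. -/
def ContUpTo (n : ℕ) (Z : ℝ → PowerSeries ℂ) : Prop :=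
  ∀ j ≤ n, Continuous fun t => PowerSeries.coeff j (Z t)

namespace ContUpTo

variable {n : ℕ} {Y Z : ℝ → PowerSeries ℂ}

theorem const (z : PowerSeries ℂ) : ContUpTo n fun _ => z := fun _ _ => continuous_const

theorem add (hY : ContUpTo n Y) (hZ : ContUpTo n Z) : ContUpTo n fun t => Y t + Z t :=
  fun j hj => by
    simp only [map_add]
    exact (hY j hj).add (hZ j hj)

theorem mul (hY : ContUpTo n Y) (hZ : ContUpTo n Z) : ContUpTo n fun t => Y t * Z t :=
  fun j hj => by
    simp only [PowerSeries.coeff_mul]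
    refine continuous_finsetSum _ fun x hx => ?_
    have := Finset.HasAntidiagonal.mem_antidiagonal.1 hx
    exact (hY _ (by omega)).mul (hZ _ (by omega))

theorem pow (hZ : ContUpTo n Z) (j : ℕ) : ContUpTo n fun t => Z t ^ j := by
  induction j with
  | zero => simpa using const 1
  | succ j ih => simpa only [pow_succ] using ih.mul hZ

theorem C {h : ℝ → ℂ} (hh : Continuous h) : ContUpTo n fun t => PowerSeries.C (h t) :=
  fun j _ => by
    simp only [PowerSeries.coeff_C]
    by_cases hj : j = 0
    · simpa [hj] using hh
    · simpa [hj] using continuous_const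

theorem smul {h : ℝ → ℂ} (hh : Continuous h) (hZ : ContUpTo n Z) :
    ContUpTo n fun t => h t • Z t := by
  simp only [PowerSeries.smul_eq_C_mul]
  exact (C hh).mul hZ

theorem polyIn (hZ : ContUpTo n Z) (γ : Polynomial Config) :
    ContUpTo n fun t => polyIn γ t (Z t) := by
  induction γ using Polynomial.induction_on' with
  | add p q hp hq =>
    have : ∀ t, MSR.polyIn (p + q) t (Z t) = MSR.polyIn p t (Z t) + MSR.polyIn q t (Z t) :=
      fun t => by simp [MSR.polyIn, Polynomial.map_add]
    simp only [this]
    exact hp.add hq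
  | monomial j x =>
    have : ∀ t, MSR.polyIn (Polynomial.monomial j x) t (Z t) = PowerSeries.C (toC x t) * Z t ^ j :=
      fun t => by
        simp only [MSR.polyIn, Polynomial.map_monomial, Polynomial.aeval_monomial]
        rfl
    simp only [this]
    exact (C (continuous_toC x)).mul (hZ.pow j)

end ContUpTo

theorem map_polyEvalSeries (γ : Polynomial Config) (y : PowerSeries ℝ) (t : ℝ) :
    (polyEvalSeries γ y t).map Complex.ofRealHom = polyIn γ t (y.map Complex.ofRealHom) := by
  rw [polyEvalSeries, polyIn, Polynomial.hom_eval₂, Polynomial.aeval_def, Polynomial.eval₂_map]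
  congr 1
  refine RingHom.ext fun x => ?_
  simp only [RingHom.comp_apply, PowerSeries.map_C]
  rfl

namespace Model

variable (m : Model) {k : ℕ}

/-- The right-hand side of the differential equation, as a formal power series. -/
def velocity (ξ : Config) (Z : ℝ → PowerSeries ℂ) (s : ℝ) : PowerSeries ℂ :=
  m.lin drift s (Z s) + toC ξ s • m.lin noise s (Z s)

variable {m} {sol : Config → ℝ → PowerSeries ℝ}

theorem solution_eq (hsol : IsPerturbativeSolution m.χ m.σ m.α m.β m.x₀ sol) (ξ : Config) (t : ℝ) :
    (sol ξ t).map Complex.ofRealHom = PowerSeries.C (toC m.x₀ t) + PowerSeries.X *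
      PowerSeries.mk fun n => ∫ s, (G t s : ℂ) * PowerSeries.coeff n
        (m.velocity ξ (fun s => (sol ξ s).map Complex.ofRealHom) s) := by
  conv_lhs => rw [hsol ξ t]
  rw [map_add, map_mul, PowerSeries.map_X, PowerSeries.map_C]
  congr 2
  ext n
  rw [PowerSeries.coeff_map, PowerSeries.coeff_mk, PowerSeries.coeff_mk, Complex.ofRealHom_eq_coe,
    ← integral_complex_ofReal]
  congr 1
  ext s
  rw [Complex.ofReal_mul, Complex.ofReal_mul]
  congr 1
  have : ((PowerSeries.coeff n (polyEvalSeries m.α (sol ξ s) s + PowerSeries.C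
      (√m.σ * (ξ : ℝ → ℝ) s) * polyEvalSeries m.β (sol ξ s) s) : ℝ) : ℂ) =
      PowerSeries.coeff n ((polyEvalSeries m.α (sol ξ s) s + PowerSeries.C
      (√m.σ * (ξ : ℝ → ℝ) s) * polyEvalSeries m.β (sol ξ s) s).map Complex.ofRealHom) := by
    rw [PowerSeries.coeff_map]; rfl
  rw [this, map_add, map_mul, map_polyEvalSeries, map_polyEvalSeries, PowerSeries.map_C]
  simp only [velocity, lin, map_add, PowerSeries.coeff_smul, PowerSeries.coeff_C_mul, toC,
    Complex.ofRealHom_eq_coe, Complex.ofReal_mul]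
  ring

theorem velocity_eq_zero (ξ : Config) (Z : ℝ → PowerSeries ℂ) {s : ℝ} (hs : m.R ≤ |s|) :
    m.velocity ξ Z s = 0 := by
  rw [velocity, lin_eq_zero m _ _ (m.χ_eq_zero s hs), lin_eq_zero m _ _ (m.χ_eq_zero s hs),
    smul_zero, add_zero]

theorem contUpTo_velocity (ξ : Config) {Z : ℝ → PowerSeries ℂ} {n : ℕ} (hZ : ContUpTo n Z) :
    ContUpTo n (m.velocity ξ Z) := by
  have hχ : Continuous fun s => (m.χ s : ℂ) := m.contAlg_χ
  refine (ContUpTo.smul hχ (hZ.polyIn _)).add (ContUpTo.smul (continuous_toC ξ)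
    (ContUpTo.smul (continuous_const.mul hχ) (hZ.polyIn _)))

/-- The explicit factor `χ` gives triangularity: the coefficient of order `n + 1` is a primitive of
the coefficient of order `n` of the velocity, which involves the solution up to order `n` only. -/
theorem contUpTo_solution (hsol : IsPerturbativeSolution m.χ m.σ m.α m.β m.x₀ sol) (ξ : Config)
    (n : ℕ) : ContUpTo n fun t => (sol ξ t).map Complex.ofRealHom := by
  induction n with
  | zero =>
    intro j hj
    obtain rfl : j = 0 := by omega
    have e : (fun t => PowerSeries.coeff 0 ((sol ξ t).map Complex.ofRealHom)) = toC m.x₀ := by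
      funext t
      conv_lhs => rw [solution_eq hsol]
      rw [map_add, PowerSeries.coeff_zero_X_mul, add_zero, PowerSeries.coeff_zero_C]
    rw [e]
    exact continuous_toC _
  | succ n ih =>
    intro j hj
    rcases Nat.lt_or_ge j (n + 1) with h | h
    · exact ih j (by omega)
    · obtain rfl : j = n + 1 := by omega
      have hv : Continuous fun s => PowerSeries.coeff n
          (m.velocity ξ (fun s => (sol ξ s).map Complex.ofRealHom) s) :=
        contUpTo_velocity ξ ih n le_rfl
      have h0 : ∀ s, m.R ≤ |s| → PowerSeries.coeff n
          (m.velocity ξ (fun s => (sol ξ s).map Complex.ofRealHom) s) = 0 := fun s hs => by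
        rw [velocity_eq_zero ξ _ hs, map_zero]
      have hd : Continuous fun t => ∫ s, (G t s : ℂ) * PowerSeries.coeff n
          (m.velocity ξ (fun s => (sol ξ s).map Complex.ofRealHom) s) :=
        continuous_iff_continuousAt.2 fun t => (hasDerivAt_integral_G hv h0 t).continuousAt
      have e : (fun t => PowerSeries.coeff (n + 1) ((sol ξ t).map Complex.ofRealHom)) =
          fun t => ∫ s, (G t s : ℂ) * PowerSeries.coeff n
          (m.velocity ξ (fun s => (sol ξ s).map Complex.ofRealHom) s) := by
        funext t
        conv_lhs => rw [solution_eq hsol]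
        rw [map_add, PowerSeries.coeff_succ_X_mul, PowerSeries.coeff_mk, PowerSeries.coeff_C,
          if_neg (by omega), zero_add]
      rw [e]
      exact hd

/-- The increment `x_ξ - x₀`. -/
def increment (m : Model) (sol : Config → ℝ → PowerSeries ℝ) (ξ : Config) (t : ℝ) :
    PowerSeries ℂ :=
  (sol ξ t).map Complex.ofRealHom - PowerSeries.C (toC m.x₀ t)

/-- The velocity of the perturbative solution. -/
def solVelocity (m : Model) (sol : Config → ℝ → PowerSeries ℝ) (ξ : Config) (s : ℝ) :
    PowerSeries ℂ :=
  m.velocity ξ (fun s => (sol ξ s).map Complex.ofRealHom) s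

theorem solVelocity_eq_zero (ξ : Config) {s : ℝ} (hs : m.R ≤ |s|) :
    m.solVelocity sol ξ s = 0 := velocity_eq_zero ξ _ hs

theorem continuous_solVelocity (hsol : IsPerturbativeSolution m.χ m.σ m.α m.β m.x₀ sol)
    (ξ : Config) (n : ℕ) : Continuous fun s => PowerSeries.coeff n (m.solVelocity sol ξ s) :=
  contUpTo_velocity ξ (contUpTo_solution hsol ξ n) n le_rfl

theorem coeff_increment_zero (hsol : IsPerturbativeSolution m.χ m.σ m.α m.β m.x₀ sol)
    (ξ : Config) (t : ℝ) : PowerSeries.coeff 0 (m.increment sol ξ t) = 0 := by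
  rw [increment, solution_eq hsol, add_sub_cancel_left, PowerSeries.coeff_zero_X_mul]

theorem coeff_increment_succ (hsol : IsPerturbativeSolution m.χ m.σ m.α m.β m.x₀ sol)
    (ξ : Config) (t : ℝ) (n : ℕ) : PowerSeries.coeff (n + 1) (m.increment sol ξ t) =
      ∫ s, (G t s : ℂ) * PowerSeries.coeff n (m.solVelocity sol ξ s) := by
  rw [increment, solution_eq hsol, add_sub_cancel_left, PowerSeries.coeff_succ_X_mul,
    PowerSeries.coeff_mk]
  rfl

theorem hasDerivAt_coeff_increment (hsol : IsPerturbativeSolution m.χ m.σ m.α m.β m.x₀ sol)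
    (ξ : Config) (n : ℕ) (τ : ℝ) :
    HasDerivAt (fun τ => PowerSeries.coeff n (m.increment sol ξ τ))
      (PowerSeries.coeff n (PowerSeries.X * m.solVelocity sol ξ τ)) τ := by
  cases n with
  | zero =>
    simp only [coeff_increment_zero hsol, PowerSeries.coeff_zero_X_mul]
    exact hasDerivAt_const _ _
  | succ n =>
    simp only [coeff_increment_succ hsol, PowerSeries.coeff_succ_X_mul]
    exact hasDerivAt_integral_G (continuous_solVelocity hsol ξ n) (fun s hs => by
      rw [solVelocity_eq_zero ξ hs, map_zero]) τ

theorem increment_eq_zero (hsol : IsPerturbativeSolution m.χ m.σ m.α m.β m.x₀ sol)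
    (ξ : Config) {t : ℝ} (ht : t ≤ -m.R) : m.increment sol ξ t = 0 := by
  ext n
  cases n with
  | zero => rw [coeff_increment_zero hsol, map_zero]
  | succ n =>
    rw [coeff_increment_succ hsol, map_zero]
    refine integral_eq_zero_of_ae (Eventually.of_forall fun s => ?_)
    by_cases hs : s < t
    · have : m.R ≤ |s| := by
        have := neg_le_abs s
        linarith
      simp [solVelocity_eq_zero ξ this]
    · simp [G_of_le (not_lt.1 hs)]

/-- The velocity vanishes from `R` on, so stopping at `R` changes nothing and the state stopped at
`R` is the full solution. -/
theorem increment_min_R (hsol : IsPerturbativeSolution m.χ m.σ m.α m.β m.x₀ sol)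
    (ξ : Config) (t : ℝ) : m.increment sol ξ (min t m.R) = m.increment sol ξ t := by
  ext n
  cases n with
  | zero => rw [coeff_increment_zero hsol, coeff_increment_zero hsol]
  | succ n =>
    rw [coeff_increment_succ hsol, coeff_increment_succ hsol]
    congr 1
    ext s
    by_cases hs : m.R ≤ |s|
    · simp [solVelocity_eq_zero ξ hs]
    · have h : s < m.R := (le_abs_self s).trans_lt (not_le.1 hs)
      by_cases ht : s < t
      · rw [G_of_lt ht, G_of_lt (lt_min ht h)]
      · rw [G_of_le (not_lt.1 ht), G_of_le ((min_le_left _ _).trans (not_lt.1 ht))]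

/-- The values of the increment stopped at time `τ`. -/
def stopped (m : Model) (sol : Config → ℝ → PowerSeries ℝ) (ξ : Config) (t : Fin k → ℝ) (τ : ℝ) :
    Option (Fin k) → PowerSeries ℂ
  | none => m.increment sol ξ τ
  | some i => m.increment sol ξ (min (t i) τ)

/-- Evaluation of a state polynomial at the increment stopped at time `τ`. -/
def stoppedEval (m : Model) (sol : Config → ℝ → PowerSeries ℝ) (ξ : Config) (t : Fin k → ℝ)
    (τ : ℝ) : State k →ₐ[ℂ] PowerSeries ℂ :=
  MvPolynomial.aeval (m.stopped sol ξ t τ)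

theorem continuous_coeff_stoppedEval
    (hsol : IsPerturbativeSolution m.χ m.σ m.α m.β m.x₀ sol) (ξ : Config) (t : Fin k → ℝ)
    (n : ℕ) (P : State k) : ContUpTo n fun τ => m.stoppedEval sol ξ t τ P := by
  have hi : ContUpTo n (m.increment sol ξ) := fun j _ =>
    continuous_iff_continuousAt.2 fun τ => (hasDerivAt_coeff_increment hsol ξ j τ).continuousAt
  induction P using MvPolynomial.induction_on with
  | C a => simpa [stoppedEval] using ContUpTo.const _
  | add p q hp hq => simpa only [map_add] using hp.add hq
  | mul_X p o hp =>
    simp only [map_mul]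
    refine hp.mul ?_
    cases o with
    | none => simpa [stoppedEval, stopped] using hi
    | some i =>
      simp only [stoppedEval, stopped, MvPolynomial.aeval_X]
      exact fun j hj => (hi j hj).comp (continuous_const.min continuous_id)

/-- Chain rule. The variables moving at time `τ` are `none` and the `some i` with `τ < t i`; all
have the same velocity, and `shift` is the sum of the corresponding partial derivatives. At `τ = t
i` the stopped value may have a corner, whence the exclusion of `range t`. -/
theorem hasDerivAt_coeff_stoppedEval
    (hsol : IsPerturbativeSolution m.χ m.σ m.α m.β m.x₀ sol) (ξ : Config) (t : Fin k → ℝ)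
    {τ : ℝ} (hτ : τ ∉ range t) (P : State k) : ∀ n : ℕ,
    HasDerivAt (fun τ => PowerSeries.coeff n (m.stoppedEval sol ξ t τ P))
      (PowerSeries.coeff n (PowerSeries.X *
        (m.stoppedEval sol ξ t τ (shift t τ P) * m.solVelocity sol ξ τ))) τ := by
  induction P using MvPolynomial.induction_on with
  | C a =>
    intro n
    simp only [stoppedEval, MvPolynomial.algHom_C, MvPolynomial.derivation_C, map_zero, zero_mul,
      mul_zero]
    exact hasDerivAt_const _ _
  | add p q hp hq =>
    intro n
    simp only [map_add, add_mul, mul_add]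
    exact (hp n).add (hq n)
  | mul_X p o hp =>
    intro n
    have ho : ∀ n, HasDerivAt (fun τ => PowerSeries.coeff n
        (m.stoppedEval sol ξ t τ (MvPolynomial.X o)))
        (PowerSeries.coeff n (PowerSeries.X *
        (m.stoppedEval sol ξ t τ (shift t τ (MvPolynomial.X o)) * m.solVelocity sol ξ τ))) τ := by
      intro n
      have hd := hasDerivAt_coeff_increment hsol ξ n τ
      cases o with
      | none =>
        simp only [stoppedEval, MvPolynomial.aeval_X, shift_none, map_one, one_mul, stopped]
        exact hd
      | some i =>
        simp only [stoppedEval, MvPolynomial.aeval_X, shift_some, MvPolynomial.algHom_C, stopped]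
        -- Before `t i` the stopped value follows the increment, afterwards it is frozen; the two
        -- cases are the two values of the propagator.
        have hne : τ ≠ t i := fun h => hτ ⟨i, h.symm⟩
        rcases lt_or_gt_of_ne hne with h | h
        · rw [G_of_lt h, Complex.ofReal_one, map_one, one_mul]
          refine hd.congr_of_eventuallyEq ?_
          filter_upwards [gt_mem_nhds h] with r hr
          rw [min_eq_right (le_of_lt hr)]
        · rw [G_of_le h.le, Complex.ofReal_zero, map_zero, zero_mul, mul_zero, map_zero]
          refine (hasDerivAt_const τ (PowerSeries.coeff n
            (m.increment sol ξ (t i)))).congr_of_eventuallyEq ?_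
          filter_upwards [lt_mem_nhds h] with r hr
          rw [min_eq_left (le_of_lt hr)]
    simp only [map_mul, Derivation.leibniz, smul_eq_mul, map_add]
    have := HasDerivAt.fun_sum (u := Finset.HasAntidiagonal.antidiagonal n)
      fun x (_ : x ∈ Finset.HasAntidiagonal.antidiagonal n) => (hp x.1).mul (ho x.2)
    simp only [Pi.mul_apply, Finset.sum_add_distrib, ← PowerSeries.coeff_mul] at this
    refine this.congr_deriv ?_
    rw [← map_add]
    congr 1
    ring

theorem stoppedEval_position (ξ : Config) (t : Fin k → ℝ) (s : ℝ) :
    m.stoppedEval sol ξ t s (m.position s) = (sol ξ s).map Complex.ofRealHom := by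
  rw [position, map_add, stoppedEval, MvPolynomial.algHom_C, MvPolynomial.aeval_X, stopped,
    increment]
  change PowerSeries.C (toC m.x₀ s) + _ = _
  ring

theorem stoppedEval_vertexOp (ξ : Config) (t : Fin k → ℝ) (s : ℝ) (P : State k) :
    m.stoppedEval sol ξ t s (m.vertexOp drift t s P) +
      toC ξ s • m.stoppedEval sol ξ t s (m.vertexOp noise t s P) =
    m.stoppedEval sol ξ t s (shift t s P) * m.solVelocity sol ξ s := by
  have hq : ∀ a : Letter, a = drift ∨ a = noise →
      m.stoppedEval sol ξ t s (m.vertexOp a t s P) =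
      m.lin a s ((sol ξ s).map Complex.ofRealHom) * m.stoppedEval sol ξ t s (shift t s P) := by
    intro a ha
    rw [vertexOp_apply, map_add, map_mul, map_lin, stoppedEval_position]
    rcases ha with rfl | rfl <;> simp [quad]
  rw [hq _ (Or.inl rfl), hq _ (Or.inr rfl), solVelocity, velocity, ← smul_mul_assoc]
  ring

theorem coeff_zero_stoppedEval (hsol : IsPerturbativeSolution m.χ m.σ m.α m.β m.x₀ sol)
    (ξ : Config) (t : Fin k → ℝ) (τ : ℝ) (P : State k) :
    PowerSeries.coeff 0 (m.stoppedEval sol ξ t τ P) = P.coeff 0 := by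
  induction P using MvPolynomial.induction_on with
  | C a =>
    rw [stoppedEval, MvPolynomial.algHom_C, MvPolynomial.coeff_zero_C]
    exact PowerSeries.coeff_zero_C a
  | add p q hp hq => rw [map_add, map_add, hp, hq, MvPolynomial.coeff_add]
  | mul_X p o hp =>
    have h1 : PowerSeries.coeff 0 (m.stoppedEval sol ξ t τ (MvPolynomial.X o)) = 0 := by
      rw [stoppedEval, MvPolynomial.aeval_X]
      cases o <;> exact coeff_increment_zero hsol ξ _
    rw [map_mul, PowerSeries.coeff_zero_eq_constantCoeff_apply, map_mul,
      ← PowerSeries.coeff_zero_eq_constantCoeff_apply, ← PowerSeries.coeff_zero_eq_constantCoeff_apply, h1,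
      mul_zero]
    rw [MvPolynomial.coeff_mul_X']
    simp

/-- Integrated form of the chain rule from `-R`, where all increments vanish and the evaluated
polynomial is a constant without higher orders. -/
theorem coeff_succ_stoppedEval (hsol : IsPerturbativeSolution m.χ m.σ m.α m.β m.x₀ sol)
    (ξ : Config) (t : Fin k → ℝ) (n : ℕ) {τ : ℝ} (hτ : τ ∈ Icc (-m.R) m.R) (P : State k) :
    PowerSeries.coeff (n + 1) (m.stoppedEval sol ξ t τ P) =
      ∫ s, (G τ s : ℂ) * PowerSeries.coeff n
        (m.stoppedEval sol ξ t s (shift t s P) * m.solVelocity sol ξ s) ∂slab m.R := by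
  rw [integral_slab_G hτ]
  have h0 : PowerSeries.coeff (n + 1) (m.stoppedEval sol ξ t (-m.R) P) = 0 := by
    have : m.stopped sol ξ t (-m.R) = 0 := by
      funext o
      cases o with
      | none => exact increment_eq_zero hsol ξ le_rfl
      | some i => exact increment_eq_zero hsol ξ (min_le_right _ _)
    rw [stoppedEval, this, MvPolynomial.aeval_zero]
    change PowerSeries.coeff (n + 1) (PowerSeries.C _) = 0
    rw [PowerSeries.coeff_C, if_neg (by omega)]
  have hv : ContUpTo n (m.solVelocity sol ξ) := fun j _ => continuous_solVelocity hsol ξ j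
  have hterm : ∀ Q : State k, Continuous fun s => PowerSeries.coeff n
      (m.stoppedEval sol ξ t s Q * m.solVelocity sol ξ s) := fun Q =>
    ((continuous_coeff_stoppedEval hsol ξ t n Q).mul hv) n le_rfl
  have hint : IntervalIntegrable (fun s => PowerSeries.coeff n
      (m.stoppedEval sol ξ t s (shift t s P) * m.solVelocity sol ξ s)) volume (-m.R) τ := by
    simp only [shift_apply, map_add, map_sum, map_smul, add_mul, Finset.sum_mul, smul_mul_assoc,
      smul_eq_mul]
    refine ((hterm _).intervalIntegrable _ _).add ?_
    have e : (fun s => ∑ i, (G (t i) s : ℂ) * PowerSeries.coeff n (m.stoppedEval sol ξ t s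
        (MvPolynomial.pderiv (some i) P) * m.solVelocity sol ξ s)) = ∑ i, fun s => (G (t i) s : ℂ) *
        PowerSeries.coeff n (m.stoppedEval sol ξ t s
        (MvPolynomial.pderiv (some i) P) * m.solVelocity sol ξ s) := by
      funext s; rw [Finset.sum_apply]
    rw [e]
    refine IntervalIntegrable.sum _ fun i _ => ?_
    rw [intervalIntegrable_iff]
    have := ((hterm (MvPolynomial.pderiv (some i) P)).intervalIntegrable (μ := volume)
      (-m.R) τ).def'
    exact this.bdd_mul (c := 1) (measurable_ofReal_G measurable_const
      measurable_id).aestronglyMeasurable (Eventually.of_forall fun s => norm_G_le _ _)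
  -- This form of the fundamental theorem tolerates the finitely many corners at the observation
  -- times.
  have := integral_eq_of_hasDerivAt_off_countable (a := -m.R) (b := τ)
    (f := fun τ => PowerSeries.coeff (n + 1) (m.stoppedEval sol ξ t τ P))
    (f' := fun s => PowerSeries.coeff n
      (m.stoppedEval sol ξ t s (shift t s P) * m.solVelocity sol ξ s)) (s := range t)
    (countable_range t) (continuous_coeff_stoppedEval hsol ξ t (n + 1) P (n + 1)
      le_rfl).continuousOn (fun s hs => by
        simpa only [PowerSeries.coeff_succ_X_mul] using
          hasDerivAt_coeff_stoppedEval hsol ξ t hs.2 P (n + 1)) hint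
  rw [this, h0, sub_zero]

/-- Dyson expansion. One order in `χ` splits off one vertex, the latest one; what remains is the
same coefficient problem at the earlier time `s` with `P` replaced by the vertex operator applied to
`P`. This is why `P` and `τ` vary in the induction. -/
theorem coeff_stoppedEval (hsol : IsPerturbativeSolution m.χ m.σ m.α m.β m.x₀ sol)
    (ξ : Config) (t : Fin k → ℝ) (n : ℕ) : ∀ {τ : ℝ} (_ : τ ∈ Icc (-m.R) m.R) (P : State k),
    PowerSeries.coeff n (m.stoppedEval sol ξ t τ P) =
      wordSum (fun w => nest m.R (toC ξ) 0 w 0 τ (m.kern w t P)) (pairWords n 0) := by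
  induction n with
  | zero =>
    intro τ hτ P
    rw [coeff_zero_stoppedEval hsol]
    simp [pairWords, nest, kern]
  | succ n ih =>
    intro τ hτ P
    have hi := fun a => m.integral_wordSum (integrable_toC ξ _) (measurable_toC ξ) t a τ P
      (pairWords n 0)
    rw [coeff_succ_stoppedEval hsol ξ t n hτ, pairWords_zero_succ, wordSum_append, wordSum_map,
      wordSum_map]
    have e : ∀ a, wordSum ((fun w => nest m.R (toC ξ) 0 w 0 τ (m.kern w t P)) ∘ (a :: ·))
        (pairWords n 0) = ∫ s, (G τ s : ℂ) * (weight (toC ξ) a s * wordSum (fun v =>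
      nest m.R (toC ξ) 0 v 0 s (m.kern v t (m.vertexOp a t s P))) (pairWords n 0)) ∂slab m.R :=
      fun a => (hi a).2.symm
    rw [e, e, ← integral_add (hi drift).1 (hi noise).1]
    refine integral_congr_ae ?_
    filter_upwards [ae_restrict_mem measurableSet_Icc] with s hs
    rw [← ih hs, ← ih hs, ← stoppedEval_vertexOp, map_add, PowerSeries.coeff_smul]
    simp only [weight, Pi.one_apply]
    ring

end Model

/-- The functional `F` as a polynomial in the increments, at the points `t`. -/
def Multilocal.initState {k : ℕ} (F : Multilocal k) (x₀ : Config) (t : Fin k → ℝ) : State k :=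
  F.eval₂ ((MvPolynomial.C).comp (evalAt t)) fun i =>
    MvPolynomial.C (toC x₀ (t i)) + MvPolynomial.X (some i)

theorem Multilocal.coeffIn_initState {k : ℕ} (F : Multilocal k) (x₀ : Config) :
    CoeffIn (contAlg (Fin k → ℝ)) (F.initState x₀) := by
  unfold Multilocal.initState
  induction F using MvPolynomial.induction_on with
  | C a =>
    simp only [MvPolynomial.eval₂_C, RingHom.comp_apply]
    exact CoeffIn.C (show ContDiff ℝ ∞ (a : (Fin k → ℝ) → ℂ) from a.2).continuous
  | add p q hp hq => simpa only [MvPolynomial.eval₂_add] using hp.add hq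
  | mul_X p i hp =>
    simp only [MvPolynomial.eval₂_mul, MvPolynomial.eval₂_X]
    exact hp.mul ((CoeffIn.C ((continuous_toC x₀).comp (continuous_apply i))).add
      (CoeffIn.const _))

section testFunction

variable {k : ℕ} {f : (Fin k → ℝ) → ℂ} (F : Multilocal k) (x₀ : Config)

theorem coeffIn_smul_initState (hf : Continuous f) :
    CoeffIn (contAlg (Fin k → ℝ)) fun t => f t • F.initState x₀ t :=
  CoeffIn.smul hf (F.coeffIn_initState x₀)

theorem coeffIn_measAlg_smul_initState (hf : Continuous f) :
    CoeffIn (measAlg (Fin k → ℝ)) fun t => f t • F.initState x₀ t :=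
  fun d => Continuous.measurable (coeffIn_smul_initState F x₀ hf d)

theorem coeffIn_bddAlg_smul_initState (hf : Continuous f) (hfc : HasCompactSupport f) :
    CoeffIn (bddAlg (Fin k → ℝ)) fun t => f t • F.initState x₀ t := fun d => by
  have hc : HasCompactSupport fun t => (f t • F.initState x₀ t).coeff d := by
    refine hfc.mono fun t ht h0 => ht ?_
    simp [show f t = 0 from h0]
  exact hc.exists_bound_of_continuous (coeffIn_smul_initState F x₀ hf d)

end testFunction

/-! ### The coefficients of the noise expectation -/

namespace Model

variable {m : Model} {k : ℕ} {sol : Config → ℝ → PowerSeries ℝ}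

theorem stoppedEval_initState (hsol : IsPerturbativeSolution m.χ m.σ m.α m.β m.x₀ sol)
    (ξ : Config) (t : Fin k → ℝ) (F : Multilocal k) :
    m.stoppedEval sol ξ t m.R (F.initState m.x₀ t) =
      F.eval₂ ((PowerSeries.C (R := ℂ)).comp (evalAt t))
        (fun i => (sol ξ (t i)).map Complex.ofRealHom) := by
  have h := MvPolynomial.eval₂_comp_left (m.stoppedEval sol ξ t m.R : State k →+* PowerSeries ℂ)
    ((MvPolynomial.C).comp (evalAt t)) (fun i =>
    (MvPolynomial.C (toC m.x₀ (t i)) + MvPolynomial.X (some i) : State k)) F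
  refine h.trans ?_
  congr 1
  · refine RingHom.ext fun x => ?_
    simp only [RingHom.comp_apply, RingHom.coe_coe, stoppedEval, MvPolynomial.algHom_C]
    rfl
  · funext i
    simp only [Function.comp_apply, RingHom.coe_coe, map_add, stoppedEval, MvPolynomial.algHom_C,
      MvPolynomial.aeval_X, stopped, increment_min_R hsol]
    change PowerSeries.C (toC m.x₀ (t i)) + _ = _
    rw [increment]
    ring

/-- Restricting Lebesgue measure to the compact support of `f` does not change the integral and
makes the measure finite, as the bounds on kernels require. -/
theorem coeff_smearedSolution (hsol : IsPerturbativeSolution m.χ m.σ m.α m.β m.x₀ sol)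
    (F : Multilocal k) {f : (Fin k → ℝ) → ℂ} (hf : Continuous f) (hfc : HasCompactSupport f)
    (N : ℕ) : PowerSeries.coeff N (smearedSolution F f sol) =
      wordSum (m.wordFn (volume.restrict (tsupport f)) fun t => f t • F.initState m.x₀ t)
        (pairWords N 0) := by
  have : IsFiniteMeasure (volume.restrict (tsupport f)) :=
    ⟨by rw [Measure.restrict_apply_univ]; exact hfc.measure_lt_top⟩
  have hPm := coeffIn_measAlg_smul_initState F m.x₀ hf
  have hPb := coeffIn_bddAlg_smul_initState F m.x₀ hf hfc
  funext ξ
  have e : ∀ t, f t * PowerSeries.coeff N (F.eval₂ ((PowerSeries.C (R := ℂ)).comp (evalAt t))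
      (fun i => (sol ξ (t i)).map Complex.ofRealHom)) = wordSum (fun w =>
        nest m.R (toC ξ) 0 w 0 m.R (m.kern w t (f t • F.initState m.x₀ t))) (pairWords N 0) := by
    intro t
    rw [← coeff_stoppedEval hsol ξ t N ⟨by linarith [m.R_pos], le_rfl⟩, map_smul,
      stoppedEval_initState hsol, map_smul, smul_eq_mul]
  rw [smearedSolution, PowerSeries.coeff_mk, wordSum_apply,
    ← setIntegral_eq_integral_of_forall_compl_eq_zero (s := tsupport f) fun t ht => by
      rw [image_eq_zero_of_notMem_tsupport ht, zero_mul]]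
  simp only [e]
  generalize pairWords N 0 = l
  have : Integrable (fun t => wordSum (fun w => nest m.R (toC ξ) 0 w 0 m.R
      (m.kern w t (f t • F.initState m.x₀ t))) l) (volume.restrict (tsupport f)) ∧
    ∫ t, wordSum (fun w => nest m.R (toC ξ) 0 w 0 m.R
      (m.kern w t (f t • F.initState m.x₀ t))) l ∂(volume.restrict (tsupport f)) =
      wordSum (fun w => m.wordFn (volume.restrict (tsupport f))
        (fun t => f t • F.initState m.x₀ t) w ξ) l := by
    induction l with
    | nil => simp
    | cons v l ih =>
      have hi := m.integrable_nest_kern (volume.restrict (tsupport f)) hPm hPb (measurable_toC ξ)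
        (integrable_toC ξ _) measurable_zero (integrable_zero _ _ _) v 0 m.R
      simp only [wordSum_cons]
      exact ⟨hi.add ih.1, by rw [integral_add hi ih.1, ih.2]; rfl⟩
  exact this.2

theorem coeff_sdeExpectation (hsol : IsPerturbativeSolution m.χ m.σ m.α m.β m.x₀ sol)
    (F : Multilocal k) {f : (Fin k → ℝ) → ℂ} (hf : Continuous f) (hfc : HasCompactSupport f)
    (N : ℕ) : PowerSeries.coeff N (sdeExpectation F f sol) =
      wordSum (fun w => m.wordFn (volume.restrict (tsupport f))
        (fun t => f t • F.initState m.x₀ t) w 0) (freeWords N) := by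
  have : IsFiniteMeasure (volume.restrict (tsupport f)) :=
    ⟨by rw [Measure.restrict_apply_univ]; exact hfc.measure_lt_top⟩
  rw [sdeExpectation, PowerSeries.coeff_mk, coeff_smearedSolution hsol F hf hfc,
    m.gammaDelta_wordSum _ Measure.absolutelyContinuous_restrict
      (coeffIn_measAlg_smul_initState F m.x₀ hf) (coeffIn_bddAlg_smul_initState F m.x₀ hf hfc)]

end Model
end MSR
end
noncomputable section
namespace MSR

open MeasureTheory Filter Topology Set Letter

/-! ### The exponential of the contraction operator on polynomials in `x` and `x̃`

The variables `Sum.inl j` are values of `x`, the variables `Sum.inr j` are values of `x̃`. -/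

section algebra

section general

variable {K : Type} [CommRing K] {ι J : Type}

/-- A combination of partial derivatives with constant coefficients. -/
def linDer (c : ι → K) : Derivation K (MvPolynomial ι K) (MvPolynomial ι K) :=
  MvPolynomial.mkDerivation K fun i => MvPolynomial.C (c i)

@[simp] theorem linDer_X (c : ι → K) (i : ι) :
    linDer c (MvPolynomial.X i) = MvPolynomial.C (c i) := MvPolynomial.mkDerivation_X _ _ _

theorem linDer_apply [Fintype ι] (c : ι → K) (P : MvPolynomial ι K) :
    linDer c P = ∑ i, c i • MvPolynomial.pderiv i P := by
  classical
  induction P using MvPolynomial.induction_on with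
  | C a => simp [MvPolynomial.derivation_C]
  | add p q hp hq => simp only [map_add, hp, hq, smul_add, Finset.sum_add_distrib]
  | mul_X p i hp =>
    simp only [Derivation.leibniz, hp, linDer_X, smul_add, Finset.sum_add_distrib, smul_eq_mul,
      MvPolynomial.pderiv_X, Finset.mul_sum, MvPolynomial.smul_eq_C_mul]
    congr 1
    · rw [Finset.sum_eq_single i]
      · simp [mul_comm]
      · intro j _ hj
        rw [Pi.single_eq_of_ne hj.symm]
        simp
      · simp
    · exact Finset.sum_congr rfl fun j _ => by ring

theorem linDer_comm (c d : ι → K) (P : MvPolynomial ι K) :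
    linDer c (linDer d P) = linDer d (linDer c P) := by
  have h : ⁅linDer c, linDer d⁆ = 0 := MvPolynomial.derivation_ext fun i => by
    rw [Derivation.commutator_apply]
    simp [MvPolynomial.derivation_C]
  have := congrArg (fun D => D P) h
  simp only [Derivation.commutator_apply, Derivation.zero_apply] at this
  exact sub_eq_zero.1 this

/-- The derivative in the direction of the propagator from `l`, in the variables `(x, x̃)`. -/
def propDer₂ (g : J → J → K) (l : J) :
    Derivation K (MvPolynomial (J ⊕ J) K) (MvPolynomial (J ⊕ J) K) :=
  linDer (Sum.elim (fun j => g j l) 0)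

/-- The contraction operator `∑ G(j, l) ∂² / ∂x(j) ∂x̃(l)`. -/
def contract [Fintype J] (g : J → J → K) : MvPolynomial (J ⊕ J) K →ₗ[K] MvPolynomial (J ⊕ J) K :=
  ∑ l, (propDer₂ g l : MvPolynomial (J ⊕ J) K →ₗ[K] MvPolynomial (J ⊕ J) K) ∘ₗ
    ((MvPolynomial.pderiv (Sum.inr l) :
      Derivation K (MvPolynomial (J ⊕ J) K) (MvPolynomial (J ⊕ J) K)) :
      MvPolynomial (J ⊕ J) K →ₗ[K] MvPolynomial (J ⊕ J) K)

theorem contract_apply [Fintype J] (g : J → J → K) (Q : MvPolynomial (J ⊕ J) K) :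
    contract g Q = ∑ l, propDer₂ g l (MvPolynomial.pderiv (Sum.inr l) Q) := by
  simp [contract, LinearMap.sum_apply]

theorem contract_eq_sum [Fintype J] (g : J → J → K) (Q : MvPolynomial (J ⊕ J) K) :
    contract g Q = ∑ l, ∑ j,
      g j l • MvPolynomial.pderiv (Sum.inl j) (MvPolynomial.pderiv (Sum.inr l) Q) := by
  rw [contract_apply]
  refine Finset.sum_congr rfl fun l _ => ?_
  rw [propDer₂, linDer_apply, Fintype.sum_sum_type]
  simp

theorem map_contract [Fintype J] {L : Type} [CommRing L] (φ : K →+* L) (g : J → J → K)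
    (Q : MvPolynomial (J ⊕ J) K) :
    MvPolynomial.map φ (contract g Q) =
      contract (fun j l => φ (g j l)) (MvPolynomial.map φ Q) := by
  simp only [contract_eq_sum, map_sum, MvPolynomial.smul_eq_C_mul, map_mul, MvPolynomial.map_C,
    MvPolynomial.pderiv_map]

end general

variable {J : Type} [Fintype J] (g : J → J → ℂ)

/-- The derivative in the direction of the propagator from `l`, in the variables `x`. -/
def propDer (l : J) : Derivation ℂ (MvPolynomial J ℂ) (MvPolynomial J ℂ) := linDer fun j => g j l

theorem pderiv_eq_linDer {ι : Type} [Fintype ι] [DecidableEq ι] (i : ι) (P : MvPolynomial ι ℂ) :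
    MvPolynomial.pderiv i P = linDer (Pi.single i 1) P := by
  rw [linDer_apply, Finset.sum_eq_single i]
  · simp
  · intro j _ hj
    simp [hj]
  · simp

theorem propDer₂_contract (l : J) (Q : MvPolynomial (J ⊕ J) ℂ) :
    propDer₂ g l (contract g Q) = contract g (propDer₂ g l Q) := by
  classical
  simp only [contract_apply, map_sum, pderiv_eq_linDer, propDer₂]
  refine Finset.sum_congr rfl fun j _ => ?_
  rw [linDer_comm (Sum.elim (fun j => g j l) 0), linDer_comm (Sum.elim (fun j => g j l) 0)]

/-- The commutator of the contraction with multiplication by `x̃(l)` is the derivation along the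
propagator from `l`: exactly one contraction can use up this factor. -/
theorem contract_X_mul (l : J) (Q : MvPolynomial (J ⊕ J) ℂ) :
    contract g (MvPolynomial.X (Sum.inr l) * Q) =
      MvPolynomial.X (Sum.inr l) * contract g Q + propDer₂ g l Q := by
  classical
  have hX : ∀ j, propDer₂ g j (MvPolynomial.X (Sum.inr l)) = 0 := fun j => by simp [propDer₂]
  have h1 : ∀ j, propDer₂ g j (MvPolynomial.pderiv (Sum.inr j) (MvPolynomial.X (Sum.inr l) * Q)) =
      MvPolynomial.X (Sum.inr l) * propDer₂ g j (MvPolynomial.pderiv (Sum.inr j) Q) +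
        if j = l then propDer₂ g l Q else 0 := fun j => by
    rw [Derivation.leibniz, map_add, smul_eq_mul, smul_eq_mul, Derivation.leibniz, hX, smul_zero,
      add_zero, smul_eq_mul]
    congr 1
    split_ifs with h
    · rw [h, MvPolynomial.pderiv_X_self, mul_one]
    · rw [MvPolynomial.pderiv_X_of_ne (by simpa using Ne.symm h), mul_zero, map_zero]
  simp only [contract_apply, h1, Finset.sum_add_distrib, Finset.mul_sum, Finset.sum_ite_eq',
    Finset.mem_univ, if_true]

/-- The commutator commutes with the contraction, so the powers obey `[Cⁿ⁺¹, x̃] = (n + 1) D Cⁿ`, as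
for a derivative. -/
theorem iterate_contract_X_mul (l : J) (Q : MvPolynomial (J ⊕ J) ℂ) (n : ℕ) :
    (contract g)^[n + 1] (MvPolynomial.X (Sum.inr l) * Q) =
      MvPolynomial.X (Sum.inr l) * (contract g)^[n + 1] Q +
        ((n + 1 : ℕ) : ℂ) • propDer₂ g l ((contract g)^[n] Q) := by
  induction n with
  | zero => simp [contract_X_mul]
  | succ n ih =>
    rw [Function.iterate_succ_apply' _ (n + 1), ih, map_add, contract_X_mul, map_smul,
      ← propDer₂_contract, ← Function.iterate_succ_apply' (contract g) n,
      Function.iterate_succ_apply' _ (n + 1)]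
    push_cast
    module

/-- Setting `x̃ = 0`. -/
def dropTilde : MvPolynomial (J ⊕ J) ℂ →ₐ[ℂ] MvPolynomial J ℂ :=
  MvPolynomial.aeval (Sum.elim MvPolynomial.X 0)

theorem dropTilde_propDer₂ {J : Type} (g : J → J → ℂ) (l : J) (Q : MvPolynomial (J ⊕ J) ℂ) :
    dropTilde (propDer₂ g l Q) = propDer g l (dropTilde Q) := by
  induction Q using MvPolynomial.induction_on with
  | C a => simp [propDer, propDer₂, dropTilde, MvPolynomial.derivation_C]
  | add p q hp hq => simp only [map_add, hp, hq]
  | mul_X p i hp =>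
    have hX : (dropTilde (propDer₂ g l (MvPolynomial.X i)) : MvPolynomial J ℂ) =
        propDer g l (dropTilde (MvPolynomial.X i)) := by
      cases i <;> simp [propDer, propDer₂, dropTilde]
    rw [Derivation.leibniz, map_add, smul_eq_mul, smul_eq_mul, map_mul, map_mul, map_mul,
      Derivation.leibniz, smul_eq_mul, smul_eq_mul, hp, hX]

/-- The exponential of the contraction operator, whose terms of order at least `M` vanish, maps `Q`
to `P` at `x̃ = 0`. -/
def HasExp (M : ℕ) (Q : MvPolynomial (J ⊕ J) ℂ) (P : MvPolynomial J ℂ) : Prop :=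
  (∀ n, M ≤ n → (contract g)^[n] Q = 0) ∧
    ∑ n ∈ Finset.range M, ((n.factorial : ℂ))⁻¹ • dropTilde ((contract g)^[n] Q) = P

variable {g}

theorem HasExp.mono {M M' : ℕ} {Q : MvPolynomial (J ⊕ J) ℂ} {P : MvPolynomial J ℂ}
    (h : HasExp g M Q P) (hM : M ≤ M') : HasExp g M' Q P := by
  refine ⟨fun n hn => h.1 n (hM.trans hn), ?_⟩
  rw [← h.2]
  symm
  refine Finset.sum_subset (Finset.range_mono hM) fun n _ hn => ?_
  rw [h.1 n (by simpa using hn), map_zero, smul_zero]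

theorem HasExp.add {M : ℕ} {Q Q' : MvPolynomial (J ⊕ J) ℂ} {P P' : MvPolynomial J ℂ}
    (h : HasExp g M Q P) (h' : HasExp g M Q' P') : HasExp g M (Q + Q') (P + P') := by
  refine ⟨fun n hn => ?_, ?_⟩
  · rw [← Module.End.pow_apply (contract g), map_add, Module.End.pow_apply, Module.End.pow_apply,
      h.1 n hn, h'.1 n hn, add_zero]
  · rw [← h.2, ← h'.2, ← Finset.sum_add_distrib]
    refine Finset.sum_congr rfl fun n _ => ?_
    rw [← Module.End.pow_apply (contract g), map_add, Module.End.pow_apply, Module.End.pow_apply,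
      map_add, smul_add]

theorem HasExp.smul {M : ℕ} {Q : MvPolynomial (J ⊕ J) ℂ} {P : MvPolynomial J ℂ}
    (h : HasExp g M Q P) (c : ℂ) : HasExp g M (c • Q) (c • P) := by
  refine ⟨fun n hn => ?_, ?_⟩
  · rw [← Module.End.pow_apply (contract g), map_smul, Module.End.pow_apply, h.1 n hn, smul_zero]
  · rw [← h.2, Finset.smul_sum]
    refine Finset.sum_congr rfl fun n _ => ?_
    rw [← Module.End.pow_apply (contract g), map_smul, Module.End.pow_apply, map_smul, smul_comm]

theorem hasExp_rename (P : MvPolynomial J ℂ) :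
    HasExp g 1 (MvPolynomial.rename Sum.inl P) P := by
  classical
  have h0 : contract g (MvPolynomial.rename Sum.inl P) = 0 := by
    rw [contract_apply]
    refine Finset.sum_eq_zero fun l _ => ?_
    have : MvPolynomial.pderiv (Sum.inr l) (MvPolynomial.rename Sum.inl P) =
        (0 : MvPolynomial (J ⊕ J) ℂ) := by
      refine MvPolynomial.pderiv_eq_zero_of_notMem_vars fun h => ?_
      obtain ⟨j, _, hj⟩ := Finset.mem_image.1 (MvPolynomial.vars_rename Sum.inl P h)
      simp at hj
    rw [this, map_zero]
  refine ⟨fun n hn => ?_, ?_⟩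
  · obtain ⟨n, rfl⟩ := Nat.exists_eq_succ_of_ne_zero (by omega : n ≠ 0)
    rw [Function.iterate_succ_apply, h0]
    exact Function.iterate_fixed (map_zero _) n
  · simp only [Finset.range_one, Finset.sum_singleton, Nat.factorial_zero, Nat.cast_one, inv_one,
      one_smul, Function.iterate_zero, id_eq, dropTilde, MvPolynomial.aeval_rename]
    exact MvPolynomial.aeval_X_left_apply P

/-- This is `e^C x̃(l) = x̃(l) e^C + D e^C` at `x̃ = 0`, where only the last term survives; `(n + 1)
/ (n + 1)!` leaves the factorial of the shifted index. The extra factor `x̃` allows one more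
contraction. -/
theorem HasExp.X_mul {M : ℕ} {Q : MvPolynomial (J ⊕ J) ℂ} {P : MvPolynomial J ℂ}
    (h : HasExp g M Q P) (l : J) :
    HasExp g (M + 1) (MvPolynomial.X (Sum.inr l) * Q) (propDer g l P) := by
  refine ⟨fun n hn => ?_, ?_⟩
  · obtain ⟨n, rfl⟩ := Nat.exists_eq_succ_of_ne_zero (by omega : n ≠ 0)
    rw [iterate_contract_X_mul, h.1 _ (by omega), h.1 _ (by omega), map_zero, mul_zero, smul_zero,
      add_zero]
  · rw [← h.2, Finset.sum_range_succ']
    have h0 : dropTilde ((contract g)^[0] (MvPolynomial.X (Sum.inr l) * Q)) = 0 := by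
      simp [dropTilde]
    rw [h0, smul_zero, add_zero, map_sum]
    refine Finset.sum_congr rfl fun n _ => ?_
    have hX : (dropTilde (MvPolynomial.X (Sum.inr l)) : MvPolynomial J ℂ) = 0 := by
      simp [dropTilde]
    have hn : ((n + 1 : ℕ) : ℂ) ≠ 0 := by exact_mod_cast Nat.succ_ne_zero n
    rw [iterate_contract_X_mul, map_add, map_mul, hX, zero_mul, zero_add, map_smul,
      dropTilde_propDer₂, smul_smul, Derivation.map_smul, Nat.factorial_succ, Nat.cast_mul, mul_inv,
      mul_right_comm, inv_mul_cancel₀ hn, one_mul]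

end algebra

/-! ### Time-ordered products of vertices -/

section vertices

variable (m : Model) {J : Type} [Fintype J] (p : J → ℝ)

theorem derivation_lin_eq_zero {A : Type} [CommRing A] [Algebra ℂ A] (D : Derivation ℂ A A)
    (a : Letter) (s : ℝ) {y : A} (hy : D y = 0) : D (m.lin a s y) = 0 := by
  cases a <;> simp [Model.lin, derivation_polyIn, hy]

theorem derivation_quad_eq_zero {A : Type} [CommRing A] [Algebra ℂ A] (D : Derivation ℂ A A)
    (a : Letter) (s : ℝ) {y : A} (hy : D y = 0) : D (m.quad a s y) = 0 := by
  cases a <;> simp [Model.quad, Derivation.leibniz_pow, derivation_polyIn, hy]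

/-- The propagators between the times `p`. -/
def prop (i j : J) : ℂ := G (p i) (p j)

/-- The interaction vertex with letter `v.1` at the time with index `v.2`, as a polynomial in
`(x, x̃)`. -/
def vertex (v : Letter × J) : MvPolynomial (J ⊕ J) ℂ :=
  MvPolynomial.X (Sum.inr v.2) *
      MvPolynomial.rename Sum.inl (m.lin v.1 (p v.2) (MvPolynomial.X v.2 : MvPolynomial J ℂ)) +
    MvPolynomial.X (Sum.inr v.2) * (MvPolynomial.X (Sum.inr v.2) *
      MvPolynomial.rename Sum.inl (m.quad v.1 (p v.2) (MvPolynomial.X v.2 : MvPolynomial J ℂ)))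

/-- The action of a vertex on polynomials in `x`. -/
def vertexAct (v : Letter × J) (P : MvPolynomial J ℂ) : MvPolynomial J ℂ :=
  m.lin v.1 (p v.2) (MvPolynomial.X v.2) * propDer (prop p) v.2 P +
    m.quad v.1 (p v.2) (MvPolynomial.X v.2) * propDer (prop p) v.2 (propDer (prop p) v.2 P)

/-- The successive action of a list of vertices. -/
def vertexActs : List (Letter × J) → MvPolynomial J ℂ → MvPolynomial J ℂ
  | [], P => P
  | v :: l, P => vertexActs l (vertexAct m p v P)

theorem vertexActs_add {J : Type} (p : J → ℝ) (l : List (Letter × J)) : ∀ P Q : MvPolynomial J ℂ,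
    vertexActs m p l (P + Q) = vertexActs m p l P + vertexActs m p l Q := by
  induction l with
  | nil => intro P Q; rfl
  | cons v l ih =>
    intro P Q
    simp only [vertexActs, ← ih, vertexAct, map_add]
    congr 1
    ring

variable {p}

/-- The times of the list of vertices are decreasing. -/
def Ordered (p : J → ℝ) (l : List (Letter × J)) : Prop :=
  l.Pairwise fun v v' => p v'.2 < p v.2

/-- Retardation. The inequality is not strict because `G(t, t) = 0`, so a vertex does not
differentiate its own coefficients either. -/
theorem propDer_X_eq_zero {J : Type} {p : J → ℝ} {j l : J} (h : p j ≤ p l) :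
    propDer (prop p) l (MvPolynomial.X j : MvPolynomial J ℂ) = 0 := by
  simp [propDer, prop, G_of_le h]

/-- The derivation from `j` annihilates the coefficients of vertices that are not later than `j`,
and constant-coefficient derivations commute. -/
theorem propDer_vertexActs {J : Type} {p : J → ℝ} (l : List (Letter × J)) (j : J) (hj : ∀ v ∈ l, p v.2 ≤ p j) :
    ∀ P, propDer (prop p) j (vertexActs m p l P) = vertexActs m p l (propDer (prop p) j P) := by
  induction l with
  | nil => intro P; rfl
  | cons v l ih =>
    intro P
    have hX := propDer_X_eq_zero (p := p) (hj v (by simp))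
    rw [vertexActs, ih fun v' hv' => hj v' (by simp [hv']), vertexActs]
    congr 1
    rw [vertexAct, map_add, Derivation.leibniz, Derivation.leibniz,
      derivation_lin_eq_zero m _ _ _ hX, derivation_quad_eq_zero m _ _ _ hX, vertexAct]
    have hcomm : ∀ (i i' : J) (Q : MvPolynomial J ℂ),
        propDer (prop p) i (propDer (prop p) i' Q) = propDer (prop p) i' (propDer (prop p) i Q) :=
      fun i i' Q => linDer_comm _ _ _
    rw [smul_zero, add_zero, smul_zero, add_zero, smul_eq_mul, smul_eq_mul, hcomm j v.2 (propDer _ _ P),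
      hcomm j v.2 P]

/-- The head vertex is the latest. Its factors `x̃` become derivations which pass through the
actions of the earlier vertices and reach `P` times the coefficient of the vertex. That coefficient
is not differentiated, since it sits at equal time; what is left is the vertex operator acting on
`P`. The bound `2 * l.length + 1` reflects at most two factors `x̃` per vertex. -/
theorem hasExp_vertices (l : List (Letter × J)) (hl : Ordered p l) : ∀ P : MvPolynomial J ℂ,
    HasExp (prop p) (2 * l.length + 1) (MvPolynomial.rename Sum.inl P * (l.map (vertex m p)).prod)
      (vertexActs m p l P) := by
  induction l with
  | nil => intro P; simpa [vertexActs] using hasExp_rename P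
  | cons v l ih =>
    intro P
    have hl' := List.pairwise_cons.1 hl
    have hle : ∀ v' ∈ l, p v'.2 ≤ p v.2 := fun v' hv' => (hl'.1 v' hv').le
    have hX := propDer_X_eq_zero (p := p) (le_refl (p v.2))
    have h1 := (ih hl'.2 (P * m.lin v.1 (p v.2) (MvPolynomial.X v.2))).X_mul v.2
    have h2 := ((ih hl'.2 (P * m.quad v.1 (p v.2) (MvPolynomial.X v.2))).X_mul v.2).X_mul v.2
    rw [propDer_vertexActs m l v.2 hle] at h1 h2
    rw [propDer_vertexActs m l v.2 hle] at h2
    have h3 := (h1.mono (Nat.le_succ _)).add h2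
    rw [← vertexActs_add] at h3
    have e : propDer (prop p) v.2 (P * m.lin v.1 (p v.2) (MvPolynomial.X v.2)) +
        propDer (prop p) v.2 (propDer (prop p) v.2 (P * m.quad v.1 (p v.2) (MvPolynomial.X v.2))) =
        vertexAct m p v P := by
      simp only [Derivation.leibniz, derivation_lin_eq_zero m _ _ _ hX,
        derivation_quad_eq_zero m _ _ _ hX, zero_add, smul_eq_mul, vertexAct, mul_zero, add_zero]
    rw [e] at h3
    have hlen : (2 * l.length + 1 + 1).succ = 2 * (v :: l).length + 1 := by
      rw [List.length_cons]; omega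
    rw [hlen] at h3
    rw [vertexActs]
    convert h3 using 1
    rw [List.map_cons, List.prod_cons, vertex, map_mul, map_mul]
    ring

/-- Every contraction consumes one `x̃`, whatever the order of the times. The uniform truncation of
the exponential needs this at all times, so the value `P'` is left unspecified. -/
theorem iterate_contract_vertices_eq_zero (l : List (Letter × J)) : ∀ P : MvPolynomial J ℂ,
    ∀ n, 2 * l.length + 1 ≤ n → (contract (prop p))^[n]
      (MvPolynomial.rename Sum.inl P * (l.map (vertex m p)).prod) = 0 := by
  suffices h : ∀ P : MvPolynomial J ℂ, ∃ P', HasExp (prop p) (2 * l.length + 1)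
      (MvPolynomial.rename Sum.inl P * (l.map (vertex m p)).prod) P' by
    intro P
    obtain ⟨P', hP'⟩ := h P
    exact hP'.1
  induction l with
  | nil => exact fun P => ⟨P, by simpa using hasExp_rename P⟩
  | cons v l ih =>
    intro P
    obtain ⟨P₁, h1⟩ := ih (P * m.lin v.1 (p v.2) (MvPolynomial.X v.2))
    obtain ⟨P₂, h2⟩ := ih (P * m.quad v.1 (p v.2) (MvPolynomial.X v.2))
    have h3 := ((h1.X_mul v.2).mono (Nat.le_succ _)).add ((h2.X_mul v.2).X_mul v.2)
    have hlen : (2 * l.length + 1 + 1).succ = 2 * (v :: l).length + 1 := by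
      rw [List.length_cons]; omega
    rw [hlen] at h3
    refine ⟨propDer (prop p) v.2 P₁ + propDer (prop p) v.2 (propDer (prop p) v.2 P₂), ?_⟩
    convert h3 using 1
    rw [List.map_cons, List.prod_cons, vertex, map_mul, map_mul]
    ring

end vertices

/-! ### Comparison with the kernels of words -/

section comparison

variable (m : Model) {k n : ℕ} (p : Fin k ⊕ Fin n → ℝ)

/-- Rewriting polynomials in `x` in terms of the increments. -/
def toState : MvPolynomial (Fin k ⊕ Fin n) ℂ →ₐ[ℂ] State k :=
  MvPolynomial.aeval (Sum.elim
    (fun i => MvPolynomial.C (toC m.x₀ (p (Sum.inl i))) + MvPolynomial.X (some i))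
    fun j => m.position (p (Sum.inr j)))

/-- The variant of `propDer` in which all vertices are later than `l`. -/
def fullDer (l : Fin k ⊕ Fin n) :
    Derivation ℂ (MvPolynomial (Fin k ⊕ Fin n) ℂ) (MvPolynomial (Fin k ⊕ Fin n) ℂ) :=
  linDer (Sum.elim (fun i => prop p (Sum.inl i) l) 1)

theorem toState_fullDer (l : Fin k ⊕ Fin n) (P : MvPolynomial (Fin k ⊕ Fin n) ℂ) :
    toState m p (fullDer p l P) = shift (fun i => p (Sum.inl i)) (p l) (toState m p P) := by
  induction P using MvPolynomial.induction_on with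
  | C a => simp [fullDer, toState, MvPolynomial.derivation_C]
  | add p q hp hq => simp only [map_add, hp, hq]
  | mul_X q i hq =>
    have hX : toState m p (fullDer p l (MvPolynomial.X i)) =
        shift (fun i => p (Sum.inl i)) (p l) (toState m p (MvPolynomial.X i)) := by
      cases i with
      | inl i => simp [fullDer, toState, MvPolynomial.derivation_C, prop]
      | inr i => simp [fullDer, toState]
    rw [Derivation.leibniz, map_add, smul_eq_mul, smul_eq_mul, map_mul, map_mul, map_mul,
      Derivation.leibniz, smul_eq_mul, smul_eq_mul, hq, hX]

theorem eval_eq_coeff_toState (P : MvPolynomial (Fin k ⊕ Fin n) ℂ) :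
    MvPolynomial.eval (fun j => toC m.x₀ (p j)) P = (toState m p P).coeff 0 := by
  have : ∀ Q : State k, Q.coeff 0 = MvPolynomial.constantCoeff Q := fun Q => rfl
  rw [this]
  induction P using MvPolynomial.induction_on with
  | C a => simp [toState]
  | add p q hp hq => simp only [map_add, hp, hq]
  | mul_X q i hq =>
    simp only [map_mul, hq, MvPolynomial.eval_X]
    congr 1
    cases i <;> simp [toState, Model.position, toC]

/-- After `toState` all vertex variables share the single moving variable `none`, so the true
propagators must agree with `fullDer`. They do on polynomials involving only observation times and
vertices that have already acted, since those are later than the remaining ones. The hypothesis on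
`P` is this invariant. -/
theorem eval_vertexActs (l : List (Letter × Fin n))
    (hl : l.Pairwise fun v v' => p (Sum.inr v'.2) < p (Sum.inr v.2)) :
    ∀ (P : MvPolynomial (Fin k ⊕ Fin n) ℂ) (u : ℕ → ℝ),
    (∀ v ∈ l, propDer (prop p) (Sum.inr v.2) P = fullDer p (Sum.inr v.2) P) →
    (∀ i (hi : i < l.length), u i = p (Sum.inr (l[i]).2)) →
    MvPolynomial.eval (fun j => toC m.x₀ (p j))
      (vertexActs m p (l.map fun v => (v.1, Sum.inr v.2)) P) =
      m.kern (l.map Prod.fst) (fun i => p (Sum.inl i)) (toState m p P) u := by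
  induction l with
  | nil => intro P u _ _; exact eval_eq_coeff_toState m p P
  | cons v l ih =>
    intro P u hP hu
    have hl' := List.pairwise_cons.1 hl
    simp only [List.map_cons, vertexActs, Model.kern]
    have hu0 : u 0 = p (Sum.inr v.2) := hu 0 (by simp)
    have hcomm : ∀ (j : Fin k ⊕ Fin n) (Q : MvPolynomial (Fin k ⊕ Fin n) ℂ) (j' : Fin k ⊕ Fin n),
        propDer (prop p) j (propDer (prop p) j' Q) = propDer (prop p) j' (propDer (prop p) j Q) :=
      fun j Q j' => linDer_comm _ _ _
    have hcomm' : ∀ (j : Fin k ⊕ Fin n) (Q : MvPolynomial (Fin k ⊕ Fin n) ℂ)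
        (j' : Fin k ⊕ Fin n),
        fullDer p j (propDer (prop p) j' Q) = propDer (prop p) j' (fullDer p j Q) :=
      fun j Q j' => linDer_comm _ _ _
    have hv := hP v (by simp)
    have hst : toState m p (vertexAct m p (v.1, Sum.inr v.2) P) =
        m.vertexOp v.1 (fun i => p (Sum.inl i)) (u 0) (toState m p P) := by
      rw [Model.vertexOp_apply, hu0, vertexAct, map_add, map_mul, map_mul, m.map_lin, m.map_quad,
        hcomm (Sum.inr v.2) P (Sum.inr v.2), ← toState_fullDer, ← toState_fullDer]
      simp only [hv]
      rw [← hv, hcomm', ← hv]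
      simp [toState]
    rw [← hst]
    refine ih hl'.2 _ _ (fun v' hv' => ?_) fun i hi => hu (i + 1) (by simpa using hi)
    have hlt := hl'.1 v' hv'
    have hX : propDer (prop p) (Sum.inr v'.2) (MvPolynomial.X (Sum.inr v.2)) =
        fullDer p (Sum.inr v'.2) (MvPolynomial.X (Sum.inr v.2)) := by
      simp [propDer, fullDer, prop, G_of_lt hlt]
    -- The invariant is carried by the difference of the two derivations: it is itself a derivation,
    -- kills the newly introduced variable and hence kills the result of the vertex action.
    have hX' : (propDer (prop p) (Sum.inr v'.2) - fullDer p (Sum.inr v'.2))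
        (MvPolynomial.X (Sum.inr v.2)) = 0 := by
      rw [Derivation.sub_apply, hX, sub_self]
    have hE : ∀ Q, propDer (prop p) (Sum.inr v'.2) Q = fullDer p (Sum.inr v'.2) Q ↔
        (propDer (prop p) (Sum.inr v'.2) - fullDer p (Sum.inr v'.2)) Q = 0 := fun Q => by
      rw [Derivation.sub_apply, sub_eq_zero]
    have h0 := (hE P).1 (hP v' (by simp [hv']))
    have hD : ∀ Q, (propDer (prop p) (Sum.inr v'.2) - fullDer p (Sum.inr v'.2)) Q = 0 →
        (propDer (prop p) (Sum.inr v'.2) - fullDer p (Sum.inr v'.2))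
          (propDer (prop p) (Sum.inr v.2) Q) = 0 := fun Q hQ => by
      rw [← hE] at hQ ⊢
      rw [hcomm, hcomm', hQ]
    rw [hE, vertexAct, map_add, Derivation.leibniz, Derivation.leibniz,
      derivation_lin_eq_zero m _ _ _ hX', derivation_quad_eq_zero m _ _ _ hX', hD _ h0,
      hD _ (hD _ h0)]
    simp

end comparison

end MSR
end
noncomputable section
namespace MSR

open MeasureTheory Filter Topology Set Letter

/-! ### Polynomial functionals of `(x, x̃)` with integrable kernels -/

section directional

variable {A ι : Type} [CommRing A] [Algebra ℂ A]

/-- First-order Taylor expansion with a remainder polynomial in `b` over `A`. When `A` is an algebra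
of kernels, a linear functional on `A` turns the remainder into a complex polynomial, so no
differentiation under the integral is needed. -/
theorem exists_eval_add_smul (y η : ι → A) (Q : MvPolynomial ι A) : ∃ q : Polynomial A, ∀ b : ℂ,
    MvPolynomial.eval (y + b • η) Q = MvPolynomial.eval y Q +
      b • MvPolynomial.eval y (linDer η Q) + b ^ 2 • q.eval (algebraMap ℂ A b) := by
  induction Q using MvPolynomial.induction_on with
  | C a => exact ⟨0, fun b => by simp [MvPolynomial.derivation_C]⟩
  | add p q hp hq =>
    obtain ⟨r, hr⟩ := hp
    obtain ⟨r', hr'⟩ := hq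
    refine ⟨r + r', fun b => ?_⟩
    simp only [map_add, hr, hr', Polynomial.eval_add, smul_add]
    abel
  | mul_X p i hp =>
    obtain ⟨r, hr⟩ := hp
    refine ⟨r * (Polynomial.C (y i) + Polynomial.X * Polynomial.C (η i)) +
      Polynomial.C (MvPolynomial.eval y (linDer η p) * η i), fun b => ?_⟩
    rw [map_mul, hr, MvPolynomial.eval_X, Pi.add_apply, Pi.smul_apply]
    simp only [map_mul, MvPolynomial.eval_X, Derivation.leibniz,
      linDer_X, map_add, smul_eq_mul, MvPolynomial.eval_C, Polynomial.eval_add, Polynomial.eval_mul,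
      Polynomial.eval_C, Polynomial.eval_X, Algebra.smul_def, map_pow]
    ring

theorem hasDerivAt_eval_add_smul (I : A →ₗ[ℂ] ℂ) (y η : ι → A) (Q : MvPolynomial ι A) :
    HasDerivAt (fun b : ℝ => I (MvPolynomial.eval (y + (b : ℂ) • η) Q))
      (I (MvPolynomial.eval y (linDer η Q))) 0 := by
  obtain ⟨q, hq⟩ := exists_eval_add_smul y η Q
  have hpoly : ∃ r : Polynomial ℂ, ∀ b : ℂ, I (q.eval (algebraMap ℂ A b)) = r.eval b := by
    clear hq
    induction q using Polynomial.induction_on' with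
    | add p q hp hq =>
      obtain ⟨r, hr⟩ := hp
      obtain ⟨r', hr'⟩ := hq
      exact ⟨r + r', fun b => by simp [hr, hr']⟩
    | monomial n a =>
      refine ⟨Polynomial.monomial n (I a), fun b => ?_⟩
      rw [Polynomial.eval_monomial, Polynomial.eval_monomial, ← map_pow, mul_comm,
        ← Algebra.smul_def, map_smul, smul_eq_mul, mul_comm]
  obtain ⟨r, hr⟩ := hpoly
  have hfun : (fun b : ℝ => I (MvPolynomial.eval (y + (b : ℂ) • η) Q)) = fun b : ℝ =>
      (Polynomial.C (I (MvPolynomial.eval y Q)) + Polynomial.X *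
        Polynomial.C (I (MvPolynomial.eval y (linDer η Q))) + Polynomial.X ^ 2 * r).eval (b : ℂ) := by
    funext b
    rw [hq, map_add, map_add, map_smul, map_smul, hr]
    simp only [Polynomial.eval_add, Polynomial.eval_mul, Polynomial.eval_C, Polynomial.eval_X,
      Polynomial.eval_pow, smul_eq_mul]
  rw [hfun]
  have h := (Polynomial.hasDerivAt (Polynomial.C (I (MvPolynomial.eval y Q)) + Polynomial.X *
        Polynomial.C (I (MvPolynomial.eval y (linDer η Q))) + Polynomial.X ^ 2 * r)
        ((0 : ℝ) : ℂ)).comp_ofReal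
  simpa using h

end directional

/-- The product of the measures `slab R`. -/
def boxMeasure (J : Type) [Fintype J] (R : ℝ) : Measure (J → ℝ) := Measure.pi fun _ => slab R

instance (J : Type) [Fintype J] (R : ℝ) : IsFiniteMeasure (boxMeasure J R) := by
  unfold boxMeasure
  infer_instance

theorem ae_boxMeasure (J : Type) [Fintype J] (R : ℝ) :
    ∀ᵐ p ∂boxMeasure J R, ∀ j, p j ∈ Icc (-R) R := by
  refine ae_all_iff.2 fun j => ?_
  have : ∀ᵐ s ∂slab R, s ∈ Icc (-R) R := ae_restrict_mem measurableSet_Icc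
  exact (Measure.quasiMeasurePreserving_eval (μ := fun _ : J => slab R) j).ae this

/-- The algebra of measurable functions that are bounded on the box of side `R`. -/
def boxAlg (J : Type) (R : ℝ) : Subalgebra ℂ ((J → ℝ) → ℂ) where
  carrier := {h | Measurable h ∧ ∃ C, ∀ p, (∀ j, p j ∈ Icc (-R) R) → ‖h p‖ ≤ C}
  mul_mem' := by
    rintro f g ⟨hf, C, hC⟩ ⟨hg, C', hC'⟩
    refine ⟨hf.mul hg, C * C', fun p hp => ?_⟩
    simp only [Pi.mul_apply, norm_mul]
    exact mul_le_mul (hC p hp) (hC' p hp) (norm_nonneg _) ((norm_nonneg _).trans (hC p hp))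
  add_mem' := by
    rintro f g ⟨hf, C, hC⟩ ⟨hg, C', hC'⟩
    exact ⟨hf.add hg, C + C', fun p hp => (norm_add_le _ _).trans (add_le_add (hC p hp) (hC' p hp))⟩
  algebraMap_mem' r := ⟨measurable_const, ‖r‖, fun _ _ => le_rfl⟩

variable {J : Type} [Fintype J] {R : ℝ}

theorem integrable_boxAlg (h : boxAlg J R) : Integrable (h : (J → ℝ) → ℂ) (boxMeasure J R) := by
  obtain ⟨hm, C, hC⟩ := h.2
  exact Integrable.of_bound hm.aestronglyMeasurable (C := C)
    ((ae_boxMeasure J R).mono fun p hp => hC p hp)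

/-- Integration over the box. -/
def boxInt (J : Type) [Fintype J] (R : ℝ) : boxAlg J R →ₗ[ℂ] ℂ where
  toFun h := ∫ p, (h : (J → ℝ) → ℂ) p ∂boxMeasure J R
  map_add' h h' := integral_add (integrable_boxAlg h) (integrable_boxAlg h')
  map_smul' c _ := integral_const_mul c _

/-- Evaluation of the elements of `boxAlg` at a point. -/
def atPoint (p : J → ℝ) : boxAlg J R →+* ℂ :=
  (Pi.evalRingHom (fun _ : J → ℝ => ℂ) p).comp (boxAlg J R).subtype

/-- The value of a configuration at the time with index `j`. -/
def coord (R : ℝ) (x : Config) (j : J) : boxAlg J R :=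
  ⟨fun p => toC x (p j), (measurable_toC x).comp (measurable_pi_apply j), by
    obtain ⟨C, hC⟩ := (isCompact_Icc (a := -R) (b := R)).exists_bound_of_continuousOn
      (continuous_toC x).continuousOn
    exact ⟨C, fun p hp => hC _ (hp j)⟩⟩

/-- The propagator between the times with indices `j` and `l`. -/
def propCoeff (R : ℝ) (j l : J) : boxAlg J R :=
  ⟨fun p => prop p j l, measurable_ofReal_G (measurable_pi_apply j) (measurable_pi_apply l), 1,
    fun _ _ => norm_G_le _ _⟩

/-- The fields `(x, x̃)` at the times with indices in `J`. -/
def fields (J : Type) [Fintype J] (R : ℝ) (x x' : Config) : J ⊕ J → boxAlg J R :=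
  Sum.elim (coord R x) (coord R x')

theorem fields_add_smul_left (x x' ζ : Config) (a : ℝ) :
    fields J R (x + a • ζ) x' = fields J R x x' + (a : ℂ) • Sum.elim (coord R ζ) (0 : J → boxAlg J R) := by
  funext i
  cases i with
  | inl j =>
    refine Subtype.ext (funext fun p => ?_)
    exact congrFun (toC_add_smul x ζ a) (p j)
  | inr j => simp [fields]

theorem fields_add_smul_right (x x' η : Config) (b : ℝ) :
    fields J R x (x' + b • η) = fields J R x x' + (b : ℂ) • Sum.elim (0 : J → boxAlg J R) (coord R η) := by
  funext i
  cases i with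
  | inr j =>
    refine Subtype.ext (funext fun p => ?_)
    exact congrFun (toC_add_smul x' η b) (p j)
  | inl j => simp [fields]

/-- The functional of `(x, x̃)` with kernel `Q`. -/
def kernelFn (Q : MvPolynomial (J ⊕ J) (boxAlg J R)) (x x' : Config) : ℂ :=
  boxInt J R (MvPolynomial.eval (fields J R x x') Q)

theorem atPoint_eval_fields (Q : MvPolynomial (J ⊕ J) (boxAlg J R)) (x x' : Config) (p : J → ℝ) :
    atPoint p (MvPolynomial.eval (fields J R x x') Q) =
      MvPolynomial.eval (Sum.elim (fun j => toC x (p j)) fun j => toC x' (p j))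
        (MvPolynomial.map (atPoint p) Q) := by
  have e : (Sum.elim (fun j => toC x (p j)) fun j => toC x' (p j)) =
      fun i => atPoint p (fields J R x x' i) := by
    funext i
    cases i <;> rfl
  rw [e, MvPolynomial.eval_map, MvPolynomial.eval, MvPolynomial.coe_eval₂Hom,
    MvPolynomial.eval₂_comp_left (atPoint p)]
  rfl

/-- Evaluation at `x̃ = 0`. -/
theorem eval_dropTilde {J : Type} (y : J → ℂ) (Q : MvPolynomial (J ⊕ J) ℂ) :
    MvPolynomial.eval y (dropTilde Q) = MvPolynomial.eval (Sum.elim y 0) Q := by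
  rw [dropTilde, MvPolynomial.aeval_def, MvPolynomial.eval₂_eq_eval_map]
  induction Q using MvPolynomial.induction_on with
  | C a => simp
  | add p q hp hq => simp only [map_add, hp, hq]
  | mul_X p i hp =>
    simp only [map_mul, hp, MvPolynomial.map_X, MvPolynomial.eval_X]
    cases i <;> simp

theorem kernelFn_eq_integral (Q : MvPolynomial (J ⊕ J) (boxAlg J R)) (x x' : Config) :
    kernelFn Q x x' = ∫ p, MvPolynomial.eval (Sum.elim (fun j => toC x (p j)) fun j => toC x' (p j))
      (MvPolynomial.map (atPoint p) Q) ∂boxMeasure J R := by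
  unfold kernelFn boxInt
  refine integral_congr_ae (Eventually.of_forall fun p => ?_)
  exact atPoint_eval_fields Q x x' p

/-! ### The marginals of a kernel -/

theorem slab_univ_pos (hR : 0 < R) : slab R univ ≠ 0 := by
  simp [slab, hR]

/-- Replacing the times with indices `j` and `l`. -/
def replace [DecidableEq J] (j l : J) (q : (J → ℝ) × (ℝ × ℝ)) : J → ℝ :=
  Function.update (Function.update q.1 j q.2.1) l q.2.2

theorem measurable_replace {J : Type} [DecidableEq J] (j l : J) : Measurable (replace j l) := by
  refine measurable_pi_iff.2 fun i => ?_
  unfold replace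
  by_cases hl : i = l
  · subst hl
    simpa using measurable_snd.snd
  · by_cases hj : i = j
    · subst hj
      simpa [Function.update_of_ne hl] using measurable_snd.fst
    · simpa [Function.update_of_ne hl, Function.update_of_ne hj] using
        measurable_pi_iff.1 measurable_fst i

/-- Resampling two coordinates independently reproduces the product measure. The two discarded
coordinates contribute the squared mass of the slab, which is divided out. -/
theorem map_replace [DecidableEq J] {j l : J} (hjl : j ≠ l) (hR : 0 < R) :
    boxMeasure J R = (slab R univ ^ 2)⁻¹ •
      ((boxMeasure J R).prod ((slab R).prod (slab R))).map (replace j l) := by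
  have hc0 : slab R univ ^ 2 ≠ 0 := pow_ne_zero _ (slab_univ_pos hR)
  have hct : slab R univ ^ 2 ≠ ⊤ := ENNReal.pow_ne_top (measure_ne_top _ _)
  refine Measure.pi_eq fun s hs => ?_
  have hpre : replace j l ⁻¹' pi univ s =
      (pi univ (Function.update (Function.update s j univ) l univ)) ×ˢ (s j ×ˢ s l) := by
    ext q
    simp only [mem_preimage, Set.mem_pi, mem_univ, true_implies, mem_prod, replace]
    constructor
    · intro h
      refine ⟨fun i => ?_, ?_, ?_⟩
      · by_cases hl : i = l
        · subst hl; simp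
        · by_cases hj : i = j
          · subst hj; simp [Function.update_of_ne hl]
          · simpa [Function.update_of_ne hl, Function.update_of_ne hj] using h i
      · simpa [Function.update_of_ne hjl] using h j
      · simpa using h l
    · rintro ⟨h, hj', hl'⟩ i
      by_cases hl : i = l
      · subst hl; simpa using hl'
      · by_cases hj : i = j
        · subst hj; simpa [Function.update_of_ne hl] using hj'
        · simpa [Function.update_of_ne hl, Function.update_of_ne hj] using h i
  rw [Measure.smul_apply, Measure.map_apply (measurable_replace j l)
    (MeasurableSet.univ_pi hs), hpre, Measure.prod_prod, Measure.prod_prod, boxMeasure,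
    Measure.pi_pi, smul_eq_mul]
  have hl : l ∈ Finset.univ.erase j := Finset.mem_erase.2 ⟨hjl.symm, Finset.mem_univ _⟩
  rw [← Finset.mul_prod_erase Finset.univ _ (Finset.mem_univ j),
    ← Finset.mul_prod_erase (Finset.univ.erase j) _ hl,
    ← Finset.mul_prod_erase Finset.univ (fun i => slab R (s i)) (Finset.mem_univ j),
    ← Finset.mul_prod_erase (Finset.univ.erase j) (fun i => slab R (s i)) hl]
  have hrest : ∏ i ∈ (Finset.univ.erase j).erase l,
      slab R (Function.update (Function.update s j univ) l univ i) =
      ∏ i ∈ (Finset.univ.erase j).erase l, slab R (s i) := by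
    refine Finset.prod_congr rfl fun i hi => ?_
    have h1 := Finset.mem_erase.1 hi
    have h2 := Finset.mem_erase.1 h1.2
    rw [Function.update_of_ne h1.1, Function.update_of_ne h2.1]
  rw [hrest, Function.update_self, Function.update_of_ne hjl, Function.update_self]
  set a := slab R univ
  set P := ∏ i ∈ (Finset.univ.erase j).erase l, slab R (s i)
  calc (a ^ 2)⁻¹ * (a * (a * P) * (slab R (s j) * slab R (s l)))
      = ((a ^ 2)⁻¹ * a ^ 2) * (slab R (s j) * (slab R (s l) * P)) := by ring
    _ = _ := by rw [ENNReal.inv_mul_cancel hc0 hct, one_mul]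

/-- Integrating out the times other than `p j` and `p l` gives the density. In resampled form the
discarded coordinates are integrated as well, which the constant `c` compensates. -/
theorem exists_marginal {j l : J} (hjl : j ≠ l) (hR : 0 < R) (h : boxAlg J R) :
    ∃ d : ℝ × ℝ → ℂ, Integrable d ∧ ∀ (g : ℝ × ℝ → ℂ) (C : ℝ), Measurable g → (∀ z, ‖g z‖ ≤ C) →
      ∫ p, g (p j, p l) * (h : (J → ℝ) → ℂ) p ∂boxMeasure J R = ∫ z, g z * d z := by
  classical
  set c : ENNReal := (slab R univ ^ 2)⁻¹
  have hct : c ≠ ⊤ := ENNReal.inv_ne_top.2 (pow_ne_zero _ (slab_univ_pos hR))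
  set μ := (boxMeasure J R).prod ((slab R).prod (slab R))
  have hμ : boxMeasure J R = c • μ.map (replace j l) := map_replace hjl hR
  have hrm := measurable_replace j l
  have hmeas : Measurable fun q => (h : (J → ℝ) → ℂ) (replace j l q) := h.2.1.comp hrm
  have hint : Integrable (fun q => (h : (J → ℝ) → ℂ) (replace j l q)) μ := by
    have h1 : Integrable (h : (J → ℝ) → ℂ) (c • μ.map (replace j l)) := hμ ▸ integrable_boxAlg h
    have hc0 : c ≠ 0 := ENNReal.inv_ne_zero.2 (ENNReal.pow_ne_top (measure_ne_top _ _))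
    have h2 := (integrable_smul_measure hc0 hct).1 h1
    exact h2.comp_measurable hrm
  have hprod : (slab R).prod (slab R) = volume.restrict (Icc (-R) R ×ˢ Icc (-R) R) := by
    rw [slab, Measure.prod_restrict]
    rfl
  have hms : MeasurableSet (Icc (-R) R ×ˢ Icc (-R) R) := measurableSet_Icc.prod measurableSet_Icc
  refine ⟨(Icc (-R) R ×ˢ Icc (-R) R).indicator fun z =>
    c.toReal • ∫ p, (h : (J → ℝ) → ℂ) (replace j l (p, z)) ∂boxMeasure J R, ?_, ?_⟩
  · rw [integrable_indicator_iff hms, IntegrableOn, ← hprod]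
    exact hint.integral_prod_right.smul c.toReal
  · intro g C hg hC
    have hgp : Measurable fun p : J → ℝ => g (p j, p l) :=
      hg.comp ((measurable_pi_apply j).prodMk (measurable_pi_apply l))
    have e : ∀ q : (J → ℝ) × (ℝ × ℝ), g (replace j l q j, replace j l q l) = g q.2 := fun q => by
      simp [replace, Function.update_of_ne hjl]
    conv_lhs => rw [hμ]
    rw [integral_smul_measure, integral_map (f := fun p => g (p j, p l) * (h : (J → ℝ) → ℂ) p)
      hrm.aemeasurable (hgp.mul h.2.1).aestronglyMeasurable]
    simp only [e]
    have hint2 : Integrable (fun q : (J → ℝ) × (ℝ × ℝ) =>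
        g q.2 * (h : (J → ℝ) → ℂ) (replace j l q)) μ :=
      hint.bdd_mul (c := C) (hg.comp measurable_snd).aestronglyMeasurable
        (Eventually.of_forall fun q => hC _)
    rw [integral_prod_symm _ hint2, hprod, ← integral_indicator hms, ← integral_smul]
    congr 1
    funext z
    by_cases hz : z ∈ Icc (-R) R ×ˢ Icc (-R) R
    · rw [indicator_of_mem hz, indicator_of_mem hz]
      change c.toReal • ∫ p, g z * (h : (J → ℝ) → ℂ) (replace j l (p, z)) ∂boxMeasure J R = _
      rw [integral_const_mul]
      simp only [Complex.real_smul]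
      ring
    · rw [indicator_of_notMem hz, indicator_of_notMem hz, smul_zero, mul_zero]

/-! ### Differentiation of the marginals -/

/-- Lebesgue differentiation in the plane: products of mollifiers are supported in sup-norm balls of
radius `2 / (n + 1)` and bounded by a constant over their volume. Since only integrability of `d` is
used, the jumps of the kernels at coinciding times do no harm. -/
theorem ae_tendsto_integral_approxDelta {d : ℝ × ℝ → ℂ} (hd : Integrable d) :
    ∀ᵐ z : ℝ × ℝ, Tendsto (fun n => ∫ w, (toC (approxDelta z.1 n) w.1 *
      toC (approxDelta z.2 n) w.2) * d w) atTop (𝓝 (d z)) := by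
  have hL := IsUnifLocDoublingMeasure.ae_tendsto_average_norm_sub
    (μ := (volume : Measure (ℝ × ℝ))) hd.locallyIntegrable 1
  filter_upwards [hL] with z hz
  have hr : ∀ n : ℕ, (0 : ℝ) < 2 / ((n : ℝ) + 1) := fun n => by positivity
  have hlim : Tendsto (fun n : ℕ => 2 / ((n : ℝ) + 1)) atTop (𝓝[>] 0) :=
    tendsto_nhdsWithin_iff.2 ⟨(isMollifier_approxDelta 0).tendsto, Eventually.of_forall hr⟩
  have h1 := hz (fun _ : ℕ => z) (fun n => 2 / ((n : ℝ) + 1)) hlim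
    (Eventually.of_forall fun n => Metric.mem_closedBall_self (by have := hr n; linarith))
  have hm1 := isMollifier_approxDelta z.1
  have hm2 := isMollifier_approxDelta z.2
  -- The constant is `4 = 2 · 2`, one factor for the ratio of outer to inner radius of each
  -- mollifier.
  have h2 := tendsto_integral_smul_of_tendsto_average_norm_sub
    (g := fun n (w : ℝ × ℝ) => (approxDelta z.1 n : ℝ → ℝ) w.1 * (approxDelta z.2 n : ℝ → ℝ) w.2) 4 h1
    (Eventually.of_forall fun n => hd.integrableOn) ?_ ?_ ?_
  · refine h2.congr fun n => ?_
    refine integral_congr_ae (Eventually.of_forall fun w => ?_)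
    simp [toC]
  · refine tendsto_const_nhds.congr fun n => ?_
    have := integral_prod_mul (μ := (volume : Measure ℝ)) (ν := (volume : Measure ℝ))
      (approxDelta z.1 n : ℝ → ℝ) (approxDelta z.2 n : ℝ → ℝ)
    rw [hm1.integral_eq, hm2.integral_eq, one_mul] at this
    exact this.symm
  · refine Eventually.of_forall fun n w hw => ?_
    have hw1 := left_ne_zero_of_mul hw
    have hw2 := right_ne_zero_of_mul hw
    rw [Metric.mem_closedBall, Prod.dist_eq]
    refine max_le ?_ ?_
    · by_contra! hlt
      exact hw1 (hm1.eq_zero n w.1 hlt.le)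
    · by_contra! hlt
      exact hw2 (hm2.eq_zero n w.2 hlt.le)
  · have hb : ∀ (t s : ℝ) (n : ℕ), (approxDelta t n : ℝ → ℝ) s ≤
        2 / (volume : Measure ℝ).real (Metric.closedBall t (2 / ((n : ℝ) + 1))) := by
      intro t s n
      have hpos : (0 : ℝ) < (n : ℝ) + 1 := by positivity
      let φ : ContDiffBump t :=
        { rIn := 1 / ((n : ℝ) + 1)
          rOut := 2 / ((n : ℝ) + 1)
          rIn_pos := by positivity
          rIn_lt_rOut := (div_lt_div_iff_of_pos_right hpos).2 one_lt_two }
      have := φ.normed_le_div_measure_closedBall_rOut volume 2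
        (show 2 / ((n : ℝ) + 1) ≤ 2 * (1 / ((n : ℝ) + 1)) by rw [mul_one_div]) s
      rw [Module.finrank_self, pow_one] at this
      exact this
    refine Eventually.of_forall fun n w => ?_
    rw [abs_of_nonneg (mul_nonneg (hm1.nonneg n _) (hm2.nonneg n _))]
    have hv : (volume : Measure (ℝ × ℝ)).real (Metric.closedBall z (2 / ((n : ℝ) + 1))) =
        (volume : Measure ℝ).real (Metric.closedBall z.1 (2 / ((n : ℝ) + 1))) *
        (volume : Measure ℝ).real (Metric.closedBall z.2 (2 / ((n : ℝ) + 1))) := by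
      rw [← measureReal_prod_prod, closedBall_prod_same]
      rfl
    rw [hv, show (4 : ℝ) = 2 * 2 by norm_num, mul_div_mul_comm]
    exact mul_le_mul (hb _ _ _) (hb _ _ _) (hm2.nonneg n _) (by positivity)

/-- For `j ≠ l` this is differentiation of the marginal. For `j = l` the second derivative is
concentrated on the diagonal: wherever the propagator is nonzero the two points differ, the
mollifiers eventually have disjoint supports, and the density `0` matches the vanishing propagator
at equal times. -/
theorem exists_kernel_density (hR : 0 < R) (j l : J) (h : boxAlg J R) :
    ∃ d : ℝ × ℝ → ℂ, Integrable d ∧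
      (∀ᵐ z : ℝ × ℝ, G z.1 z.2 ≠ 0 → Tendsto (fun n => boxInt J R
        (coord R (approxDelta z.1 n) j * coord R (approxDelta z.2 n) l * h)) atTop (𝓝 (d z))) ∧
      boxInt J R (propCoeff R j l * h) = ∫ z : ℝ × ℝ, (G z.1 z.2 : ℂ) * d z := by
  by_cases hjl : j = l
  · subst hjl
    refine ⟨0, integrable_zero _ _ _, Eventually.of_forall fun z hz => ?_, ?_⟩
    · refine tendsto_const_nhds.congr' ?_
      have hlt : z.2 < z.1 := by
        by_contra! hle
        exact hz (G_of_le hle)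
      -- Radii below half of the gap between the two points make the supports disjoint.
      have hm := (isMollifier_approxDelta 0).tendsto.eventually
        (gt_mem_nhds (show (0 : ℝ) < (z.1 - z.2) / 2 by linarith))
      filter_upwards [hm] with n hn
      have : coord R (approxDelta z.1 n) j * coord R (approxDelta z.2 n) j * h = 0 := by
        refine Subtype.ext (funext fun p => ?_)
        change toC (approxDelta z.1 n) (p j) * toC (approxDelta z.2 n) (p j) * _ = (0 : ℂ)
        by_cases hp : 2 / ((n : ℝ) + 1) ≤ |p j - z.1|
        · have := (isMollifier_approxDelta z.1).eq_zero n (p j) hp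
          simp [toC, this]
        · have := (isMollifier_approxDelta z.2).eq_zero n (p j) (by
            have h1 := abs_sub_abs_le_abs_sub (z.1 - z.2) (z.1 - p j)
            rw [abs_sub_comm z.1 (p j)] at h1
            rw [abs_of_pos (by linarith : 0 < z.1 - z.2)] at h1
            rw [show p j - z.2 = z.1 - z.2 - (z.1 - p j) by ring]
            push Not at hp
            linarith)
          simp [toC, this]
      rw [this, map_zero]
      rfl
    · have : propCoeff R j j * h = 0 := by
        refine Subtype.ext (funext fun p => ?_)
        change (prop p j j) * _ = (0 : ℂ)
        simp [prop]
      rw [this, map_zero]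
      simp
  · obtain ⟨d, hd, hg⟩ := exists_marginal hjl hR h
    refine ⟨d, hd, ?_, hg (fun z => (G z.1 z.2 : ℂ)) 1
      (measurable_ofReal_G measurable_fst measurable_snd) fun z => norm_G_le _ _⟩
    filter_upwards [ae_tendsto_integral_approxDelta hd] with z hz _
    refine hz.congr fun n => ?_
    have hbd : ∀ (t : ℝ), ∃ C, ∀ s, ‖toC (approxDelta t n) s‖ ≤ C := fun t => by
      have hcs : HasCompactSupport (toC (approxDelta t n)) :=
        HasCompactSupport.intro (isCompact_Icc (a := t - 2 / ((n : ℝ) + 1))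
          (b := t + 2 / ((n : ℝ) + 1))) fun s hs => by
          have := (isMollifier_approxDelta t).eq_zero n s (by
            by_contra! hlt
            rw [abs_lt] at hlt
            exact hs ⟨by linarith, by linarith⟩)
          simp [toC, this]
      exact (continuous_toC _).bounded_above_of_compact_support hcs
    obtain ⟨C, hC⟩ := hbd z.1
    obtain ⟨C', hC'⟩ := hbd z.2
    refine (hg (fun w => toC (approxDelta z.1 n) w.1 * toC (approxDelta z.2 n) w.2) (C * C')
      (((measurable_toC _).comp measurable_fst).mul ((measurable_toC _).comp measurable_snd))
      fun w => ?_).symm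
    rw [norm_mul]
    exact mul_le_mul (hC _) (hC' _) (norm_nonneg _) ((norm_nonneg _).trans (hC w.1))

/-! ### The contraction of smeared kernels -/

/-- `Ψ'` is the contraction of `Ψ` with the propagator. -/
def HasUpsilonG (Ψ Ψ' : Config → Config → ℂ) : Prop :=
  ∃ (D : Config → Config → Config → ℂ) (E : Config → Config → Config → Config → ℂ)
    (d : Config → Config → ℝ × ℝ → ℂ),
    (∀ η x x', HasDerivAt (fun b : ℝ => Ψ x (x' + b • η)) (D η x x') 0) ∧
    (∀ ζ η x x', HasDerivAt (fun a : ℝ => D η (x + a • ζ) x') (E ζ η x x') 0) ∧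
    (∀ x x', ∀ᵐ z : ℝ × ℝ, G z.1 z.2 ≠ 0 → Tendsto (fun n =>
      E (approxDelta z.1 n) (approxDelta z.2 n) x x') atTop (𝓝 (d x x' z))) ∧
    (∀ x x', Integrable (d x x')) ∧ ∀ x x', Ψ' x x' = ∫ z : ℝ × ℝ, (G z.1 z.2 : ℂ) * d x x' z

theorem HasUpsilonG.upsilonG_eq {Ψ Ψ' : Config → Config → ℂ} (h : HasUpsilonG Ψ Ψ') :
    upsilonG Ψ = Ψ' := by
  obtain ⟨D, E, d, hD, hE, hlim, _, hΨ'⟩ := h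
  funext x x'
  rw [upsilonG, hΨ']
  refine integral_congr_ae ?_
  filter_upwards [hlim x x'] with z hz
  by_cases hG : G z.1 z.2 = 0
  · simp [hG]
  · congr 1
    unfold mixedDeriv
    have e : ∀ n, deriv (fun a : ℝ => deriv (fun b : ℝ =>
        Ψ (x + a • approxDelta z.1 n) (x' + b • approxDelta z.2 n)) 0) 0 =
        E (approxDelta z.1 n) (approxDelta z.2 n) x x' := fun n => by
      simp only [(hD _ _ _).deriv, (hE _ _ _ _).deriv]
    simp only [e]
    exact (hz hG).limUnder_eq

theorem HasUpsilonG.zero : HasUpsilonG 0 0 :=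
  ⟨0, 0, 0, fun _ _ _ => hasDerivAt_const _ _, fun _ _ _ _ => hasDerivAt_const _ _,
    fun _ _ => Eventually.of_forall fun _ _ => tendsto_const_nhds,
    fun _ _ => integrable_zero _ _ _, by simp⟩

theorem integrable_G_prod_mul {d : ℝ × ℝ → ℂ} (hd : Integrable d) :
    Integrable fun z : ℝ × ℝ => (G z.1 z.2 : ℂ) * d z :=
  hd.bdd_mul (c := 1) (measurable_ofReal_G measurable_fst measurable_snd).aestronglyMeasurable
    (Eventually.of_forall fun _ => norm_G_le _ _)

theorem HasUpsilonG.add {Φ Φ' Ψ Ψ' : Config → Config → ℂ} (h : HasUpsilonG Φ Φ')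
    (h' : HasUpsilonG Ψ Ψ') : HasUpsilonG (Φ + Ψ) (Φ' + Ψ') := by
  obtain ⟨D, E, d, h1, h2, h3, h4, h5⟩ := h
  obtain ⟨D', E', d', h1', h2', h3', h4', h5'⟩ := h'
  refine ⟨D + D', E + E', d + d', fun η x x' => (h1 η x x').add (h1' η x x'),
    fun ζ η x x' => (h2 ζ η x x').add (h2' ζ η x x'), fun x x' => ?_,
    fun x x' => (h4 x x').add (h4' x x'), fun x x' => ?_⟩
  · filter_upwards [h3 x x', h3' x x'] with z hz hz' hG
    exact (hz hG).add (hz' hG)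
  · simp only [Pi.add_apply, h5, h5', mul_add]
    rw [integral_add (integrable_G_prod_mul (h4 x x')) (integrable_G_prod_mul (h4' x x'))]

theorem HasUpsilonG.wordSum {Φ Φ' : List Letter → Config → Config → ℂ} (l : List (List Letter))
    (h : ∀ w ∈ l, HasUpsilonG (Φ w) (Φ' w)) : HasUpsilonG (wordSum Φ l) (wordSum Φ' l) := by
  induction l with
  | nil => exact HasUpsilonG.zero
  | cons w l ih =>
    rw [wordSum_cons, wordSum_cons]
    exact (h w (by simp)).add (ih fun v hv => h v (by simp [hv]))

/-- The mixed derivative is a sum over pairs of times of the kernel of `∂²Q / ∂x(j) ∂x̃(l)` smeared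
with one mollifier at each of the two times. Its limit against `G` multiplies this kernel by the
propagator, which is what `contract` does. -/
theorem hasUpsilonG_kernelFn (hR : 0 < R) (Q : MvPolynomial (J ⊕ J) (boxAlg J R)) :
    HasUpsilonG (kernelFn Q) (kernelFn (contract (propCoeff R) Q)) := by
  set H : Config → Config → J → J → boxAlg J R := fun x x' j l =>
    MvPolynomial.eval (fields J R x x')
      (MvPolynomial.pderiv (Sum.inl j) (MvPolynomial.pderiv (Sum.inr l) Q))
  have hdens := fun x x' j l => exists_kernel_density hR j l (H x x' j l)
  choose d hd hlim hint using hdens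
  refine ⟨fun η x x' => boxInt J R (MvPolynomial.eval (fields J R x x')
      (linDer (Sum.elim (0 : J → boxAlg J R) (coord R η)) Q)),
    fun ζ η x x' => boxInt J R (MvPolynomial.eval (fields J R x x')
      (linDer (Sum.elim (coord R ζ) (0 : J → boxAlg J R))
        (linDer (Sum.elim (0 : J → boxAlg J R) (coord R η)) Q))),
    fun x x' => ∑ l, ∑ j, d x x' j l, fun η x x' => ?_, fun ζ η x x' => ?_, fun x x' => ?_,
    fun x x' => integrable_finsetSum' _ fun l _ => integrable_finsetSum' _ fun j _ => hd x x' j l,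
    fun x x' => ?_⟩
  · simp only [kernelFn, fields_add_smul_right]
    exact hasDerivAt_eval_add_smul _ _ _ _
  · simp only [fields_add_smul_left]
    exact hasDerivAt_eval_add_smul _ _ _ _
  · have hall : ∀ᵐ z : ℝ × ℝ, ∀ l j, G z.1 z.2 ≠ 0 → Tendsto (fun n => boxInt J R
        (coord R (approxDelta z.1 n) j * coord R (approxDelta z.2 n) l * H x x' j l)) atTop
        (𝓝 (d x x' j l z)) := by
      rw [ae_all_iff]
      intro l
      rw [ae_all_iff]
      exact fun j => hlim x x' j l
    filter_upwards [hall] with z hz hG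
    simp only [Finset.sum_apply]
    have e : ∀ ζ η : Config, boxInt J R (MvPolynomial.eval (fields J R x x')
        (linDer (Sum.elim (coord R ζ) (0 : J → boxAlg J R))
          (linDer (Sum.elim (0 : J → boxAlg J R) (coord R η)) Q))) =
        ∑ l, ∑ j, boxInt J R (coord R ζ j * coord R η l * H x x' j l) := fun ζ η => by
      rw [linDer_apply _ Q, Fintype.sum_sum_type]
      simp only [Sum.elim_inl, Sum.elim_inr, Pi.zero_apply, zero_smul, Finset.sum_const_zero,
        zero_add, map_sum, Derivation.map_smul]
      refine Finset.sum_congr rfl fun l _ => ?_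
      rw [linDer_apply, Fintype.sum_sum_type]
      simp only [Sum.elim_inl, Sum.elim_inr, Pi.zero_apply, zero_smul, Finset.sum_const_zero,
        add_zero, Finset.smul_sum, map_sum, smul_smul, MvPolynomial.smul_eval, H]
      refine Finset.sum_congr rfl fun j _ => ?_
      rw [mul_comm (coord R η l)]
    simp only [e]
    exact tendsto_finsetSum _ fun l _ => tendsto_finsetSum _ fun j _ => hz l j hG
  · rw [kernelFn, contract_eq_sum]
    simp only [Finset.sum_apply, Finset.mul_sum, map_sum, MvPolynomial.smul_eval]
    rw [integral_finsetSum _ fun l _ => integrable_finsetSum _ fun j _ =>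
      integrable_G_prod_mul (hd x x' j l)]
    refine Finset.sum_congr rfl fun l _ => ?_
    rw [integral_finsetSum _ fun j _ => integrable_G_prod_mul (hd x x' j l)]
    exact Finset.sum_congr rfl fun j _ => hint x x' j l

theorem iterate_upsilonG_wordSum (hR : 0 < R) {J : List Letter → Type} [∀ w, Fintype (J w)]
    (l : List (List Letter)) (n : ℕ) : ∀ Q : ∀ w, MvPolynomial (J w ⊕ J w) (boxAlg (J w) R),
    upsilonG^[n] (wordSum (fun w => kernelFn (Q w)) l) =
      wordSum (fun w => kernelFn ((contract (propCoeff R))^[n] (Q w))) l := by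
  induction n with
  | zero => intro Q; rfl
  | succ n ih =>
    intro Q
    rw [Function.iterate_succ_apply, (HasUpsilonG.wordSum l fun w _ =>
      hasUpsilonG_kernelFn hR (Q w)).upsilonG_eq, ih]
    rfl

theorem map_iterate_contract (Q : MvPolynomial (J ⊕ J) (boxAlg J R)) (p : J → ℝ) (n : ℕ) :
    MvPolynomial.map (atPoint p) ((contract (propCoeff R))^[n] Q) =
      (contract (prop p))^[n] (MvPolynomial.map (atPoint p) Q) := by
  induction n with
  | zero => rfl
  | succ n ih =>
    rw [Function.iterate_succ_apply', map_contract, ih, Function.iterate_succ_apply']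
    rfl

theorem integrable_eval_map (Q : MvPolynomial (J ⊕ J) (boxAlg J R)) (x x' : Config) :
    Integrable (fun p => MvPolynomial.eval (Sum.elim (fun j => toC x (p j)) fun j => toC x' (p j))
      (MvPolynomial.map (atPoint p) Q)) (boxMeasure J R) := by
  refine (integrable_boxAlg (MvPolynomial.eval (fields J R x x') Q)).congr
    (Eventually.of_forall fun p => ?_)
  exact atPoint_eval_fields Q x x' p

/-- The value of `Γ_G` on a sum of functionals with kernels whose contractions of order at least
`M` vanish. -/
theorem gammaG_wordSum (hR : 0 < R) {J : List Letter → Type} [∀ w, Fintype (J w)]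
    (l : List (List Letter)) (Q : ∀ w, MvPolynomial (J w ⊕ J w) (boxAlg (J w) R)) (M : ℕ)
    (hM : ∀ w ∈ l, ∀ p, ∀ n, M ≤ n →
      (contract (prop p))^[n] (MvPolynomial.map (atPoint p) (Q w)) = 0) (x₀ : Config) :
    gammaG (wordSum (fun w => kernelFn (Q w)) l) x₀ 0 = wordSum (fun w => ∫ p,
      MvPolynomial.eval (fun j => toC x₀ (p j)) (∑ n ∈ Finset.range M, ((n.factorial : ℂ))⁻¹ •
        dropTilde ((contract (prop p))^[n] (MvPolynomial.map (atPoint p) (Q w))))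
      ∂boxMeasure (J w) R) l := by
  have hval : ∀ n, (upsilonG^[n] (wordSum (fun w => kernelFn (Q w)) l)) x₀ 0 =
      wordSum (fun w => ∫ p, MvPolynomial.eval (fun j => toC x₀ (p j))
        (dropTilde ((contract (prop p))^[n] (MvPolynomial.map (atPoint p) (Q w))))
        ∂boxMeasure (J w) R) l := fun n => by
    rw [iterate_upsilonG_wordSum hR, wordSum_apply, wordSum_apply]
    refine wordSum_congr fun w _ => ?_
    rw [kernelFn_eq_integral]
    simp only [map_iterate_contract, eval_dropTilde]
    rfl
  have hsum : ∀ n ∉ Finset.range M, ((n.factorial : ℂ))⁻¹ *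
      (upsilonG^[n] (wordSum (fun w => kernelFn (Q w)) l)) x₀ 0 = 0 := fun n hn => by
    rw [hval, wordSum_eq_zero, mul_zero]
    intro w hw
    simp only [hM w hw _ n (by simpa using hn), map_zero, integral_zero]
  rw [gammaG, tsum_eq_sum hsum]
  simp only [hval]
  clear hM hsum hval
  induction l with
  | nil => simp
  | cons w l ih =>
    simp only [wordSum_cons, mul_add, Finset.sum_add_distrib, ih]
    congr 1
    simp only [map_sum, MvPolynomial.smul_eval]
    have hi : ∀ n, Integrable (fun p => MvPolynomial.eval (fun j => toC x₀ (p j))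
        (dropTilde ((contract (prop p))^[n] (MvPolynomial.map (atPoint p) (Q w)))))
        (boxMeasure (J w) R) := fun n => by
      refine (integrable_eval_map ((contract (propCoeff R))^[n] (Q w)) x₀ 0).congr
        (Eventually.of_forall fun p => ?_)
      simp only [map_iterate_contract, eval_dropTilde]
      rfl
    rw [integral_finsetSum _ fun n _ => (hi n).const_mul _]
    exact Finset.sum_congr rfl fun n _ => (integral_const_mul _ _).symm

end MSR
end
noncomputable section
namespace MSR

open MeasureTheory Filter Topology Set Letter

/-! ### The expansion of the exponential of the interaction -/

theorem polyIn_ofReal (γ : Polynomial Config) (s x : ℝ) :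
    polyIn γ s (x : ℂ) = (polyEval γ x s : ℂ) := by
  have h := Polynomial.hom_eval₂ γ (evalAt s) Complex.ofRealHom x
  rw [polyIn, Polynomial.aeval_def, Polynomial.eval₂_map]
  exact h.symm

theorem continuous_polyIn_toC (γ : Polynomial Config) (x : Config) :
    Continuous fun s => polyIn γ s (toC x s) := by
  induction γ using Polynomial.induction_on' with
  | add p q hp hq =>
    have : ∀ t, polyIn (p + q) t (toC x t) = polyIn p t (toC x t) + polyIn q t (toC x t) :=
      fun t => by simp [polyIn, Polynomial.map_add]
    simp only [this]
    exact hp.add hq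
  | monomial j y =>
    have : ∀ t, polyIn (Polynomial.monomial j y) t (toC x t) = toC y t * toC x t ^ j :=
      fun t => by
        simp only [polyIn, Polynomial.map_monomial, Polynomial.aeval_monomial]
        rfl
    simp only [this]
    exact (continuous_toC y).mul ((continuous_toC x).pow j)

namespace Model

variable (m : Model)

/-- The value of a vertex at time `s` on the fields `(x, x̃)`. -/
def vertexValue (x x' : Config) (a : Letter) (s : ℝ) : ℂ :=
  toC x' s * m.lin a s (toC x s) + toC x' s * (toC x' s * m.quad a s (toC x s))

theorem continuous_vertexValue (x x' : Config) (a : Letter) :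
    Continuous (m.vertexValue x x' a) := by
  have hχ : Continuous fun s => (m.χ s : ℂ) := Complex.continuous_ofReal.comp m.continuous
  have hp := fun γ => continuous_polyIn_toC γ x
  have hx := continuous_toC x'
  have hl : Continuous fun s => m.lin a s (toC x s) := by
    cases a
    · exact hχ.smul (hp _)
    · exact (continuous_const.mul hχ).smul (hp _)
    · exact (continuous_const.mul (hχ.pow 2)).smul ((hp _).mul (hp _))
  have hq : Continuous fun s => m.quad a s (toC x s) := by
    cases a
    · exact continuous_const
    · exact continuous_const
    · exact (continuous_const.mul (hχ.pow 2)).smul ((hp _).pow 2)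
  exact (hx.mul hl).add (hx.mul (hx.mul hq))

theorem vertexValue_eq_zero (x x' : Config) (a : Letter) {s : ℝ} (hs : m.R ≤ |s|) :
    m.vertexValue x x' a s = 0 := by
  have h := m.χ_eq_zero s hs
  simp [vertexValue, m.lin_eq_zero a _ h, m.quad_eq_zero a _ h]

theorem exists_norm_vertexValue_le (x x' : Config) (a : Letter) :
    ∃ C, ∀ s, ‖m.vertexValue x x' a s‖ ≤ C :=
  m.exists_norm_le_of_χ (m.continuous_vertexValue x x' a) fun s hs => by
    simp [vertexValue, m.lin_eq_zero a _ hs, m.quad_eq_zero a _ hs]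

/-- The integral of a vertex over the times before `τ`. -/
def vertexInt (x x' : Config) (a : Letter) (τ : ℝ) : ℂ :=
  ∫ s in (-m.R)..τ, m.vertexValue x x' a s

theorem integral_vertexValue (x x' : Config) (a : Letter) :
    ∫ s, m.vertexValue x x' a s = m.vertexInt x x' a m.R := by
  rw [vertexInt, intervalIntegral.integral_of_le (by linarith [m.R_pos]),
    setIntegral_eq_integral_of_forall_compl_eq_zero]
  intro s hs
  refine m.vertexValue_eq_zero x x' a ?_
  by_contra! h
  rw [abs_lt] at h
  exact hs ⟨h.1, h.2.le⟩

/-- The interaction restricted to the times before `τ`, at fixed fields. -/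
def interactionAt (x x' : Config) (τ : ℝ) : PowerSeries ℂ :=
  PowerSeries.X * PowerSeries.C (m.vertexInt x x' drift τ) +
    PowerSeries.X ^ 2 * PowerSeries.C (m.vertexInt x x' pair τ)

theorem map_interaction (x x' : Config) :
    (interaction m.χ m.σ m.α m.β).map ((Pi.evalRingHom (fun _ : Config => ℂ) x').comp
      (Pi.evalRingHom (fun _ : Config => Config → ℂ) x)) = m.interactionAt x x' m.R := by
  rw [interaction, interactionAt, ← integral_vertexValue, ← integral_vertexValue]
  simp only [map_add, map_mul, map_pow, PowerSeries.map_X, PowerSeries.map_C, RingHom.comp_apply,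
    Pi.evalRingHom_apply]
  congr 3
  · rw [← integral_complex_ofReal]
    congr 1
    funext s
    simp only [vertexValue, lin, quad, toC, polyIn_ofReal, smul_eq_mul]
    push_cast
    ring
  · rw [← integral_complex_ofReal]
    congr 1
    funext s
    simp only [vertexValue, lin, quad, toC, polyIn_ofReal, smul_eq_mul]
    push_cast
    ring

/-- The coefficient of order `N` of the exponential of `interactionAt`. -/
def expCoeff (x x' : Config) (N : ℕ) (τ : ℝ) : ℂ :=
  ∑ n ∈ Finset.range (N + 1), ((n.factorial : ℂ))⁻¹ *
    PowerSeries.coeff N (m.interactionAt x x' τ ^ n)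

theorem coeff_formalExp (x x' : Config) (N : ℕ) :
    PowerSeries.coeff N (formalExp (interaction m.χ m.σ m.α m.β)) x x' =
      m.expCoeff x x' N m.R := by
  rw [formalExp, PowerSeries.coeff_mk, expCoeff, ← map_interaction]
  simp only [Finset.sum_apply, Pi.smul_apply, smul_eq_mul, ← map_pow, PowerSeries.coeff_map]
  rfl

end Model

theorem hasDerivAt_coeff_pow {Z : ℝ → PowerSeries ℂ} {Z' : PowerSeries ℂ} {τ : ℝ}
    (h : ∀ N, HasDerivAt (fun t => PowerSeries.coeff N (Z t)) (PowerSeries.coeff N Z') τ) (n : ℕ) :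
    ∀ N, HasDerivAt (fun t => PowerSeries.coeff N (Z t ^ (n + 1)))
      (PowerSeries.coeff N (((n + 1 : ℕ) : ℂ) • (Z τ ^ n * Z'))) τ := by
  induction n with
  | zero => simpa using h
  | succ n ih =>
    intro N
    have e : ∀ t, PowerSeries.coeff N (Z t ^ (n + 1 + 1)) =
        ∑ q ∈ Finset.HasAntidiagonal.antidiagonal N,
          PowerSeries.coeff q.1 (Z t ^ (n + 1)) * PowerSeries.coeff q.2 (Z t) := fun t => by
      rw [pow_succ, PowerSeries.coeff_mul]
    simp only [e]
    have h1 : HasDerivAt (fun t => ∑ q ∈ Finset.HasAntidiagonal.antidiagonal N,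
        PowerSeries.coeff q.1 (Z t ^ (n + 1)) * PowerSeries.coeff q.2 (Z t))
        (∑ q ∈ Finset.HasAntidiagonal.antidiagonal N,
          (PowerSeries.coeff q.1 (((n + 1 : ℕ) : ℂ) • (Z τ ^ n * Z')) *
            PowerSeries.coeff q.2 (Z τ) +
          PowerSeries.coeff q.1 (Z τ ^ (n + 1)) * PowerSeries.coeff q.2 Z')) τ :=
      HasDerivAt.fun_sum fun q _ => (ih q.1).mul (h q.2)
    convert h1 using 1
    rw [Finset.sum_add_distrib, ← PowerSeries.coeff_mul, ← PowerSeries.coeff_mul, ← map_add]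
    congr 1
    push_cast
    rw [smul_mul_assoc, add_smul, one_smul, pow_succ]
    congr 2
    ring

namespace Model

variable (m : Model)

theorem hasDerivAt_vertexInt (x x' : Config) (a : Letter) (τ : ℝ) :
    HasDerivAt (m.vertexInt x x' a) (m.vertexValue x x' a τ) τ :=
  intervalIntegral.integral_hasDerivAt_right
    ((m.continuous_vertexValue x x' a).intervalIntegrable _ _)
    (m.continuous_vertexValue x x' a).aestronglyMeasurable.stronglyMeasurableAtFilter
    (m.continuous_vertexValue x x' a).continuousAt

theorem hasDerivAt_coeff_interactionAt (x x' : Config) (τ : ℝ) (N : ℕ) :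
    HasDerivAt (fun t => PowerSeries.coeff N (m.interactionAt x x' t))
      (PowerSeries.coeff N (PowerSeries.X * PowerSeries.C (m.vertexValue x x' drift τ) +
        PowerSeries.X ^ 2 * PowerSeries.C (m.vertexValue x x' pair τ))) τ := by
  simp only [interactionAt, map_add, mul_comm (PowerSeries.X ^ _), mul_comm PowerSeries.X,
    PowerSeries.coeff_C_mul]
  exact ((m.hasDerivAt_vertexInt x x' drift τ).mul_const _).add
    ((m.hasDerivAt_vertexInt x x' pair τ).mul_const _)

theorem X_pow_dvd_interactionAt_pow (x x' : Config) (τ : ℝ) (n : ℕ) :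
    PowerSeries.X ^ n ∣ m.interactionAt x x' τ ^ n :=
  pow_dvd_pow_of_dvd ⟨PowerSeries.C (m.vertexInt x x' drift τ) +
    PowerSeries.X * PowerSeries.C (m.vertexInt x x' pair τ), by rw [interactionAt]; ring⟩ n

/-- This is `(e^V)' = e^V V'`, coefficient by coefficient. The constant term of the exponential
drops out, the index shifts by one, and a factor of `X` taken out of `V'` lowers the order. -/
theorem hasDerivAt_expCoeff (x x' : Config) (N : ℕ) (τ : ℝ) :
    HasDerivAt (m.expCoeff x x' (N + 1)) (∑ n ∈ Finset.range (N + 1), ((n.factorial : ℂ))⁻¹ *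
      PowerSeries.coeff N (m.interactionAt x x' τ ^ n *
        (PowerSeries.C (m.vertexValue x x' drift τ) +
          PowerSeries.X * PowerSeries.C (m.vertexValue x x' pair τ)))) τ := by
  have e : m.expCoeff x x' (N + 1) = fun t => ∑ n ∈ Finset.range (N + 1),
      (((n + 1).factorial : ℂ))⁻¹ *
        PowerSeries.coeff (N + 1) (m.interactionAt x x' t ^ (n + 1)) := by
    funext t
    rw [expCoeff, Finset.sum_range_succ']
    simp [PowerSeries.coeff_one]
  rw [e]
  refine HasDerivAt.fun_sum fun n _ => ?_
  have h := (hasDerivAt_coeff_pow (m.hasDerivAt_coeff_interactionAt x x' τ) n (N + 1)).const_mul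
    (((n + 1).factorial : ℂ))⁻¹
  refine h.congr_deriv ?_
  have e2 : m.interactionAt x x' τ ^ n * (PowerSeries.X * PowerSeries.C
      (m.vertexValue x x' drift τ) + PowerSeries.X ^ 2 * PowerSeries.C
      (m.vertexValue x x' pair τ)) = PowerSeries.X * (m.interactionAt x x' τ ^ n *
        (PowerSeries.C (m.vertexValue x x' drift τ) +
          PowerSeries.X * PowerSeries.C (m.vertexValue x x' pair τ))) := by ring
  have hn : ((n + 1 : ℕ) : ℂ) ≠ 0 := by exact_mod_cast Nat.succ_ne_zero n
  rw [e2, map_smul, PowerSeries.coeff_succ_X_mul, Nat.factorial_succ, Nat.cast_mul, mul_inv,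
    smul_eq_mul]
  field_simp

theorem expCoeff_zero (x x' : Config) (τ : ℝ) : m.expCoeff x x' 0 τ = 1 := by
  simp [expCoeff]

theorem expCoeff_succ_neg_R (x x' : Config) (N : ℕ) : m.expCoeff x x' (N + 1) (-m.R) = 0 := by
  have h : m.interactionAt x x' (-m.R) = 0 := by simp [interactionAt, vertexInt]
  rw [expCoeff, h, Finset.sum_eq_zero]
  intro n _
  cases n <;> simp [PowerSeries.coeff_one]

theorem hasDerivAt_expCoeff_one (x x' : Config) (τ : ℝ) :
    HasDerivAt (m.expCoeff x x' 1) (m.vertexValue x x' drift τ) τ := by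
  simpa using m.hasDerivAt_expCoeff x x' 0 τ

/-- The recursion over `N + 1` and `N` mirrors that of `freeWords`, with `drift` or `pair` as the
latest vertex. -/
theorem hasDerivAt_expCoeff_add_two (x x' : Config) (N : ℕ) (τ : ℝ) :
    HasDerivAt (m.expCoeff x x' (N + 2)) (m.vertexValue x x' drift τ * m.expCoeff x x' (N + 1) τ +
      m.vertexValue x x' pair τ * m.expCoeff x x' N τ) τ := by
  convert m.hasDerivAt_expCoeff x x' (N + 1) τ using 1
  have e : ∀ n, PowerSeries.coeff (N + 1) (m.interactionAt x x' τ ^ n *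
        (PowerSeries.C (m.vertexValue x x' drift τ) +
          PowerSeries.X * PowerSeries.C (m.vertexValue x x' pair τ))) =
      m.vertexValue x x' drift τ * PowerSeries.coeff (N + 1) (m.interactionAt x x' τ ^ n) +
      m.vertexValue x x' pair τ * PowerSeries.coeff N (m.interactionAt x x' τ ^ n) := fun n => by
    rw [mul_add, mul_comm _ (PowerSeries.C _), mul_left_comm, mul_comm _ (PowerSeries.C _),
      map_add, PowerSeries.coeff_C_mul, PowerSeries.coeff_succ_X_mul, PowerSeries.coeff_C_mul]
  -- The order-`N` part would include `n = N + 1`, one power more than `expCoeff` at order `N`; that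
  -- power starts at order `N + 1`.
  have h0 : PowerSeries.coeff N (m.interactionAt x x' τ ^ (N + 1)) = 0 :=
    PowerSeries.X_pow_dvd_iff.1 (m.X_pow_dvd_interactionAt_pow x x' τ (N + 1)) N (by omega)
  simp only [e]
  simp only [mul_add, Finset.sum_add_distrib]
  congr 1
  · rw [expCoeff, Finset.mul_sum]
    exact Finset.sum_congr rfl fun n _ => by ring
  · rw [Finset.sum_range_succ, h0, mul_zero, mul_zero, add_zero, expCoeff, Finset.mul_sum]
    exact Finset.sum_congr rfl fun n _ => by ring

/-- The integral over `τ > s₁ > s₂ > ⋯ > -R` of the product of the vertices of a word. -/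
def iterInt (x x' : Config) : List Letter → ℝ → ℂ
  | [], _ => 1
  | a :: w, τ => ∫ s in (-m.R)..τ, m.vertexValue x x' a s * iterInt x x' w s

theorem continuous_iterInt (x x' : Config) (w : List Letter) : Continuous (m.iterInt x x' w) := by
  induction w with
  | nil => exact continuous_const
  | cons a w ih =>
    exact intervalIntegral.continuous_primitive (fun _ _ =>
      ((m.continuous_vertexValue x x' a).mul ih).intervalIntegrable _ _) _

theorem hasDerivAt_iterInt (x x' : Config) (a : Letter) (w : List Letter) (τ : ℝ) :
    HasDerivAt (m.iterInt x x' (a :: w)) (m.vertexValue x x' a τ * m.iterInt x x' w τ) τ := by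
  have hc := (m.continuous_vertexValue x x' a).mul (m.continuous_iterInt x x' w)
  exact intervalIntegral.integral_hasDerivAt_right (hc.intervalIntegrable _ _)
    hc.aestronglyMeasurable.stronglyMeasurableAtFilter hc.continuousAt

theorem hasDerivAt_wordSum_iterInt (x x' : Config) (a : Letter) (l : List (List Letter)) (τ : ℝ) :
    HasDerivAt (fun t => wordSum (fun w => m.iterInt x x' (a :: w) t) l)
      (m.vertexValue x x' a τ * wordSum (fun w => m.iterInt x x' w τ) l) τ := by
  induction l with
  | nil => simpa using hasDerivAt_const τ (0 : ℂ)
  | cons w l ih =>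
    simp only [wordSum_cons, mul_add]
    exact (m.hasDerivAt_iterInt x x' a w τ).add ih

theorem eq_of_hasDerivAt {g h g' : ℝ → ℂ} (hg : ∀ t, HasDerivAt g (g' t) t)
    (hh : ∀ t, HasDerivAt h (g' t) t) {a : ℝ} (ha : g a = h a) : g = h := by
  have hd : ∀ t, HasDerivAt (g - h) 0 t := fun t => by
    simpa using (hg t).sub (hh t)
  funext t
  have := is_const_of_deriv_eq_zero (fun t => (hd t).differentiableAt) (fun t => (hd t).deriv) t a
  simpa [ha, sub_eq_zero] using this

/-- Both sides satisfy the same differential equations in the cut time and have the same value at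
`-R`. This replaces the decomposition of a power of an integral into its `n!` time orderings. -/
theorem expCoeff_eq_wordSum (x x' : Config) (N : ℕ) :
    m.expCoeff x x' N = fun τ => wordSum (fun w => m.iterInt x x' w τ) (freeWords N) := by
  induction N using freeWords.induct with
  | case1 =>
    funext τ
    simp [expCoeff_zero, freeWords, iterInt]
  | case2 =>
    refine eq_of_hasDerivAt (m.hasDerivAt_expCoeff_one x x') (fun τ => ?_) (a := -m.R) ?_
    · have := m.hasDerivAt_wordSum_iterInt x x' drift [[]] τ
      simpa [freeWords, iterInt] using this
    · rw [m.expCoeff_succ_neg_R x x' 0]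
      simp [freeWords, iterInt]
  | case3 N ih1 ih2 =>
    refine eq_of_hasDerivAt (m.hasDerivAt_expCoeff_add_two x x' N) (fun τ => ?_) (a := -m.R) ?_
    · simp only [freeWords, wordSum_append, wordSum_map, ih1, ih2]
      exact (m.hasDerivAt_wordSum_iterInt x x' drift _ τ).add
        (m.hasDerivAt_wordSum_iterInt x x' pair _ τ)
    · rw [m.expCoeff_succ_neg_R x x' (N + 1)]
      simp only [freeWords, wordSum_append, wordSum_map]
      rw [wordSum_eq_zero, wordSum_eq_zero, add_zero] <;> intro w _ <;> simp [iterInt]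

/-- The product of the vertices of a word at the times `u 0, u 1, …`. -/
def vertexProd (x x' : Config) : List Letter → (ℕ → ℝ) → ℂ
  | [], _ => 1
  | a :: w, u => m.vertexValue x x' a (u 0) * vertexProd x x' w fun n => u (n + 1)

theorem measurable_vertexProd (x x' : Config) (w : List Letter) :
    Measurable (m.vertexProd x x' w) := by
  induction w with
  | nil => exact measurable_const
  | cons a w ih =>
    exact ((m.continuous_vertexValue x x' a).measurable.comp (measurable_pi_apply 0)).mul
      (ih.comp (measurable_pi_iff.2 fun n => measurable_pi_apply (n + 1)))

theorem exists_norm_vertexProd_le (x x' : Config) (w : List Letter) :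
    ∃ M, ∀ u, ‖m.vertexProd x x' w u‖ ≤ M := by
  induction w with
  | nil => exact ⟨1, fun u => by simp [vertexProd]⟩
  | cons a w ih =>
    obtain ⟨M, hM⟩ := ih
    obtain ⟨C, hC⟩ := m.exists_norm_vertexValue_le x x' a
    refine ⟨C * M, fun u => ?_⟩
    rw [vertexProd, norm_mul]
    exact mul_le_mul (hC _) (hM _) (norm_nonneg _) ((norm_nonneg _).trans (hC 0))

theorem iterInt_eq_nest (x x' : Config) (w : List Letter) (hw : noise ∉ w) :
    ∀ τ ∈ Icc (-m.R) m.R, m.iterInt x x' w τ = nest m.R 0 0 w 0 τ (m.vertexProd x x' w) := by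
  induction w with
  | nil => intro τ _; rfl
  | cons a w ih =>
    intro τ hτ
    have hw' : noise ∉ w := fun h => hw (List.mem_cons_of_mem _ h)
    have ha : ∀ s, weight 0 a s = 1 := fun s => by
      cases a
      · rfl
      · simp at hw
      · rfl
    rw [iterInt, nest, ← integral_slab_G hτ]
    refine integral_congr_ae ?_
    have hmem : ∀ᵐ s ∂slab m.R, s ∈ Icc (-m.R) m.R := ae_restrict_mem measurableSet_Icc
    filter_upwards [hmem] with s hs
    rw [ih hw' s hs, ha, one_mul, ← nest_const_mul]
    rfl

theorem coeff_formalExp_eq_wordSum (x x' : Config) (N : ℕ) :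
    PowerSeries.coeff N (formalExp (interaction m.χ m.σ m.α m.β)) x x' =
      wordSum (fun w => nest m.R 0 0 w 0 m.R (m.vertexProd x x' w)) (freeWords N) := by
  rw [coeff_formalExp, expCoeff_eq_wordSum]
  exact wordSum_congr fun w hw => m.iterInt_eq_nest x x' w
    (noise_notMem_of_mem_freeWords N w hw) _ ⟨by linarith [m.R_pos], le_rfl⟩

end Model

end MSR
end
noncomputable section
namespace MSR

open MeasureTheory Filter Topology Set Letter

/-! ### Nested integrals as integrals over boxes -/

/-- The sequence that continues a finite tuple by zero. -/
def seq {n : ℕ} (s : Fin n → ℝ) : ℕ → ℝ := fun i => if h : i < n then s ⟨i, h⟩ else 0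

theorem seq_apply {n : ℕ} (s : Fin n → ℝ) (i : Fin n) : seq s i = s i := by simp [seq]

theorem seq_cons {n : ℕ} (r : ℝ) (s : Fin n → ℝ) :
    seq (Fin.cons r s : Fin (n + 1) → ℝ) = cons r (seq s) := by
  funext i
  cases i with
  | zero => rfl
  | succ i =>
    simp only [seq, cons_succ, Nat.add_lt_add_iff_right]
    split_ifs with h
    · exact Fin.cons_succ (α := fun _ => ℝ) r s ⟨i, h⟩
    · rfl

theorem measurable_seq {n : ℕ} : Measurable (seq : (Fin n → ℝ) → ℕ → ℝ) := by
  refine measurable_pi_iff.2 fun i => ?_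
  by_cases h : i < n
  · simpa only [seq, h, dif_pos] using measurable_pi_apply _
  · simpa only [seq, h, dif_neg, not_false_eq_true] using measurable_const

/-- The indicator function of `τ > u 0 > u 1 > ⋯ > u (n - 1)`. -/
def simplexAt : ℕ → ℝ → (ℕ → ℝ) → ℂ
  | 0, _, _ => 1
  | n + 1, τ, u => G τ (u 0) * simplexAt n (u 0) fun i => u (i + 1)

theorem measurable_simplexAt (n : ℕ) :
    Measurable fun q : ℝ × (ℕ → ℝ) => simplexAt n q.1 q.2 := by
  induction n with
  | zero => exact measurable_const
  | succ n ih =>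
    have h0 : Measurable fun q : ℝ × (ℕ → ℝ) => q.2 0 :=
      (measurable_pi_apply 0).comp measurable_snd
    exact (measurable_ofReal_G measurable_fst h0).mul (ih.comp (h0.prodMk
      (measurable_pi_iff.2 fun i => (measurable_pi_apply (i + 1)).comp measurable_snd)))

theorem norm_simplexAt_le (n : ℕ) : ∀ (τ : ℝ) (u : ℕ → ℝ), ‖simplexAt n τ u‖ ≤ 1 := by
  induction n with
  | zero => intro τ u; simp [simplexAt]
  | succ n ih =>
    intro τ u
    rw [simplexAt, norm_mul]
    exact mul_le_one₀ (norm_G_le _ _) (norm_nonneg _) (ih _ _)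

theorem lt_of_simplexAt_ne_zero (n : ℕ) : ∀ (τ : ℝ) (u : ℕ → ℝ), simplexAt n τ u ≠ 0 →
    (∀ i < n, u i < τ) ∧ ∀ i j, i < j → j < n → u j < u i := by
  induction n with
  | zero => intro τ u _; exact ⟨fun i hi => absurd hi (by omega), fun i j _ hj => absurd hj (by omega)⟩
  | succ n ih =>
    intro τ u h
    rw [simplexAt] at h
    obtain ⟨h1, h2⟩ := ih _ _ (right_ne_zero_of_mul h)
    have h0 : u 0 < τ := by
      by_contra! hle
      exact left_ne_zero_of_mul h (by rw [G_of_le hle, Complex.ofReal_zero])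
    refine ⟨fun i hi => ?_, fun i j hij hj => ?_⟩
    · cases i with
      | zero => exact h0
      | succ i => exact (h1 i (by omega)).trans h0
    · obtain ⟨j, rfl⟩ := Nat.exists_eq_succ_of_ne_zero (by omega : j ≠ 0)
      cases i with
      | zero => exact h1 j (by omega)
      | succ i => exact h2 i j (by omega) (by omega)

/-- Without `noise` all weights are one, and Fubini splits off the latest time from the integral
over the ordered region of the box. -/
theorem nest_eq_integral {R M : ℝ} (w : List Letter) (hw : noise ∉ w) :
    ∀ (τ : ℝ) (c : (ℕ → ℝ) → ℂ), Measurable c → (∀ u, ‖c u‖ ≤ M) →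
    nest R 0 0 w 0 τ c = ∫ s, simplexAt w.length τ (seq s) * c (seq s)
      ∂boxMeasure (Fin w.length) R := by
  induction w with
  | nil =>
    intro τ c _ _
    rw [boxMeasure, List.length_nil, Measure.pi_of_empty, integral_dirac]
    simp only [nest, simplexAt, one_mul]
    congr 1
  | cons a w ih =>
    intro τ c hc hM
    have hw' : noise ∉ w := fun h => hw (List.mem_cons_of_mem _ h)
    have ha : ∀ s, weight 0 a s = 1 := fun s => by
      cases a
      · rfl
      · simp at hw
      · rfl
    have hcc : ∀ s, Measurable fun u => c (cons s u) := fun s =>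
      hc.comp (measurable_cons.comp (measurable_const.prodMk measurable_id))
    have hmp := measurePreserving_piFinSuccAbove (fun _ : Fin (w.length + 1) => slab R) 0
    have hsplit := hmp.symm.integral_comp'
      (g := fun s => simplexAt (w.length + 1) τ (seq s) * c (seq s))
    have hcons : ∀ q : ℝ × (Fin w.length → ℝ),
        (MeasurableEquiv.piFinSuccAbove (fun _ : Fin (w.length + 1) => ℝ) 0).symm q =
          Fin.cons q.1 q.2 := fun q => Fin.insertNth_zero' q.1 q.2
    have hval : ∀ q : ℝ × (Fin w.length → ℝ), simplexAt (w.length + 1) τ (seq (Fin.cons q.1 q.2 :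
        Fin (w.length + 1) → ℝ)) * c (seq (Fin.cons q.1 q.2 : Fin (w.length + 1) → ℝ)) =
        (G τ q.1 : ℂ) * (simplexAt w.length q.1 (seq q.2) * c (cons q.1 (seq q.2))) := fun q => by
      rw [seq_cons, ← mul_assoc]
      rfl
    simp only [hcons, hval] at hsplit
    have hpair : Measurable fun q : ℝ × (Fin w.length → ℝ) => (q.1, seq q.2) :=
      measurable_fst.prodMk (measurable_seq.comp measurable_snd)
    have hmeas : Measurable fun q : ℝ × (Fin w.length → ℝ) =>
        (G τ q.1 : ℂ) * (simplexAt w.length q.1 (seq q.2) * c (cons q.1 (seq q.2))) :=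
      (measurable_ofReal_G measurable_const measurable_fst).mul
        (((measurable_simplexAt w.length).comp hpair).mul (hc.comp (measurable_cons.comp hpair)))
    have hint : Integrable (fun q : ℝ × (Fin w.length → ℝ) =>
        (G τ q.1 : ℂ) * (simplexAt w.length q.1 (seq q.2) * c (cons q.1 (seq q.2))))
        ((slab R).prod (boxMeasure (Fin w.length) R)) := by
      refine Integrable.of_bound hmeas.aestronglyMeasurable (C := 1 * (1 * M))
        (Eventually.of_forall fun q => ?_)
      rw [norm_mul, norm_mul]
      exact mul_le_mul (norm_G_le _ _) (mul_le_mul (norm_simplexAt_le _ _ _) (hM _) (norm_nonneg _)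
        zero_le_one) (by positivity) zero_le_one
    refine Eq.trans ?_ hsplit
    refine Eq.trans ?_ (integral_prod _ hint).symm
    rw [nest]
    congr 1
    funext s
    rw [ha, one_mul, ih hw' s _ (hcc s) fun u => hM _]
    exact (integral_const_mul _ _).symm

theorem integral_boxMeasure_sum {I J : Type} [Fintype I] [Fintype J] (R : ℝ)
    (h : (I → ℝ) → (J → ℝ) → ℂ) :
    ∫ p, h (fun i => p (Sum.inl i)) (fun j => p (Sum.inr j)) ∂boxMeasure (I ⊕ J) R =
      ∫ q, h q.1 q.2 ∂(boxMeasure I R).prod (boxMeasure J R) :=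
  (measurePreserving_sumPiEquivProdPi (fun _ : I ⊕ J => slab R)).integral_comp'
    (g := fun q => h q.1 q.2)

theorem integral_boxMeasure {I : Type} [Fintype I] {R : ℝ} {h : (I → ℝ) → ℂ}
    (h0 : ∀ t, h t ≠ 0 → ∀ i, t i ∈ Icc (-R) R) : ∫ t, h t ∂boxMeasure I R = ∫ t, h t := by
  have e : boxMeasure I R = volume.restrict (univ.pi fun _ => Icc (-R) R) := by
    rw [volume_pi, Measure.restrict_pi_pi]
    rfl
  rw [e, setIntegral_eq_integral_of_forall_compl_eq_zero]
  intro t ht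
  by_contra hne
  exact ht fun i _ => h0 t hne i

/-! ### Families of polynomials with coefficients in `boxAlg` -/

/-- The family of polynomials has coefficients in `boxAlg J R`. -/
def IsFamily {J ι : Type} (R : ℝ) (Q : (J → ℝ) → MvPolynomial ι ℂ) : Prop :=
  ∃ Q' : MvPolynomial ι (boxAlg J R), ∀ p, MvPolynomial.map (atPoint p) Q' = Q p

namespace IsFamily

variable {J ι : Type} {R : ℝ} {P Q : (J → ℝ) → MvPolynomial ι ℂ}

theorem C {h : (J → ℝ) → ℂ} (hh : h ∈ boxAlg J R) :
    IsFamily R fun p => (MvPolynomial.C (h p) : MvPolynomial ι ℂ) :=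
  ⟨MvPolynomial.C ⟨h, hh⟩, fun _ => MvPolynomial.map_C _ _⟩

theorem X (i : ι) : IsFamily R fun _ : J → ℝ => (MvPolynomial.X i : MvPolynomial ι ℂ) :=
  ⟨MvPolynomial.X i, fun _ => MvPolynomial.map_X _ _⟩

theorem add (hP : IsFamily R P) (hQ : IsFamily R Q) : IsFamily R fun p => P p + Q p := by
  obtain ⟨P', hP'⟩ := hP
  obtain ⟨Q', hQ'⟩ := hQ
  exact ⟨P' + Q', fun p => by rw [map_add, hP', hQ']⟩

theorem mul (hP : IsFamily R P) (hQ : IsFamily R Q) : IsFamily R fun p => P p * Q p := by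
  obtain ⟨P', hP'⟩ := hP
  obtain ⟨Q', hQ'⟩ := hQ
  exact ⟨P' * Q', fun p => by rw [map_mul, hP', hQ']⟩

theorem pow (hP : IsFamily R P) (n : ℕ) : IsFamily R fun p => P p ^ n := by
  obtain ⟨P', hP'⟩ := hP
  exact ⟨P' ^ n, fun p => by rw [map_pow, hP']⟩

theorem smul {h : (J → ℝ) → ℂ} (hh : h ∈ boxAlg J R) (hQ : IsFamily R Q) :
    IsFamily R fun p => h p • Q p := by
  simpa only [MvPolynomial.smul_eq_C_mul] using (C hh).mul hQ

theorem zero : IsFamily R fun _ : J → ℝ => (0 : MvPolynomial ι ℂ) := ⟨0, fun _ => map_zero _⟩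

theorem rename {κ : Type} (φ : ι → κ) (hQ : IsFamily R Q) :
    IsFamily R fun p => MvPolynomial.rename φ (Q p) := by
  obtain ⟨Q', hQ'⟩ := hQ
  exact ⟨MvPolynomial.rename φ Q', fun p => by rw [MvPolynomial.map_rename, hQ']⟩

theorem prod_map {κ : Type} (l : List κ) {Q : κ → (J → ℝ) → MvPolynomial ι ℂ}
    (hQ : ∀ v ∈ l, IsFamily R (Q v)) : IsFamily R fun p => (l.map fun v => Q v p).prod := by
  induction l with
  | nil => exact ⟨1, fun p => by simp⟩
  | cons v l ih =>
    simp only [List.map_cons, List.prod_cons]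
    exact (hQ v (by simp)).mul (ih fun v' hv' => hQ v' (by simp [hv']))

end IsFamily

theorem continuous_mem_boxAlg {J : Type} (R : ℝ) {h : (J → ℝ) → ℂ} [Fintype J] (hh : Continuous h) :
    h ∈ boxAlg J R := by
  obtain ⟨C, hC⟩ := (isCompact_univ_pi fun _ : J => isCompact_Icc (a := -R) (b := R)
    ).exists_bound_of_continuousOn hh.continuousOn
  exact ⟨hh.measurable, C, fun p hp => hC p fun j _ => hp j⟩

section families

variable (m : Model) {J : Type} [Fintype J] {R : ℝ}

theorem isFamily_polyIn {J : Type} (γ : Polynomial Config) (j : J) :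
    IsFamily R fun p : J → ℝ => polyIn γ (p j) (MvPolynomial.X j : MvPolynomial J ℂ) := by
  induction γ using Polynomial.induction_on' with
  | add q r hq hr =>
    have : ∀ p : J → ℝ, polyIn (q + r) (p j) (MvPolynomial.X j : MvPolynomial J ℂ) =
        polyIn q (p j) (MvPolynomial.X j) + polyIn r (p j) (MvPolynomial.X j) :=
      fun p => by simp [polyIn, Polynomial.map_add]
    simp only [this]
    exact hq.add hr
  | monomial n y =>
    have : ∀ p : J → ℝ, polyIn (Polynomial.monomial n y) (p j) (MvPolynomial.X j : MvPolynomial J ℂ)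
        = MvPolynomial.C (toC y (p j)) * MvPolynomial.X j ^ n := fun p => by
      simp only [polyIn, Polynomial.map_monomial, Polynomial.aeval_monomial,
        MvPolynomial.algebraMap_eq]
      rfl
    simp only [this]
    exact (IsFamily.C (coord R y j).2).mul ((IsFamily.X j).pow n)

theorem isFamily_vertex (v : Letter × J) : IsFamily R fun p : J → ℝ => vertex m p v := by
  have hχ : Continuous fun p : J → ℝ => (m.χ (p v.2) : ℂ) :=
    Complex.continuous_ofReal.comp (m.continuous.comp (continuous_apply v.2))
  have hp := fun γ => isFamily_polyIn (R := R) γ v.2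
  have hl : IsFamily R fun p : J → ℝ =>
      m.lin v.1 (p v.2) (MvPolynomial.X v.2 : MvPolynomial J ℂ) := by
    cases v.1
    · exact IsFamily.smul (continuous_mem_boxAlg R hχ) (hp _)
    · exact IsFamily.smul (continuous_mem_boxAlg R (continuous_const.mul hχ)) (hp _)
    · exact IsFamily.smul (continuous_mem_boxAlg R (continuous_const.mul (hχ.pow 2)))
        ((hp _).mul (hp _))
  have hq : IsFamily R fun p : J → ℝ =>
      m.quad v.1 (p v.2) (MvPolynomial.X v.2 : MvPolynomial J ℂ) := by
    cases v.1
    · exact IsFamily.zero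
    · exact IsFamily.zero
    · exact IsFamily.smul (continuous_mem_boxAlg R (continuous_const.mul (hχ.pow 2))) ((hp _).pow 2)
  have hX := IsFamily.X (R := R) (J := J) (Sum.inr v.2 : J ⊕ J)
  exact (hX.mul (hl.rename _)).add (hX.mul (hX.mul (hq.rename _)))

end families

theorem isFamily_multilocal {k n : ℕ} {R : ℝ} (F : Multilocal k) :
    IsFamily R fun p : Fin k ⊕ Fin n → ℝ =>
      MvPolynomial.map (evalAt fun i => p (Sum.inl i)) F := by
  induction F using MvPolynomial.induction_on with
  | C a =>
    simp only [MvPolynomial.map_C]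
    exact IsFamily.C (continuous_mem_boxAlg R
      ((show ContDiff ℝ ∞ (a : (Fin k → ℝ) → ℂ) from a.2).continuous.comp
        (continuous_pi fun i => continuous_apply (Sum.inl i))))
  | add p q hp hq => simpa only [map_add] using hp.add hq
  | mul_X p i hp =>
    simp only [map_mul, MvPolynomial.map_X]
    exact hp.mul (IsFamily.X i)

/-! ### The kernels of the words -/

/-- The letters of a word with their positions. -/
def positions (w : List Letter) : List (Letter × Fin w.length) := List.ofFn fun i => (w.get i, i)

theorem length_positions (w : List Letter) : (positions w).length = w.length := by simp [positions]

theorem map_fst_positions (w : List Letter) : (positions w).map Prod.fst = w := by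
  simp [positions, List.map_ofFn, Function.comp_def]

theorem linDer_rename_congr {I J : Type} [Fintype J] {c d : J → ℂ} (φ : I → J)
    (h : ∀ i, c (φ i) = d (φ i)) (P : MvPolynomial I ℂ) :
    linDer c (MvPolynomial.rename φ P) = linDer d (MvPolynomial.rename φ P) := by
  induction P using MvPolynomial.induction_on with
  | C a => simp [MvPolynomial.derivation_C]
  | add p q hp hq => simp only [map_add, hp, hq]
  | mul_X p i hp =>
    rw [map_mul, MvPolynomial.rename_X, Derivation.leibniz, Derivation.leibniz, hp, linDer_X,
      linDer_X, h]

section kernel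

variable (m : Model) {k : ℕ} (F : Multilocal k) (f : (Fin k → ℝ) → ℂ) (w : List Letter)

/-- The polynomial `f F` at the times `p`. -/
def observable (p : Fin k ⊕ Fin w.length → ℝ) : MvPolynomial (Fin k ⊕ Fin w.length) ℂ :=
  f (fun i => p (Sum.inl i)) •
    MvPolynomial.rename Sum.inl (MvPolynomial.map (evalAt fun i => p (Sum.inl i)) F)

/-- The vertices of a word. -/
def vertices : List (Letter × (Fin k ⊕ Fin w.length)) :=
  (positions w).map fun v => (v.1, Sum.inr v.2)

/-- The kernel of the contribution of a word to `e ^ ⟨V⟩ ⟨F, f⟩`. -/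
def wordKernel (p : Fin k ⊕ Fin w.length → ℝ) :
    MvPolynomial ((Fin k ⊕ Fin w.length) ⊕ (Fin k ⊕ Fin w.length)) ℂ :=
  simplexAt w.length m.R (seq fun j => p (Sum.inr j)) •
    (MvPolynomial.rename Sum.inl (observable F f w p) * ((vertices w).map (vertex m p)).prod)

variable {f}

theorem isFamily_wordKernel (hf : Continuous f) : IsFamily m.R (wordKernel m F f w) := by
  have hu : Measurable fun p : Fin k ⊕ Fin w.length → ℝ => (m.R, seq fun j => p (Sum.inr j)) :=
    measurable_const.prodMk (measurable_seq.comp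
      (measurable_pi_iff.2 fun j => measurable_pi_apply (Sum.inr j)))
  have hS : (fun p : Fin k ⊕ Fin w.length → ℝ =>
      simplexAt w.length m.R (seq fun j => p (Sum.inr j))) ∈ boxAlg _ m.R :=
    ⟨(measurable_simplexAt w.length).comp hu, 1, fun p _ => norm_simplexAt_le _ _ _⟩
  refine IsFamily.smul hS (IsFamily.mul (IsFamily.rename _ (IsFamily.smul (continuous_mem_boxAlg m.R
    (hf.comp (continuous_pi fun i => continuous_apply (Sum.inl i))))
    ((isFamily_multilocal F).rename _))) ?_)
  exact IsFamily.prod_map _ fun v _ => isFamily_vertex m v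

theorem eval_vertex {J : Type} [Fintype J] (p : J → ℝ) (x x' : Config) (v : Letter × J) :
    MvPolynomial.eval (Sum.elim (fun j => toC x (p j)) fun j => toC x' (p j)) (vertex m p v) =
      m.vertexValue x x' v.1 (p v.2) := by
  have h : ∀ P : MvPolynomial J ℂ, MvPolynomial.eval (fun j => toC x (p j)) P =
      MvPolynomial.aeval (fun j => toC x (p j)) P := fun P => by
    rw [MvPolynomial.aeval_eq_eval]
  rw [vertex, Model.vertexValue, map_add, map_mul, map_mul, map_mul, MvPolynomial.eval_X,
    MvPolynomial.eval_rename, MvPolynomial.eval_rename, Sum.elim_inr, Sum.elim_comp_inl, h, h,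
    m.map_lin, m.map_quad, MvPolynomial.aeval_X]

theorem prod_ofFn_vertexValue (x x' : Config) : ∀ u : ℕ → ℝ,
    ∏ i : Fin w.length, m.vertexValue x x' (w.get i) (u i) = m.vertexProd x x' w u := by
  induction w with
  | nil => intro u; rfl
  | cons a w ih =>
    intro u
    rw [Model.vertexProd, ← ih]
    exact Fin.prod_univ_succ _

theorem eval_wordKernel (x x' : Config) (p : Fin k ⊕ Fin w.length → ℝ) :
    MvPolynomial.eval (Sum.elim (fun j => toC x (p j)) fun j => toC x' (p j))
      (wordKernel m F f w p) =
      (f (fun i => p (Sum.inl i)) * F.eval₂ (evalAt fun i => p (Sum.inl i))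
        fun i => toC x (p (Sum.inl i))) *
      (simplexAt w.length m.R (seq fun j => p (Sum.inr j)) *
        m.vertexProd x x' w (seq fun j => p (Sum.inr j))) := by
  have hprod : MvPolynomial.eval (Sum.elim (fun j => toC x (p j)) fun j => toC x' (p j))
      ((vertices w).map (vertex m p)).prod = m.vertexProd x x' w (seq fun j => p (Sum.inr j)) := by
    rw [map_list_prod, vertices, List.map_map, List.map_map, positions, List.map_ofFn,
      List.prod_ofFn, ← prod_ofFn_vertexValue]
    refine Finset.prod_congr rfl fun i _ => ?_
    simp only [Function.comp_apply, eval_vertex, seq_apply]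
  rw [wordKernel, MvPolynomial.smul_eval, map_mul, hprod, MvPolynomial.eval_rename,
    Sum.elim_comp_inl, observable, MvPolynomial.smul_eval, MvPolynomial.eval_rename,
    MvPolynomial.eval_map]
  simp only [Function.comp_def]
  ring

theorem iterate_contract_wordKernel_eq_zero (p : Fin k ⊕ Fin w.length → ℝ) (n : ℕ)
    (hn : 2 * w.length + 1 ≤ n) : (contract (prop p))^[n] (wordKernel m F f w p) = 0 := by
  rw [wordKernel, ← Module.End.pow_apply, map_smul, Module.End.pow_apply,
    iterate_contract_vertices_eq_zero m _ _ _ (by simpa [vertices, length_positions] using hn),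
    smul_zero]

theorem toState_observable (p : Fin k ⊕ Fin w.length → ℝ) :
    toState m p (observable F f w p) =
      f (fun i => p (Sum.inl i)) • F.initState m.x₀ fun i => p (Sum.inl i) := by
  rw [observable, map_smul, Multilocal.initState]
  congr 1
  rw [toState, MvPolynomial.aeval_rename, MvPolynomial.aeval_def, MvPolynomial.eval₂_map]
  rfl

/-- The observable involves only observation times, where both derivations have the same
coefficients. It provides the initial invariant for `eval_vertexActs`. -/
theorem propDer_observable (p : Fin k ⊕ Fin w.length → ℝ) (l : Fin k ⊕ Fin w.length) :
    propDer (prop p) l (observable F f w p) = fullDer p l (observable F f w p) := by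
  have h := linDer_rename_congr (c := fun j => prop p j l)
    (d := Sum.elim (fun i => prop p (Sum.inl i) l) 1) Sum.inl (fun i => rfl)
    (MvPolynomial.map (evalAt fun i => p (Sum.inl i)) F)
  rw [observable, Derivation.map_smul, Derivation.map_smul]
  exact congrArg _ h

/-- Off the simplex both sides vanish. On it the times of the letters decrease, so the exponential
of the contraction is the ordered product of vertex operators, whose value at `x₀` is the kernel of
the word. -/
theorem eval_sum_contract_wordKernel (p : Fin k ⊕ Fin w.length → ℝ) (M : ℕ)
    (hM : 2 * w.length + 1 ≤ M) :
    MvPolynomial.eval (fun j => toC m.x₀ (p j)) (∑ n ∈ Finset.range M, ((n.factorial : ℂ))⁻¹ •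
      dropTilde ((contract (prop p))^[n] (wordKernel m F f w p))) =
    simplexAt w.length m.R (seq fun j => p (Sum.inr j)) *
      m.kern w (fun i => p (Sum.inl i))
        (f (fun i => p (Sum.inl i)) • F.initState m.x₀ fun i => p (Sum.inl i))
        (seq fun j => p (Sum.inr j)) := by
  by_cases hS : simplexAt w.length m.R (seq fun j => p (Sum.inr j)) = 0
  · have h0 : wordKernel m F f w p = 0 := by rw [wordKernel, hS, zero_smul]
    rw [h0, hS, zero_mul, Finset.sum_eq_zero, map_zero]
    intro n _
    rw [Function.iterate_fixed (map_zero _), map_zero, smul_zero]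
  · obtain ⟨_, hlt⟩ := lt_of_simplexAt_ne_zero _ _ _ hS
    have hpos : (positions w).Pairwise fun v v' => p (Sum.inr v'.2) < p (Sum.inr v.2) := by
      rw [positions, List.pairwise_ofFn]
      intro i j hij
      have := hlt i j hij j.2
      rwa [seq_apply, seq_apply] at this
    have hord : Ordered p (vertices w) := by
      rw [Ordered, vertices, List.pairwise_map]
      exact hpos
    have hexp := ((hasExp_vertices m (vertices w) hord (observable F f w p)).smul
      (simplexAt w.length m.R (seq fun j => p (Sum.inr j)))).mono
      (show 2 * (vertices (k := k) w).length + 1 ≤ M by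
        simpa [vertices, length_positions] using hM)
    have hev := eval_vertexActs m p (positions w) hpos (observable F f w p)
      (seq fun j => p (Sum.inr j)) (fun v _ => propDer_observable F w p _) fun i hi => by
        have hi' : i < w.length := by rwa [length_positions] at hi
        have := seq_apply (fun j => p (Sum.inr j)) (⟨i, hi'⟩ : Fin w.length)
        simpa [positions] using this
    rw [map_fst_positions, toState_observable] at hev
    have hsum : ∑ n ∈ Finset.range M, ((n.factorial : ℂ))⁻¹ •
        dropTilde ((contract (prop p))^[n] (wordKernel m F f w p)) = _ := hexp.2
    rw [hsum, MvPolynomial.smul_eval]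
    exact congrArg _ hev

end kernel

theorem wordSum_mul (φ : List Letter → ℂ) (l : List (List Letter)) (c : ℂ) :
    wordSum φ l * c = wordSum (fun w => φ w * c) l := by
  induction l with
  | nil => simp
  | cons w l ih => simp [add_mul, ih]

theorem length_le_of_mem_freeWords (N : ℕ) : ∀ w ∈ freeWords N, w.length ≤ N := by
  induction N using freeWords.induct with
  | case1 => simp [freeWords]
  | case2 => simp [freeWords]
  | case3 N ih1 ih2 =>
    intro w hw
    simp only [freeWords, List.mem_append, List.mem_map] at hw
    rcases hw with ⟨v, hv, rfl⟩ | ⟨v, hv, rfl⟩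
    · have := ih1 v hv
      simpa using this
    · have := ih2 v hv
      simp only [List.length_cons]
      omega

/-! ### The coefficients of the response-field expectation -/

namespace Model

variable (m : Model) {k : ℕ} (F : Multilocal k) {f : (Fin k → ℝ) → ℂ}

/-- Observation and vertex times are independent, so the integral over the joint box factorizes. The
box contains the support of `f`, and hence the observable factor is the full smeared functional. -/
theorem smeared_mul_nest (hfR : ∀ t, f t ≠ 0 → ∀ i, t i ∈ Icc (-m.R) m.R) (w : List Letter)
    (hw : noise ∉ w) (Q : MvPolynomial _ (boxAlg (Fin k ⊕ Fin w.length) m.R))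
    (hQ : ∀ p, MvPolynomial.map (atPoint p) Q = wordKernel m F f w p) (x x' : Config) :
    nest m.R 0 0 w 0 m.R (m.vertexProd x x' w) * smeared F f x = kernelFn Q x x' := by
  obtain ⟨M, hM⟩ := m.exists_norm_vertexProd_le x x' w
  rw [kernelFn_eq_integral]
  simp only [hQ, eval_wordKernel]
  rw [integral_boxMeasure_sum m.R fun t s => (f t * F.eval₂ (evalAt t) fun i => toC x (t i)) *
    (simplexAt w.length m.R (seq s) * m.vertexProd x x' w (seq s))]
  rw [integral_prod_mul (fun t => f t * F.eval₂ (evalAt t) fun i => toC x (t i))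
    fun s => simplexAt w.length m.R (seq s) * m.vertexProd x x' w (seq s),
    ← nest_eq_integral w hw _ _ (m.measurable_vertexProd x x' w) hM,
    integral_boxMeasure fun t ht => hfR t (left_ne_zero_of_mul ht), mul_comm]
  rfl

theorem coeff_msrExpectation (hf : Continuous f) (hfc : HasCompactSupport f)
    (hfR : ∀ t, f t ≠ 0 → ∀ i, t i ∈ Icc (-m.R) m.R) (N : ℕ) :
    PowerSeries.coeff N (msrExpectation m.χ m.σ m.α m.β m.x₀ F f) =
      wordSum (fun w => m.wordFn (boxMeasure (Fin k) m.R)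
        (fun t => f t • F.initState m.x₀ t) w 0) (freeWords N) := by
  choose Q hQ using fun w => isFamily_wordKernel m F w hf
  have hcoeff : PowerSeries.coeff N (formalExp (interaction m.χ m.σ m.α m.β) *
      PowerSeries.C (fun x _ : Config => smeared F f x)) =
      wordSum (fun w => kernelFn (Q w)) (freeWords N) := by
    funext x x'
    rw [PowerSeries.coeff_mul_C, Pi.mul_apply, Pi.mul_apply, coeff_formalExp_eq_wordSum,
      wordSum_apply, wordSum_apply, wordSum_mul]
    refine wordSum_congr fun w hw => ?_
    exact m.smeared_mul_nest F hfR w (noise_notMem_of_mem_freeWords N w hw) (Q w) (hQ w) x x'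
  rw [msrExpectation, PowerSeries.coeff_mk, hcoeff,
    -- A word of order `N` has at most `N` letters with at most two factors `x̃` each, so one
    -- truncation serves all words.
    gammaG_wordSum m.R_pos _ Q (2 * N + 1) (fun w hw p n hn => by
      rw [hQ]
      have := length_le_of_mem_freeWords N w hw
      exact iterate_contract_wordKernel_eq_zero m F w p n (by omega))]
  refine wordSum_congr fun w hw => ?_
  have hlen := length_le_of_mem_freeWords N w hw
  have hw' := noise_notMem_of_mem_freeWords N w hw
  have hPm := coeffIn_measAlg_smul_initState F m.x₀ hf
  obtain ⟨M, hM⟩ := m.exists_norm_kern_le w (fun t : Fin k → ℝ => t)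
    (coeffIn_bddAlg_smul_initState F m.x₀ hf hfc)
  simp only [hQ]
  simp only [fun p => eval_sum_contract_wordKernel m F w (f := f) p (2 * N + 1) (by omega)]
  rw [integral_boxMeasure_sum m.R fun t s => simplexAt w.length m.R (seq s) *
    m.kern w t (f t • F.initState m.x₀ t) (seq s), integral_prod]
  · have h0 : toC 0 = 0 := by funext s; simp [toC]
    rw [wordFn, wordCoeff, h0]
    congr 1
    funext t
    exact (nest_eq_integral w hw' _ _ (m.measurable_kern_fixed w t _) (hM t)).symm
  · have hmeas : Measurable fun q : (Fin k → ℝ) × (Fin w.length → ℝ) =>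
        simplexAt w.length m.R (seq q.2) * m.kern w q.1 (f q.1 • F.initState m.x₀ q.1) (seq q.2) :=
      ((measurable_simplexAt w.length).comp (measurable_const.prodMk
        (measurable_seq.comp measurable_snd))).mul ((m.measurable_kern w measurable_id hPm).comp
          (measurable_fst.prodMk (measurable_seq.comp measurable_snd)))
    refine Integrable.of_bound hmeas.aestronglyMeasurable (C := 1 * M)
      (Eventually.of_forall fun q => ?_)
    rw [norm_mul]
    exact mul_le_mul (norm_simplexAt_le _ _ _) (hM _ _) (norm_nonneg _) zero_le_one

/-- The noise side integrates over the support of `f`, the response side over the box. The integrand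
vanishes together with `f`, so both integrals agree with the one over the whole space. -/
theorem wordFn_congr_measure (hfR : ∀ t, f t ≠ 0 → ∀ i, t i ∈ Icc (-m.R) m.R) (w : List Letter)
    (ξ : Config) : m.wordFn (volume.restrict (tsupport f)) (fun t => f t • F.initState m.x₀ t) w ξ =
      m.wordFn (boxMeasure (Fin k) m.R) (fun t => f t • F.initState m.x₀ t) w ξ := by
  have h0 : ∀ t, f t = 0 → nest m.R (toC ξ) 0 w 0 m.R
      (m.kern w t (f t • F.initState m.x₀ t)) = 0 := fun t ht => by
    have : m.kern w t (f t • F.initState m.x₀ t) = fun _ => 0 := by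
      funext u
      rw [kern_smul, ht, zero_mul]
    rw [this, nest_zero]
  rw [wordFn, wordFn, wordCoeff, wordCoeff,
    setIntegral_eq_integral_of_forall_compl_eq_zero fun t ht =>
      h0 t (image_eq_zero_of_notMem_tsupport ht),
    integral_boxMeasure fun t ht => hfR t fun h => ht (h0 t h)]

end Model

end MSR
end
theorem theorem1 (χ : ℝ → ℝ) (hχ : ContDiff ℝ ∞ χ) (hχc : HasCompactSupport χ)
    (σ : ℝ) (hσ : 0 < σ) (α β : Polynomial MSR.Config) (hαβ : β = 1 ∨ α = 0)
    (x₀ : MSR.Config) (sol : MSR.Config → ℝ → PowerSeries ℝ)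
    (hsol : MSR.IsPerturbativeSolution χ σ α β x₀ sol)
    (k : ℕ) (F : MSR.Multilocal k)
    (f : (Fin k → ℝ) → ℂ) (hf : ContDiff ℝ ∞ f) (hfc : HasCompactSupport f) :
    MSR.sdeExpectation F f sol = MSR.msrExpectation χ σ α β x₀ F f := by
  obtain ⟨a, ha⟩ := hχc.isCompact.isBounded.subset_closedBall 0
  obtain ⟨b, hb⟩ := hfc.isCompact.isBounded.subset_closedBall 0
  let m : MSR.Model :=
    { χ := χ
      σ := σ
      α := α
      β := β
      x₀ := x₀
      -- One radius for both supports: `χ` vanishes from `R` on, and the box of side `R` contains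
      -- the support of `f`. The summand `1` makes `R` positive and strictly larger than the radius
      -- for `χ`.
      R := |a| + |b| + 1
      continuous := hχ.continuous
      σ_nonneg := hσ.le
      R_pos := by positivity
      χ_eq_zero := fun s hs => by
        by_contra hne
        have h1 := ha (subset_tsupport χ hne)
        rw [mem_closedBall_zero_iff, Real.norm_eq_abs] at h1
        linarith [le_abs_self a, abs_nonneg b] }
  have hfR : ∀ t, f t ≠ 0 → ∀ i, t i ∈ Set.Icc (-m.R) m.R := fun t ht i => by
    have h1 := hb (subset_tsupport f ht)
    rw [mem_closedBall_zero_iff] at h1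
    have h2 : |t i| ≤ |a| + |b| + 1 := by
      rw [← Real.norm_eq_abs (t i)]
      linarith [norm_le_pi_norm t i, le_abs_self b, abs_nonneg a]
    exact abs_le.1 h2
  -- At order `N` both sides are the sum over `freeWords N` of the same functionals at zero noise,
  -- up to the choice of measure for the observation times.
  ext N
  have hL := MSR.Model.coeff_sdeExpectation (m := m) hsol F hf.continuous hfc N
  have hR := m.coeff_msrExpectation F hf.continuous hfc hfR N
  rw [hL]
  refine Eq.trans ?_ hR.symm
  exact MSR.wordSum_congr fun w _ => m.wordFn_congr_measure F hfR w 0
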